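/- Algorithms are randomized programs for a random-access machine (finitely many arrays of natural numbers; addition, truncated subtraction, comparison, indirect reading and writing, and a fair coin toss at unit cost; no unit-cost multiplication). A graph on the vertex set $\{0,\dots,n-1\}$ is given by $n$ and its adjacency matrix. An algorithm runs in time $T$ on an input if it halts after at most $T$ steps for every outcome of the coin tosses. Let $\mathcal G(n,\frac12)$ be the Erdős–Rényi distribution on $n$-vertex graphs in which each edge is present independently with probability $\frac12$, and let $\mathcal G(n,\frac12,\kappa)$ be the distribution of a graph drawn from $\mathcal G(n,\frac12)$ to which a clique on a uniformly random set of $\kappa$ vertices is added. The **Strongish Planted Clique Hypothesis (SPCH)** states: there is a constant $\delta\in(0,\frac12)$ such that no randomized algorithm $\mathcal A$ that runs in time $n^{o(\log n)}$ on $n$-vertex graphs satisfies, for all sufficiently large $n$, both $$\Pr_{G\sim\mathcal G(n,\frac12,\lceil n^\delta\rceil)}[\mathcal A(G)=1]\ge \tfrac23 \quad\text{and}\quad \Pr_{G\sim\mathcal G(n,\frac12)}[\mathcal A(G)=1]\le \tfrac13,$$ where the probabilities are over $G$ and the coin tosses of $\mathcal A$. In the Densest $k$-Subgraph problem the input is a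 graph $G=(V,E)$ with $n$ vertices and an integer $1\le k\le n$, and the goal is to output a set $S\subseteq V$ with $|S|=k$ that induces as many edges as possible. For real $C>0$, a randomized algorithm approximates the problem to within a factor $C$ on the instance $(G,k)$ if, with probability at least $\frac23$ over its coin tosses, it outputs a set $S\subseteq V$ with $|S|=k$ such that $|E[S']|\le C\cdot|E[S]|$ for every $S'\subseteq V$ with $|S'|=k$, where $E[S]$ is the set of edges with both endpoints in $S$. **Theorem.** Assume SPCH. Let $C>0$ be a constant, let $f:\mathbb N\to\mathbb R$ be any function and let $e:\mathbb N\to\mathbb R$ be any function with $e(k)=o(k)$ as $k\to\infty$. Then no randomized algorithm that runs in time $f(k)\cdot n^{e(k)}$ on every instance $(G,k)$ of Densest $k$-Subgraph with $n$ vertices approximates Densest $k$-Subgraph to within a factor $C$ on all instances. Furthermore, this holds even in the perfect completeness case: no randomized algorithm with such a running time approximates Densest $k$-Subgraph to within a factor $C$ on all instances $(G,k)$ in which $G$ contains a $k$-clique. -/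

import Mathlib

open Filter MeasureTheory Asymptotics
open scoped ENNReal

noncomputable section

/-! ### Randomized random-access machines

A program manipulates finitely many named arrays of unbounded length whose cells hold natural
numbers, initially zero except for the input. The unit-cost operations are addition, truncated
subtraction, comparison, reading and writing of an (indirectly addressed) cell, and a fair coin
toss. There is no unit-cost multiplication, so that in `t` steps cell contents grow by at most
`O(t)` bits and the model is polynomially equivalent to probabilistic Turing machines. -/

namespace RAM

/-- The memory: `s a i` is the content of cell `i` of array `a`. -/
abbrev Store : Type := ℕ → ℕ → ℕ

/-- Arithmetic expressions; `cell a i` is the content of the cell of array `a` with address `i`. -/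
inductive Expr : Type
  | const (c : ℕ) : Expr
  | cell (a : ℕ) (i : Expr) : Expr
  | add (x y : Expr) : Expr
  | sub (x y : Expr) : Expr

/-- The value of an expression. -/
def Expr.eval (s : Store) : Expr → ℕ
  | const c => c
  | cell a i => s a (i.eval s)
  | add x y => x.eval s + y.eval s
  | sub x y => x.eval s - y.eval s

/-- Programs. -/
inductive Prog : Type
  /-- do nothing -/
  | skip : Prog
  /-- `a[i] := x` -/
  | assign (a : ℕ) (i x : Expr) : Prog
  /-- `a[i] :=` a fresh fair coin toss (`0` or `1`) -/
  | flip (a : ℕ) (i : Expr) : Prog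
  /-- `p; q` -/
  | seq (p q : Prog) : Prog
  /-- if `x < y` then `p` else `q` -/
  | branch (x y : Expr) (p q : Prog) : Prog
  /-- while `x < y` do `p` -/
  | loop (x y : Expr) (p : Prog) : Prog

/-- Overwriting one cell. -/
def Store.set (s : Store) (a i v : ℕ) : Store :=
  fun b j => if b = a ∧ j = i then v else s b j

/-- A configuration: the list of programs that remain to be executed, and the memory. -/
abbrev Config : Type := List Prog × Store

/-- A configuration is halted if nothing remains to be executed. -/
def Config.Halted (c : Config) : Prop := c.1 = []

/-- One step of the machine. Halted configurations do not change any more. -/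
def step : Config → PMF Config
  | ([], s) => PMF.pure ([], s)
  | (.skip :: K, s) => PMF.pure (K, s)
  | (.assign a i x :: K, s) => PMF.pure (K, s.set a (i.eval s) (x.eval s))
  | (.flip a i :: K, s) =>
      (PMF.uniformOfFintype Bool).map fun b => (K, s.set a (i.eval s) b.toNat)
  | (.seq p q :: K, s) => PMF.pure (p :: q :: K, s)
  | (.branch x y p q :: K, s) =>
      PMF.pure (if x.eval s < y.eval s then (p :: K, s) else (q :: K, s))
  | (.loop x y p :: K, s) =>
      PMF.pure (if x.eval s < y.eval s then (p :: .loop x y p :: K, s) else (K, s))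

/-- The distribution of the configuration after `t` steps. -/
def run : ℕ → Config → PMF Config
  | 0, c => PMF.pure c
  | t + 1, c => (step c).bind (run t)

/-- On the initial memory `s`, the program `p` halts, whatever the outcomes of the coin tosses,
after at most `b` steps. -/
def HaltsWithin (p : Prog) (s : Store) (b : ℝ) : Prop :=
  ∃ t : ℕ, (t : ℝ) ≤ b ∧ ∀ c ∈ (run t ([p], s)).support, Config.Halted c

/-- The probability, over the coin tosses, that `p` started on the initial memory `s` halts with
a final memory in `E`. -/
def outputProb (p : Prog) (s : Store) (E : Set Store) : ℝ≥0∞ :=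
  ⨆ t : ℕ, (run t ([p], s)).toOuterMeasure {c | Config.Halted c ∧ c.2 ∈ E}

open Classical in
/-- The initial memory for a graph `G` on `n` vertices and a parameter `k`: the numbers `n` and `k`
stand in cells `0` and `1` of array `0`, and array `1` holds the adjacency matrix, row by row. -/
def input {n : ℕ} (G : SimpleGraph (Fin n)) (k : ℕ) : Store := fun a i =>
  if a = 0 ∧ i = 0 then n
  else if a = 0 ∧ i = 1 then k
  else if a = 1 ∧ ∃ u v : Fin n, i = u * n + v ∧ G.Adj u v then 1
  else 0

/-- Output of a decision algorithm: the final memories with output `1` (in cell `0` of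
array `2`). -/
def accepting : Set Store := {s | s 2 0 = 1}

/-- Output of a set of vertices: vertex `v` is in the set if cell `v` of array `2` is `1`. -/
def outputSet (n : ℕ) (s : Store) : Finset (Fin n) :=
  Finset.univ.filter fun v => s 2 v = 1

end RAM

/-! ### Planted clique -/

/-- The Erdős–Rényi distribution with edge probability `1/2` on graphs with vertex set `Fin n`. -/
def erdosRenyiHalf (n : ℕ) : Measure (SimpleGraph (Fin n)) :=
  SimpleGraph.binomialRandom (Fin n) ⟨1 / 2, by norm_num, by norm_num⟩

/-- The graph `G` with a clique added on the vertex set `S`. -/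
def addClique {n : ℕ} (G : SimpleGraph (Fin n)) (S : Finset (Fin n)) : SimpleGraph (Fin n) :=
  G ⊔ SimpleGraph.fromRel fun u v => u ∈ S ∧ v ∈ S

/-- The Erdős–Rényi distribution with edge probability `1/2` and a planted `κ`-clique (for
`κ ≤ n`): a clique is added on a uniformly random set of `κ` vertices. -/
def plantedClique (n κ : ℕ) : Measure (SimpleGraph (Fin n)) :=
  ∑ S ∈ (Finset.univ : Finset (Fin n)).powersetCard κ,
    (n.choose κ : ℝ≥0∞)⁻¹ • (erdosRenyiHalf n).map fun G => addClique G S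

/-- The probability that the randomized algorithm `A` outputs `1` on a random graph with
distribution `μ`. -/
def acceptProb {n : ℕ} (A : RAM.Prog) (μ : Measure (SimpleGraph (Fin n))) : ℝ≥0∞ :=
  ∫⁻ G, RAM.outputProb A (RAM.input G 0) RAM.accepting ∂μ

/-- `A` is an `n ^ o(log n)`-time algorithm on graphs. -/
def RunsInTimeLittleOLog (A : RAM.Prog) : Prop :=
  ∃ g : ℕ → ℝ, g =o[atTop] (fun n : ℕ => Real.log n) ∧
    ∀ᶠ n : ℕ in atTop, ∀ G : SimpleGraph (Fin n),
      RAM.HaltsWithin A (RAM.input G 0) ((n : ℝ) ^ g n)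

/-- The Strongish Planted Clique Hypothesis: for some constant `δ ∈ (0, 1/2)`, no
`n ^ o(log n)`-time algorithm distinguishes, for all large `n`, random graphs with a planted
clique of size `⌈n ^ δ⌉` from random graphs. -/
def StrongishPlantedCliqueHypothesis : Prop :=
  ∃ δ : ℝ, 0 < δ ∧ δ < 1 / 2 ∧
    ¬ ∃ A : RAM.Prog, RunsInTimeLittleOLog A ∧
      ∀ᶠ n : ℕ in atTop,
        2 / 3 ≤ acceptProb A (plantedClique n ⌈(n : ℝ) ^ δ⌉₊) ∧
        acceptProb A (erdosRenyiHalf n) ≤ 1 / 3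

/-! ### Densest `k`-Subgraph -/

/-- The number of edges of `G` with both endpoints in `S`. -/
def inducedEdges {n : ℕ} (G : SimpleGraph (Fin n)) (S : Finset (Fin n)) : ℕ :=
  (G.induce (S : Set (Fin n))).edgeSet.ncard

/-- `S` is a solution of the Densest `k`-Subgraph instance `(G, k)` whose value is within a
factor `C` of the optimum. -/
def IsApproxDensest {n : ℕ} (C : ℝ) (G : SimpleGraph (Fin n)) (k : ℕ) (S : Finset (Fin n)) :
    Prop :=
  S.card = k ∧
    ∀ S' : Finset (Fin n), S'.card = k → (inducedEdges G S' : ℝ) ≤ C * inducedEdges G S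

/-- On the instance `(G, k)`, the algorithm `A` outputs a `C`-approximate solution with
probability at least `2/3`. -/
def SolvesApprox {n : ℕ} (A : RAM.Prog) (C : ℝ) (G : SimpleGraph (Fin n)) (k : ℕ) : Prop :=
  2 / 3 ≤ RAM.outputProb A (RAM.input G k) {s | IsApproxDensest C G k (RAM.outputSet n s)}

/-- `A` approximates Densest `k`-Subgraph to within a factor `C`. -/
def ApproximatesDkS (A : RAM.Prog) (C : ℝ) : Prop :=
  ∀ (n k : ℕ), 1 ≤ k → k ≤ n → ∀ G : SimpleGraph (Fin n), SolvesApprox A C G k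

/-- `A` approximates Densest `k`-Subgraph to within a factor `C` on those instances that contain
a `k`-clique. -/
def ApproximatesDkSPerfectCompleteness (A : RAM.Prog) (C : ℝ) : Prop :=
  ∀ (n k : ℕ), 1 ≤ k → k ≤ n → ∀ G : SimpleGraph (Fin n),
    (∃ S : Finset (Fin n), G.IsNClique k S) → SolvesApprox A C G k

/-- On every instance `(G, k)` of Densest `k`-Subgraph, with `n` the number of vertices of `G`,
`A` runs in time `f k * n ^ e k`. -/
def RunsInTimeDkS (A : RAM.Prog) (f e : ℕ → ℝ) : Prop :=
  ∀ (n k : ℕ), 1 ≤ k → k ≤ n → ∀ G : SimpleGraph (Fin n),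
    RAM.HaltsWithin A (RAM.input G k) (f k * (n : ℝ) ^ e k)

end

/-! Let `A` be a `C`-approximation algorithm with the forbidden running time, let δ be the exponent
of the planted clique and q ≥ 2/δ, so that a planted clique S satisfies |S|^q ≥ n². Write b = ⌈log₂
n⌉ and let c ≥ C be a positive integer. For a width μ, draw N = n^(4(q-1)μ) random tuples of l = 4qμ
vertices and join two tuples if all their cross pairs are equal or adjacent (`tupleGraph`). Run `A`
on this graph with k = 8ch, where h = ⌈λb/μ⌉ for a large constant λ, and accept once it outputs k
tuples that span at least a fraction 1/(2c) of the ordered pairs.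

Completeness: if G has a large clique, enough tuples fall inside it for the product graph to have a
k-clique with probability at least 5/6 (`noCliqueProb_le`), and then `A` finds a dense set with
probability at least 2/3. A trial that is not cut off by the clock therefore fails with probability
at most 1/2.

Soundness: with high probability any h of the tuples cover at least 2μh vertices. Then every dense
set of k tuples forces on the order of (hμ)² distinct edges of G (`exists_many_edges`), an event of
probability 2^(-Ω((hμ)²)). There are at most N^k · 2^(k²) choices of the set and its adjacencies,
whose logarithm is of order hμ·log n + h². Since hμ ≥ λb and μ is at least a large constant, the
union bound succeeds (`edge_bound`, `lintegral_denseProb_le`).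

Running time: hμ stays close to λb, so a fixed k corresponds to a width of order (log n)/k, and
f(k)·N^(e(k)) = f(k)·n^(O(e(k) log n / k)). Because e(k) = o(k), this is at most n^(ε log n) for a
suitable constant k and all large n. As f and e need not be computable, the distinguisher dovetails:
stage j tries the widths up to j with a clock of about n^j. A timeout leads to the next pair of
stage and width; b completed runs for one pair without a dense set lead to rejection. The process
must end by the first stage J at which some width M ≤ J has time bound at most n^J (`IsBudget`), and
J = o(log n) (`budget_isLittleO`).

Programs are analysed through a weakest pre-expectation `wp` with fuel. It is infinite when the fuel
may not suffice, so that the single estimate `wp_mainProg_params_le` gives the running time and both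
error bounds. -/

noncomputable section

/-! ### Expected values over runs of a program. -/

namespace RAM

/-- The expected value of `F` (which may depend on the remaining fuel) at the halting configuration
of a run with fuel `t`; it is infinite if the fuel does not suffice for some outcome of the
coin tosses. -/
def wp (F : ℕ → Store → ℝ≥0∞) : ℕ → List Prog → Store → ℝ≥0∞
  | t, [], s => F t s
  | 0, _ :: _, _ => ⊤
  | t + 1, .skip :: K, s => wp F t K s
  | t + 1, .assign a i x :: K, s => wp F t K (s.set a (i.eval s) (x.eval s))
  | t + 1, .flip a i :: K, s =>
      2⁻¹ * wp F t K (s.set a (i.eval s) 0) + 2⁻¹ * wp F t K (s.set a (i.eval s) 1)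
  | t + 1, .seq p q :: K, s => wp F t (p :: q :: K) s
  | t + 1, .branch x y p q :: K, s =>
      if x.eval s < y.eval s then wp F t (p :: K) s else wp F t (q :: K) s
  | t + 1, .loop x y p :: K, s =>
      if x.eval s < y.eval s then wp F t (p :: .loop x y p :: K) s else wp F t K s

theorem wp_nil (F : ℕ → Store → ℝ≥0∞) (t : ℕ) (s : Store) : wp F t [] s = F t s := by
  cases t <;> simp [wp]

theorem wp_skip (F : ℕ → Store → ℝ≥0∞) (t : ℕ) (K : List Prog) (s : Store) :
    wp F (t + 1) (.skip :: K) s = wp F t K s := rfl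

theorem wp_loop (F : ℕ → Store → ℝ≥0∞) (t : ℕ) (x y : Expr) (p : Prog) (K : List Prog)
    (s : Store) : wp F (t + 1) (.loop x y p :: K) s =
      if x.eval s < y.eval s then wp F t (p :: .loop x y p :: K) s else wp F t K s := rfl

/-- Since the value may depend on the remaining fuel, the continuation can itself serve as the
function to be averaged. This is the composition rule on which all later estimates rest. -/
theorem wp_append (F : ℕ → Store → ℝ≥0∞) (t : ℕ) (K L : List Prog) (s : Store) :
    wp F t (K ++ L) s = wp (fun t' s' => wp F t' L s') t K s := by
  induction t generalizing K s with
  | zero => cases K <;> simp [wp]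
  | succ t ih =>
    cases K with
    | nil => simp [wp_nil]
    | cons p K =>
      cases p <;> simp only [wp, List.cons_append]
      case skip | assign | flip => simp only [ih]
      case seq p q => exact ih (p :: q :: K) s
      case branch x y p q =>
        split_ifs
        · exact ih (p :: K) s
        · exact ih (q :: K) s
      case loop x y p =>
        split_ifs
        · exact ih (p :: .loop x y p :: K) s
        · exact ih K s

theorem wp_cons (F : ℕ → Store → ℝ≥0∞) (t : ℕ) (p : Prog) (K : List Prog) (s : Store) :
    wp F t (p :: K) s = wp (fun t' s' => wp F t' K s') t [p] s :=
  wp_append F t [p] K s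

/-- A lower bound for the function is a lower bound for its expected value. -/
theorem le_wp {F : ℕ → Store → ℝ≥0∞} {v : ℝ≥0∞} (h : ∀ t s, v ≤ F t s) (t : ℕ) (K : List Prog)
    (s : Store) : v ≤ wp F t K s := by
  induction t generalizing K s with
  | zero => cases K <;> simp [wp, h]
  | succ t ih =>
    cases K with
    | nil => simpa [wp_nil] using h _ s
    | cons p K =>
      cases p <;> simp only [wp]
      case skip | assign | seq => exact ih _ _
      case flip a i =>
        calc v = 2⁻¹ * v + 2⁻¹ * v := by
              rw [← add_mul, ENNReal.inv_two_add_inv_two, one_mul]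
          _ ≤ _ := by gcongr <;> exact ih _ _
      case branch | loop => split_ifs <;> exact ih _ _

section PMF

variable {α β : Type*}

/-- The expected value of `g` under `p`. -/
def expect (p : PMF α) (g : α → ℝ≥0∞) : ℝ≥0∞ := ∑' a, p a * g a

theorem expect_pure (a : α) (g : α → ℝ≥0∞) : expect (PMF.pure a) g = g a := by
  classical
  rw [expect, tsum_eq_single a]
  · simp
  · intro b hb; simp [hb]

theorem expect_bind (p : PMF α) (f : α → PMF β) (g : β → ℝ≥0∞) :
    expect (p.bind f) g = expect p fun a => expect (f a) g := by
  simp only [expect, PMF.bind_apply, ← ENNReal.tsum_mul_right, ← ENNReal.tsum_mul_left]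
  rw [ENNReal.tsum_comm]
  simp only [mul_assoc]

theorem expect_coin (f : Bool → α) (g : α → ℝ≥0∞) :
    expect ((PMF.uniformOfFintype Bool).map f) g = 2⁻¹ * g (f false) + 2⁻¹ * g (f true) := by
  rw [PMF.map, expect_bind]
  simp only [Function.comp, expect_pure]
  simp [expect, tsum_fintype, add_comm]

theorem toOuterMeasure_eq_expect (p : PMF α) (E : Set α) :
    p.toOuterMeasure E = expect p (E.indicator 1) := by
  rw [PMF.toOuterMeasure_apply, expect]
  congr! with a
  by_cases h : a ∈ E <;> simp [h]

end PMF

open Classical in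
/-- The value of a configuration: `F` of the memory if it is halted, and infinite otherwise. -/
def haltValue (F : Store → ℝ≥0∞) (c : Config) : ℝ≥0∞ := if c.1 = [] then F c.2 else ⊤

theorem wp_eq_expect (F : Store → ℝ≥0∞) (t : ℕ) (K : List Prog) (s : Store) :
    wp (fun _ => F) t K s = expect (run t (K, s)) (haltValue F) := by
  induction t generalizing K s with
  | zero => cases K <;> simp [wp, run, expect_pure, haltValue]
  | succ t ih =>
    rw [run, expect_bind]
    cases K with
    | nil => simp only [wp_nil, step, expect_pure, ← ih]
    | cons p K =>
      cases p <;> simp only [wp, step, expect_pure, expect_coin, ih, Bool.toNat_false,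
        Bool.toNat_true] <;> split_ifs <;> rfl

theorem run_add (t u : ℕ) (c : Config) : run (t + u) c = (run t c).bind (run u) := by
  induction t generalizing c with
  | zero => simp [run]
  | succ t ih =>
    rw [Nat.succ_add, run, run, PMF.bind_bind]
    congr 1
    funext c
    exact ih c

theorem run_nil (t : ℕ) (s : Store) : run t ([], s) = PMF.pure ([], s) := by
  induction t with
  | zero => rfl
  | succ t ih => rw [run, step, PMF.pure_bind, ih]

theorem expect_run_mono (t u : ℕ) (c : Config) (E : Set Store) :
    expect (run t c) ({c | Config.Halted c ∧ c.2 ∈ E}.indicator 1) ≤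
      expect (run (t + u) c) ({c | Config.Halted c ∧ c.2 ∈ E}.indicator 1) := by
  rw [run_add, expect_bind]
  refine ENNReal.tsum_le_tsum fun c' => ?_
  gcongr
  by_cases h : Config.Halted c' ∧ c'.2 ∈ E
  · obtain ⟨K, s⟩ := c'
    obtain ⟨hK, hs⟩ := h
    obtain rfl : K = [] := hK
    beta_reduce
    rw [run_nil, expect_pure]
  · rw [Set.indicator_of_notMem (by simpa using h)]
    exact zero_le

theorem wp_sure_of_halts {p : Prog} {s : Store} {t : ℕ}
    (h : ∀ c ∈ (run t ([p], s)).support, Config.Halted c) (F : Store → ℝ≥0∞) :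
    wp (fun _ => F) t [p] s = expect (run t ([p], s)) fun c => F c.2 := by
  rw [wp_eq_expect]
  refine tsum_congr fun c => ?_
  by_cases hc : c ∈ (run t ([p], s)).support
  · rw [haltValue, if_pos (show c.1 = [] from h c hc)]
  · rw [PMF.mem_support_iff, not_not] at hc
    simp [hc]

theorem expect_const {α : Type*} (p : PMF α) (v : ℝ≥0∞) : expect p (fun _ => v) = v := by
  rw [expect, ENNReal.tsum_mul_right, p.tsum_coe, one_mul]

theorem expect_add {α : Type*} (p : PMF α) (f g : α → ℝ≥0∞) :
    expect p (fun a => f a + g a) = expect p f + expect p g := by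
  simp only [expect, mul_add, ENNReal.tsum_add]

theorem expect_mul_left {α : Type*} (p : PMF α) (v : ℝ≥0∞) (g : α → ℝ≥0∞) :
    expect p (fun a => v * g a) = v * expect p g := by
  simp only [expect, ← ENNReal.tsum_mul_left, mul_left_comm]

open Classical in
/-- A program that halts within `b` steps and ends up in `E` with probability at least `2 / 3`
misses `E` with probability at most `1 / 3`. -/
theorem exists_wp_le_of_outputProb {p : Prog} {s : Store} {b : ℝ} (hb : HaltsWithin p s b) :
    ∃ t : ℕ, (t : ℝ) ≤ b ∧ ∀ (E : Set Store) (v w : ℝ≥0∞),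
      wp (fun _ s => v + w * if s ∈ E then 0 else 1) t [p] s ≤ v + w ∧
      (2 / 3 ≤ outputProb p s E →
        wp (fun _ s => v + w * if s ∈ E then 0 else 1) t [p] s ≤ v + w * 3⁻¹) := by
  obtain ⟨t, htb, ht⟩ := hb
  refine ⟨t, htb, fun E v w => ?_⟩
  rw [wp_sure_of_halts ht]
  refine ⟨?_, fun hE => ?_⟩
  · refine le_trans (ENNReal.tsum_le_tsum fun c => ?_) (expect_const (run t ([p], s)) (v + w)).le
    gcongr
    dsimp only
    split_ifs <;> simp
  rw [expect_add, expect_const, expect_mul_left]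
  gcongr
  set x := expect (run t ([p], s)) fun c : Config => if c.2 ∈ E then 0 else 1 with hx
  set y := expect (run t ([p], s)) fun c : Config => if c.2 ∈ E then 1 else 0 with hy
  have hxy : x + y = 1 := by
    rw [hx, hy, ← expect_add]
    refine Eq.trans ?_ (expect_const (run t ([p], s)) 1)
    congr! 2 with c
    split_ifs <;> simp
  -- The supremum over all times is reached at `t`: every outcome has halted by then, and further
  -- steps change nothing.
  have hy2 : 2 / 3 ≤ y := by
    refine hE.trans (iSup_le fun u => ?_)
    rw [toOuterMeasure_eq_expect]
    refine (expect_run_mono u t _ E).trans ?_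
    rw [add_comm u t, run_add, expect_bind, hy]
    refine ENNReal.tsum_le_tsum fun c => ?_
    by_cases hc : c ∈ (run t ([p], s)).support
    · obtain ⟨K, s'⟩ := c
      obtain rfl : K = [] := ht _ hc
      beta_reduce
      rw [run_nil, expect_pure]
      gcongr
      simp [Set.indicator, Config.Halted]
    · rw [PMF.mem_support_iff, not_not] at hc
      simp [hc]
  by_contra hlt
  rw [not_le] at hlt
  have : (1 : ℝ≥0∞) < x + y := by
    calc (1 : ℝ≥0∞) = 3⁻¹ + 2 / 3 := by
          rw [ENNReal.div_eq_inv_mul, ← mul_one_add, show (1 + 2 : ℝ≥0∞) = 3 by norm_num,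
            ENNReal.inv_mul_cancel] <;> norm_num
      _ < x + y := ENNReal.add_lt_add_of_lt_of_le (by finiteness) hlt hy2
  exact this.ne' hxy

theorem halts_of_wp_lt_top {p : Prog} {s : Store} {t : ℕ} {F : Store → ℝ≥0∞}
    (h : wp (fun _ => F) t [p] s < ⊤) : ∀ c ∈ (run t ([p], s)).support, Config.Halted c := by
  intro c hc
  by_contra hn
  rw [wp_eq_expect] at h
  have := ENNReal.ne_top_of_tsum_ne_top h.ne c
  rw [haltValue, if_neg (show ¬ c.1 = [] from hn), ENNReal.mul_top (by simpa using hc)] at this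
  exact this rfl

/-- No halting hypothesis is needed, because the right side is infinite when the fuel may not
suffice. -/
theorem outputProb_le_wp (p : Prog) (s : Store) (t : ℕ) (E : Set Store) :
    outputProb p s E ≤ wp (fun _ => E.indicator 1) t [p] s := by
  by_cases h : wp (fun _ => E.indicator 1) t [p] s < ⊤
  · have ht := halts_of_wp_lt_top h
    refine iSup_le fun u => ?_
    rw [toOuterMeasure_eq_expect]
    refine (expect_run_mono u t _ E).trans ?_
    rw [add_comm u t, run_add, expect_bind, wp_sure_of_halts ht]
    refine ENNReal.tsum_le_tsum fun c => ?_
    by_cases hc : c ∈ (run t ([p], s)).support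
    · obtain ⟨K, s'⟩ := c
      obtain rfl : K = [] := ht _ hc
      beta_reduce
      rw [run_nil, expect_pure]
      gcongr
      by_cases hE : s' ∈ E <;> simp [hE, Config.Halted]
    · rw [PMF.mem_support_iff, not_not] at hc
      simp [hc]
  · rw [not_lt, top_le_iff] at h
    simp [h]

/-- Turns an upper bound for `wp` on the complement into a lower bound for the output probability.
-/
theorem one_le_outputProb_add_wp (p : Prog) (s : Store) (t : ℕ) (E : Set Store) :
    1 ≤ outputProb p s E + wp (fun _ => Eᶜ.indicator 1) t [p] s := by
  by_cases h : wp (fun _ => Eᶜ.indicator 1) t [p] s < ⊤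
  · have ht := halts_of_wp_lt_top h
    have h1 : expect (run t ([p], s)) ({c | Config.Halted c ∧ c.2 ∈ E}.indicator 1) ≤
        outputProb p s E := by
      rw [← toOuterMeasure_eq_expect]
      exact le_iSup (fun t => (run t ([p], s)).toOuterMeasure {c | Config.Halted c ∧ c.2 ∈ E}) t
    refine le_trans ?_ (add_le_add_left h1 _)
    rw [wp_sure_of_halts ht, ← expect_add, ← expect_const (run t ([p], s)) 1]
    refine ENNReal.tsum_le_tsum fun c => ?_
    by_cases hc : c ∈ (run t ([p], s)).support
    · gcongr
      have := ht c hc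
      by_cases hE : c.2 ∈ E <;> simp [hE, this]
    · rw [PMF.mem_support_iff, not_not] at hc
      simp [hc]
  · rw [not_lt, top_le_iff] at h
    simp [h]

/-! ### Deterministic program fragments -/

instance : Add Expr := ⟨Expr.add⟩
instance : Sub Expr := ⟨Expr.sub⟩
instance (n : ℕ) : OfNat Expr n := ⟨Expr.const n⟩

/-- The scalar variable stored in cell `0` of array `a`. -/
def Expr.var (a : ℕ) : Expr := Expr.cell a 0

/-- The `c`-fold sum of an expression. -/
def Expr.smul : ℕ → Expr → Expr
  | 0, _ => 0
  | c + 1, x => Expr.smul c x + x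

@[simp] theorem Expr.eval_add (s : Store) (x y : Expr) : (x + y).eval s = x.eval s + y.eval s := rfl
@[simp] theorem Expr.eval_sub (s : Store) (x y : Expr) : (x - y).eval s = x.eval s - y.eval s := rfl
@[simp] theorem Expr.eval_const (s : Store) (n : ℕ) : (Expr.const n).eval s = n := rfl
@[simp] theorem Expr.eval_ofNat (s : Store) (n : ℕ) : 
    (no_index (OfNat.ofNat n : Expr)).eval s = OfNat.ofNat n := rfl
@[simp] theorem Expr.eval_var (s : Store) (a : ℕ) : (Expr.var a).eval s = s a 0 := rfl
@[simp] theorem Expr.eval_cell (s : Store) (a : ℕ) (i : Expr) :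
    (Expr.cell a i).eval s = s a (i.eval s) := rfl

@[simp] theorem Expr.eval_smul (s : Store) (c : ℕ) (x : Expr) :
    (Expr.smul c x).eval s = c * x.eval s := by
  induction c with
  | zero => simp [Expr.smul]
  | succ c ih => simp [Expr.smul, ih, add_mul]

theorem Store.set_apply (s : Store) (a i v b j : ℕ) :
    s.set a i v b j = if b = a ∧ j = i then v else s b j := rfl

theorem Store.set_ne (s : Store) {a b : ℕ} (i v : ℕ) (h : b ≠ a) : s.set a i v b = s b := by
  funext j
  simp [Store.set_apply, h]

theorem Store.set_self (s : Store) (a i v : ℕ) : s.set a i v a i = v := by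
  simp [Store.set_apply]

/-- The memories `s` and `s'` agree outside of the arrays in `L`. -/
def Frame (L : List ℕ) (s s' : Store) : Prop := ∀ a, a ∉ L → s' a = s a

theorem Frame.refl (L : List ℕ) (s : Store) : Frame L s s := fun _ _ => rfl

theorem Frame.trans {L L' : List ℕ} {s s' s'' : Store} (h : Frame L s s') (h' : Frame L' s' s'')
    (hL : ∀ a, a ∈ L' → a ∈ L) : Frame L s s'' :=
  fun a ha => (h' a fun h => ha (hL a h)).trans (h a ha)

theorem Frame.mono {L L' : List ℕ} {s s' : Store} (h : Frame L' s s')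
    (hL : ∀ a, a ∈ L' → a ∈ L) : Frame L s s' :=
  (Frame.refl L s).trans h hL

theorem Frame.set {L : List ℕ} {s s' : Store} (h : Frame L s s') {a : ℕ} (i v : ℕ) (ha : a ∈ L) :
    Frame L s (s'.set a i v) := by
  intro b hb
  rw [Store.set_ne _ _ _ (by rintro rfl; exact hb ha), h b hb]

/-- From the memory `s`, the fragment `p` takes exactly `n` steps, without tossing a coin, and
ends with the memory `s'`. -/
def Exec (p : Prog) (s s' : Store) (n : ℕ) : Prop :=
  ∀ F t K, wp F (t + n) (p :: K) s = wp F t K s'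

/-- From the memory `s`, the fragment `p` takes at most `c` steps, without tossing a coin, and
ends with a memory that satisfies `Q`. -/
def Runs (p : Prog) (s : Store) (c : ℕ) (Q : Store → Prop) : Prop :=
  ∃ s' n, n ≤ c ∧ Q s' ∧ Exec p s s' n

theorem Runs.mono {p : Prog} {s : Store} {c c' : ℕ} {Q Q' : Store → Prop} (h : Runs p s c Q)
    (hc : c ≤ c') (hQ : ∀ s', Q s' → Q' s') : Runs p s c' Q' := by
  obtain ⟨s', n, hn, h1, h2⟩ := h
  exact ⟨s', n, hn.trans hc, hQ _ h1, h2⟩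

theorem Runs.wp_le {p : Prog} {s : Store} {c : ℕ} {Q : Store → Prop} (h : Runs p s c Q)
    {F : ℕ → Store → ℝ≥0∞} {t : ℕ} {K : List Prog} {v : ℝ≥0∞} (hc : c ≤ t)
    (hv : ∀ s' t', Q s' → t ≤ t' + c → wp F t' K s' ≤ v) : wp F t (p :: K) s ≤ v := by
  obtain ⟨s', n, hn, h1, h2⟩ := h
  obtain ⟨u, rfl⟩ := Nat.exists_eq_add_of_le' (hn.trans hc)
  rw [h2]
  exact hv _ _ h1 (by omega)

theorem Runs.skip {s : Store} {Q : Store → Prop} (h : Q s) : Runs .skip s 1 Q :=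
  ⟨s, 1, le_rfl, h, fun _ _ _ => rfl⟩

theorem Runs.assign {a : ℕ} {i x : Expr} {s : Store} {Q : Store → Prop}
    (h : Q (s.set a (i.eval s) (x.eval s))) : Runs (.assign a i x) s 1 Q :=
  ⟨_, 1, le_rfl, h, fun _ _ _ => rfl⟩

theorem Runs.seq {p q : Prog} {s : Store} {c d : ℕ} {P Q : Store → Prop} (hp : Runs p s c P)
    (hq : ∀ s', P s' → Runs q s' d Q) : Runs (.seq p q) s (c + d + 1) Q := by
  obtain ⟨s', n, hn, h1, h2⟩ := hp
  obtain ⟨s'', m, hm, h3, h4⟩ := hq s' h1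
  refine ⟨s'', n + m + 1, by omega, h3, fun F t K => ?_⟩
  rw [← add_assoc, wp, show t + (n + m) = t + m + n by omega, h2, h4]

theorem Runs.branch {x y : Expr} {p q : Prog} {s : Store} {c : ℕ} {Q : Store → Prop}
    (hp : x.eval s < y.eval s → Runs p s c Q) (hq : ¬ x.eval s < y.eval s → Runs q s c Q) :
    Runs (.branch x y p q) s (c + 1) Q := by
  by_cases h : x.eval s < y.eval s
  · obtain ⟨s', n, hn, h1, h2⟩ := hp h
    refine ⟨s', n + 1, by omega, h1, fun F t K => ?_⟩
    rw [← add_assoc, wp, if_pos h, h2]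
  · obtain ⟨s', n, hn, h1, h2⟩ := hq h
    refine ⟨s', n + 1, by omega, h1, fun F t K => ?_⟩
    rw [← add_assoc, wp, if_neg h, h2]

theorem Runs.loop {x y : Expr} {p : Prog} {c m : ℕ} (I : ℕ → Store → Prop)
    (hlt : ∀ i < m, ∀ s, I i s → x.eval s < y.eval s) (hm : ∀ s, I m s → ¬ x.eval s < y.eval s)
    (hstep : ∀ i < m, ∀ s, I i s → Runs p s c (I (i + 1))) {s : Store} (hs : I 0 s) :
    Runs (.loop x y p) s (m * (c + 1) + 1) (I m) := by
  suffices H : ∀ d i s, i + d = m → I i s → Runs (.loop x y p) s (d * (c + 1) + 1) (I m) from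
    H m 0 s (zero_add m) hs
  intro d
  induction d with
  | zero =>
    rintro i s rfl hi
    refine ⟨s, 1, by omega, hi, fun F t K => ?_⟩
    rw [wp, if_neg (hm s hi)]
  | succ d ih =>
    intro i s hi his
    obtain ⟨s', n, hn, h1, h2⟩ := hstep i (by omega) s his
    obtain ⟨s'', n', hn', h3, h4⟩ := ih (i + 1) s' (by omega) h1
    refine ⟨s'', n' + n + 1, ?_, h3, fun F t K => ?_⟩
    · rw [add_mul]; omega
    · rw [← add_assoc, wp, if_pos (hlt i (by omega) s his), ← add_assoc, h2, h4]

/-- `for v = 0, …, y - 1 do p`. -/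
def forLoop (v : ℕ) (y : Expr) (p : Prog) : Prog :=
  .seq (.assign v 0 0) (.loop (.var v) y (.seq p (.assign v 0 (.var v + 1))))

/-- The invariant is demanded after the increment of the loop variable, hence the updated memory in
`hstep`. The three extra steps per round are the test, the sequencing and the increment. -/
theorem Runs.forLoop {v : ℕ} {y : Expr} {p : Prog} {c m : ℕ} (I : ℕ → Store → Prop)
    (hv : ∀ i s, I i s → s v 0 = i) (hy : ∀ i s, I i s → y.eval s = m)
    (hstep : ∀ i < m, ∀ s, I i s → Runs p s c fun s' => I (i + 1) (s'.set v 0 (s' v 0 + 1)))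
    {s : Store} (hs : I 0 (s.set v 0 0)) :
    Runs (forLoop v y p) s (m * (c + 3) + 3) (I m) := by
  refine (Runs.seq (c := 1) (d := m * (c + 3) + 1) (P := I 0) (Runs.assign hs)
    fun s' hs' => ?_).mono (by omega) fun s' h => h
  refine Runs.loop I (fun i hi s h => ?_) (fun s h => ?_) (fun i hi s h => ?_) hs'
  · rwa [Expr.eval_var, hv i s h, hy i s h]
  · rw [Expr.eval_var, hv m s h, hy m s h]
    exact lt_irrefl m
  · exact Runs.seq (hstep i hi s h) fun s' h' => Runs.assign h'

/-! ### Running a program with a clock, in a fresh region of the memory -/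

notation "vOff" => (12 : ℕ)
notation "vHi" => (13 : ℕ)
notation "vClk" => (14 : ℕ)
notation "aSim" => (40 : ℕ)

/-- The expression `x` with the cell `a[i]` replaced by the cell `(a + aSim)[off + i]`. -/
def Expr.shifted : Expr → Expr
  | .const c => .const c
  | .cell a i => .cell (a + aSim) (.var vOff + i.shifted)
  | .add x y => x.shifted + y.shifted
  | .sub x y => x.shifted - y.shifted

/-- Update of the bound `vHi` on the addresses used so far before writing to address `i`. -/
def trackWrite (i : Expr) : Prog :=
  -- With truncated subtraction this is the maximum of the old bound and the address plus one.
  .assign vHi 0 (.var vHi + (.var vOff + i.shifted + 1 - .var vHi))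

/-- The program `p` working on the memory region above `vOff` of the arrays from `aSim` on. Each
iteration of a loop decreases the clock `vClk`, and no loop continues when the clock is `0`. -/
def Prog.clocked : Prog → Prog
  | .skip => .skip
  | .assign a i x =>
      .seq (trackWrite i) (.assign (a + aSim) (.var vOff + i.shifted) x.shifted)
  | .flip a i => .seq (trackWrite i) (.flip (a + aSim) (.var vOff + i.shifted))
  | .seq p q => .seq p.clocked q.clocked
  | .branch x y p q => .branch x.shifted y.shifted p.clocked q.clocked
  | .loop x y p =>
      -- The right side is the minimum of y - x and the clock, so it is positive iff x < y and the
      -- clock is not 0.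
      .loop 0 (y.shifted - x.shifted - (y.shifted - x.shifted - .var vClk))
        (.seq (.assign vClk 0 (.var vClk - 1)) p.clocked)

/-- A bound for the number of steps of `p.clocked` per unit of the clock. -/
def Prog.clockCost : Prog → ℕ
  | .skip => 1
  | .assign _ _ _ => 3
  | .flip _ _ => 3
  | .seq p q => p.clockCost + q.clockCost + 1
  | .branch _ _ p q => p.clockCost + q.clockCost + 1
  | .loop _ _ p => p.clockCost + 3

/-- The cells above `vHi` of the arrays from `aSim` on are zero. -/
def Fresh (s : Store) : Prop :=
  s vOff 0 ≤ s vHi 0 ∧ ∀ a i, s vHi 0 ≤ i → s (a + aSim) i = 0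

/-- The arrays below `aSim` other than `vHi` and `vClk` are unchanged, and the clock has not
increased. -/
def Keeps (s s' : Store) : Prop :=
  (∀ a < aSim, a ≠ vHi → a ≠ vClk → s' a = s a) ∧ s' vClk 0 ≤ s vClk 0

/-- The region of `s` above `vOff` of the arrays from `aSim` on has the content `m`. -/
def Simulates (s m : Store) : Prop := ∀ a i, s (a + aSim) (s vOff 0 + i) = m a i

theorem Keeps.refl (s : Store) : Keeps s s := ⟨fun _ _ _ _ => rfl, le_rfl⟩

theorem Keeps.trans {s s' s'' : Store} (h : Keeps s s') (h' : Keeps s' s'') : Keeps s s'' :=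
  ⟨fun a h1 h2 h3 => (h'.1 a h1 h2 h3).trans (h.1 a h1 h2 h3), h'.2.trans h.2⟩

theorem Simulates.eval_shifted {s m : Store} (h : Simulates s m) (x : Expr) :
    x.shifted.eval s = x.eval m := by
  induction x with
  | const c => rfl
  | cell a i ih => simp [Expr.shifted, ih, h a]
  | add x y hx hy => simp [Expr.shifted, hx, hy, Expr.eval]
  | sub x y hx hy => simp [Expr.shifted, hx, hy, Expr.eval]

theorem Expr.shifted_eval_set_hi (x : Expr) (s : Store) (i v : ℕ) :
    x.shifted.eval (s.set vHi i v) = x.shifted.eval s := by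
  induction x with
  | const c => rfl
  | cell a i ih => simp [Expr.shifted, ih, Store.set_apply]
  | add x y hx hy => simp [Expr.shifted, hx, hy]
  | sub x y hx hy => simp [Expr.shifted, hx, hy]

/-- The memory after `trackWrite i` and writing `v` to the simulated cell `a[i]`. -/
def simSet (s : Store) (a i v : ℕ) : Store :=
  (s.set vHi 0 (s vHi 0 + (s vOff 0 + i + 1 - s vHi 0))).set (a + aSim) (s vOff 0 + i) v

theorem fresh_simSet {s : Store} (h : Fresh s) (a i v : ℕ) : Fresh (simSet s a i v) := by
  obtain ⟨h1, h2⟩ := h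
  have hhi : simSet s a i v vHi 0 = s vHi 0 + (s vOff 0 + i + 1 - s vHi 0) := by
    simp [simSet, Store.set_apply]
  refine ⟨?_, fun b k hk => ?_⟩
  · rw [hhi]
    simp [simSet, Store.set_apply]
    omega
  · rw [hhi] at hk
    have hne : k ≠ s vOff 0 + i := by omega
    simp only [simSet, Store.set_apply, hne, and_false, if_false]
    rw [if_neg (by omega), h2 b k (by omega)]

theorem keeps_simSet (s : Store) (a i v : ℕ) : Keeps s (simSet s a i v) := by
  refine ⟨fun b hb h1 h2 => ?_, ?_⟩
  · rw [simSet, Store.set_ne _ _ _ (by omega), Store.set_ne _ _ _ h1]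
  · simp [simSet, Store.set_apply]

theorem clk_simSet (s : Store) (a i v : ℕ) : simSet s a i v vClk = s vClk := by
  rw [simSet, Store.set_ne _ _ _ (by omega), Store.set_ne _ _ _ (by omega)]

theorem Simulates.simSet {s m : Store} (h : Simulates s m) (a i v : ℕ) :
    Simulates (simSet s a i v) (m.set a i v) := by
  intro b k
  have : RAM.simSet s a i v vOff 0 = s vOff 0 := by simp [RAM.simSet, Store.set_apply]
  rw [this]
  simp only [RAM.simSet, Store.set_apply, Nat.add_right_cancel_iff, Nat.add_left_cancel_iff]
  split_ifs
  · rfl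
  · omega
  · exact h b k

/-- One tick of the clock. -/
def tick (s : Store) : Store := s.set vClk 0 (s vClk 0 - 1)

theorem clk_tick (s : Store) : tick s vClk 0 = s vClk 0 - 1 := by simp [tick, Store.set_apply]

theorem keeps_tick (s : Store) : Keeps s (tick s) := by
  refine ⟨fun b hb h1 h2 => ?_, ?_⟩
  · rw [tick, Store.set_ne _ _ _ h2]
  · rw [clk_tick]; omega

theorem fresh_tick {s : Store} (h : Fresh s) : Fresh (tick s) := by
  refine ⟨?_, fun a i hi => ?_⟩
  · simpa [tick, Store.set_apply] using h.1
  · rw [tick, Store.set_ne _ _ _ (by omega), h.2 a i (by simpa [tick, Store.set_apply] using hi)]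

theorem Simulates.tick {s m : Store} (h : Simulates s m) : Simulates (tick s) m := by
  intro a i
  rw [RAM.tick, Store.set_ne _ _ _ (by omega), Store.set_ne _ _ _ (by omega)]
  exact h a i

theorem wp_clocked_assign (F : ℕ → Store → ℝ≥0∞) (a : ℕ) (i x : Expr) (t : ℕ) (s : Store) :
    wp F (t + 3) [(Prog.assign a i x).clocked] s =
      F t (simSet s a (i.shifted.eval s) (x.shifted.eval s)) := by
  rw [Prog.clocked, wp, trackWrite, wp, wp, wp_nil]
  simp only [Expr.eval_add, Expr.eval_var, Expr.eval_ofNat, Expr.eval_sub,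
    Expr.shifted_eval_set_hi, simSet]
  rw [Store.set_ne (b := vOff) _ _ _ (by omega)]

theorem wp_clocked_flip (F : ℕ → Store → ℝ≥0∞) (a : ℕ) (i : Expr) (t : ℕ) (s : Store) :
    wp F (t + 3) [(Prog.flip a i).clocked] s =
      2⁻¹ * F t (simSet s a (i.shifted.eval s) 0) + 2⁻¹ * F t (simSet s a (i.shifted.eval s) 1) := by
  rw [Prog.clocked, wp, trackWrite, wp, wp, wp_nil, wp_nil]
  simp only [Expr.eval_add, Expr.eval_var, Expr.eval_ofNat, Expr.eval_sub,
    Expr.shifted_eval_set_hi, simSet]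
  rw [Store.set_ne (b := vOff) _ _ _ (by omega)]

theorem half_add_half_le {x y v : ℝ≥0∞} (hx : x ≤ v) (hy : y ≤ v) : 2⁻¹ * x + 2⁻¹ * y ≤ v :=
  calc 2⁻¹ * x + 2⁻¹ * y ≤ 2⁻¹ * v + 2⁻¹ * v := by gcongr
    _ = v := by rw [← add_mul, ENNReal.inv_two_add_inv_two, one_mul]

/-- Whatever the coin tosses are, the clocked program halts in time linear in the clock, and
does not disturb the rest of the memory. -/
theorem wp_clocked_le (p : Prog) : ∀ (F : ℕ → Store → ℝ≥0∞) (v : ℝ≥0∞) (t : ℕ) (s : Store),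
    Fresh s → p.clockCost * (s vClk 0 + 1) ≤ t →
    (∀ t' s', Fresh s' → Keeps s s' →
      t ≤ t' + p.clockCost * (s vClk 0 - s' vClk 0 + 1) → F t' s' ≤ v) →
    wp F t [p.clocked] s ≤ v := by
  induction p with
  | skip =>
    intro F v t s hs ht hF
    obtain ⟨t, rfl⟩ : ∃ u, t = u + 1 := ⟨t - 1, by simp [Prog.clockCost] at ht; omega⟩
    rw [Prog.clocked, wp_skip, wp_nil]
    exact hF t s hs (Keeps.refl s) (by simp [Prog.clockCost])
  | assign a i x =>
    intro F v t s hs ht hF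
    obtain ⟨t, rfl⟩ : ∃ u, t = u + 3 := ⟨t - 3, by simp [Prog.clockCost] at ht; omega⟩
    rw [wp_clocked_assign]
    exact hF _ _ (fresh_simSet hs _ _ _) (keeps_simSet _ _ _ _) (by simp [Prog.clockCost, clk_simSet])
  | flip a i =>
    intro F v t s hs ht hF
    obtain ⟨t, rfl⟩ : ∃ u, t = u + 3 := ⟨t - 3, by simp [Prog.clockCost] at ht; omega⟩
    rw [wp_clocked_flip]
    refine half_add_half_le ?_ ?_ <;>
    exact hF _ _ (fresh_simSet hs _ _ _) (keeps_simSet _ _ _ _) (by simp [Prog.clockCost, clk_simSet])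
  | seq p q hp hq =>
    intro F v t s hs ht hF
    simp only [Prog.clockCost] at ht hF
    obtain ⟨t, rfl⟩ : ∃ u, t = u + 1 := ⟨t - 1, by
      have := Nat.le_trans (Nat.le_mul_of_pos_right _ (Nat.succ_pos _)) ht; omega⟩
    rw [Prog.clocked, wp, wp_cons]
    refine hp _ v t s hs (by nlinarith) fun t' s' hs' hk ht' => ?_
    have hle := hk.2
    obtain ⟨u, hu⟩ := Nat.exists_eq_add_of_le hle
    refine hq _ v t' s' hs' ?_ fun t'' s'' hs'' hk' ht'' => ?_
    · rw [show s vClk 0 - s' vClk 0 = u by omega] at ht'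
      rw [hu] at ht
      nlinarith
    · refine hF t'' s'' hs'' (hk.trans hk') ?_
      obtain ⟨w, hw⟩ := Nat.exists_eq_add_of_le hk'.2
      rw [show s vClk 0 - s' vClk 0 = u by omega] at ht'
      rw [show s' vClk 0 - s'' vClk 0 = w by omega] at ht''
      rw [show s vClk 0 - s'' vClk 0 = u + w by omega]
      nlinarith
  | branch x y p q hp hq =>
    intro F v t s hs ht hF
    simp only [Prog.clockCost] at ht hF
    obtain ⟨t, rfl⟩ : ∃ u, t = u + 1 := ⟨t - 1, by
      have := Nat.le_trans (Nat.le_mul_of_pos_right _ (Nat.succ_pos _)) ht; omega⟩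
    rw [Prog.clocked, wp]
    split_ifs
    · refine hp _ v t s hs (by nlinarith) fun t' s' hs' hk ht' => hF t' s' hs' hk ?_
      nlinarith [Nat.zero_le (q.clockCost * (s vClk 0 - s' vClk 0 + 1))]
    · refine hq _ v t s hs (by nlinarith) fun t' s' hs' hk ht' => hF t' s' hs' hk ?_
      nlinarith [Nat.zero_le (p.clockCost * (s vClk 0 - s' vClk 0 + 1))]
  | loop x y p hp =>
    intro F v t s hs ht hF
    generalize hc : s vClk 0 = c at ht hF
    -- Every iteration costs a tick, so the loop is handled by induction on the clock.
    induction c using Nat.strong_induction_on generalizing t s with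
    | _ c ih =>
    simp only [Prog.clockCost] at ht hF ih
    obtain ⟨t, rfl⟩ : ∃ u, t = u + 1 := ⟨t - 1, by
      have := Nat.le_trans (Nat.le_mul_of_pos_right _ (Nat.succ_pos _)) ht; omega⟩
    rw [Prog.clocked, wp]
    split_ifs with hlt
    · have hc0 : 0 < c := by
        simp only [Expr.eval_ofNat, Expr.eval_sub, Expr.eval_var, hc] at hlt
        omega
      obtain ⟨t, rfl⟩ : ∃ u, t = u + 2 := ⟨t - 2, by
        have := Nat.le_trans (Nat.le_mul_of_pos_right _ (Nat.succ_pos _)) ht; omega⟩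
      rw [show t + 2 = t + 1 + 1 from rfl, wp, wp]
      change wp F t (p.clocked :: [(Prog.loop x y p).clocked]) (tick s) ≤ v
      rw [wp_cons]
      have hct : tick s vClk 0 = c - 1 := by rw [clk_tick, hc]
      obtain ⟨d, rfl⟩ : ∃ d, c = d + 1 := ⟨c - 1, by omega⟩
      refine hp _ v t _ (fresh_tick hs) (by rw [hct]; simp; nlinarith) fun t' s' hs' hk ht' => ?_
      obtain ⟨w, hw⟩ := Nat.exists_eq_add_of_le hk.2
      rw [hct] at hw ht'
      rw [show d + 1 - 1 - s' vClk 0 = w by omega] at ht'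
      have hd : d = s' vClk 0 + w := by omega
      refine ih (s' vClk 0) (by omega) t' s' hs' rfl ?_ fun t'' s'' hs'' hk' ht'' => ?_
      · subst hd
        nlinarith
      · refine hF t'' s'' hs'' (((keeps_tick s).trans hk).trans hk') ?_
        obtain ⟨w', hw'⟩ := Nat.exists_eq_add_of_le hk'.2
        rw [show s' vClk 0 - s'' vClk 0 = w' by omega] at ht''
        rw [show d + 1 - s'' vClk 0 = w + w' + 1 by omega]
        nlinarith
    · rw [wp_nil]
      refine hF t s hs (Keeps.refl s) ?_
      rw [hc, Nat.sub_self]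
      omega

/-- The clocked program simulates the original one, unless the clock runs out; the latter happens
only if the clock is initially at most the running time. -/
theorem wp_clocked_le_wp (p : Prog) : ∀ (F F₀ : ℕ → Store → ℝ≥0∞) (v : ℝ≥0∞) (t T : ℕ)
    (s m : Store), Fresh s → Simulates s m → p.clockCost * (s vClk 0 + 1) ≤ t → 0 < s vClk 0 →
    (∀ T' m', v ≤ F₀ T' m') →
    (∀ t' s' T' m', Fresh s' → Keeps s s' → Simulates s' m' → 0 < s' vClk 0 →
      t ≤ t' + p.clockCost * (s vClk 0 - s' vClk 0 + 1) → s vClk 0 + T' ≤ s' vClk 0 + T →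
      F t' s' ≤ F₀ T' m') →
    (s vClk 0 ≤ T → ∀ t' s', Fresh s' → Keeps s s' → s' vClk 0 = 0 →
      t ≤ t' + p.clockCost * (s vClk 0 - s' vClk 0 + 1) → F t' s' ≤ v) →
    wp F t [p.clocked] s ≤ wp F₀ T [p] m := by
  induction p with
  | skip =>
    intro F F₀ v t T s m hs hm ht h0 hv hF hF0
    obtain ⟨t, rfl⟩ : ∃ u, t = u + 1 := ⟨t - 1, by simp [Prog.clockCost] at ht; omega⟩
    cases T with
    -- Without fuel the side of the original program is infinite.
    | zero => simp [wp]
    | succ T =>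
      rw [Prog.clocked, wp_skip, wp_skip, wp_nil, wp_nil]
      exact hF t s T m hs (Keeps.refl s) hm h0 (by simp [Prog.clockCost]) (by omega)
  | assign a i x =>
    intro F F₀ v t T s m hs hm ht h0 hv hF hF0
    obtain ⟨t, rfl⟩ : ∃ u, t = u + 3 := ⟨t - 3, by simp [Prog.clockCost] at ht; omega⟩
    cases T with
    | zero => simp [wp]
    | succ T =>
      rw [wp_clocked_assign, wp, wp_nil, hm.eval_shifted, hm.eval_shifted]
      refine hF _ _ _ _ (fresh_simSet hs _ _ _) (keeps_simSet _ _ _ _) (hm.simSet _ _ _) ?_ ?_ ?_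
      · rwa [clk_simSet]
      · simp [Prog.clockCost, clk_simSet]
      · rw [clk_simSet]; omega
  | flip a i =>
    intro F F₀ v t T s m hs hm ht h0 hv hF hF0
    obtain ⟨t, rfl⟩ : ∃ u, t = u + 3 := ⟨t - 3, by simp [Prog.clockCost] at ht; omega⟩
    cases T with
    | zero => simp [wp]
    | succ T =>
      rw [wp_clocked_flip, wp, wp_nil, wp_nil, hm.eval_shifted]
      gcongr
      all_goals
        refine hF _ _ _ _ (fresh_simSet hs _ _ _) (keeps_simSet _ _ _ _) (hm.simSet _ _ _) ?_ ?_ ?_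
        · rwa [clk_simSet]
        · simp [Prog.clockCost, clk_simSet]
        · rw [clk_simSet]; omega
  | seq p q hp hq =>
    intro F F₀ v t T s m hs hm ht h0 hv hF hF0
    simp only [Prog.clockCost] at ht hF hF0
    obtain ⟨t, rfl⟩ : ∃ u, t = u + 1 := ⟨t - 1, by
      have := Nat.le_trans (Nat.le_mul_of_pos_right _ (Nat.succ_pos _)) ht; omega⟩
    cases T with
    | zero => simp [wp]
    | succ T =>
    rw [Prog.clocked, wp, wp_cons, wp, wp_cons F₀]
    refine hp _ _ v t T s m hs hm (by nlinarith) h0 (fun T' m' => le_wp hv _ _ _) ?_ ?_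
    · intro t' s' T' m' hs' hk hm' h0' ht' hT'
      obtain ⟨u, hu⟩ := Nat.exists_eq_add_of_le hk.2
      rw [show s vClk 0 - s' vClk 0 = u by omega] at ht'
      refine hq _ _ v t' T' s' m' hs' hm' ?_ h0' hv ?_ ?_
      · rw [hu] at ht
        nlinarith
      · intro t'' s'' T'' m'' hs'' hk' hm'' h0'' ht'' hT''
        refine hF t'' s'' T'' m'' hs'' (hk.trans hk') hm'' h0'' ?_ (by omega)
        obtain ⟨w, hw⟩ := Nat.exists_eq_add_of_le hk'.2
        rw [show s' vClk 0 - s'' vClk 0 = w by omega] at ht''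
        rw [show s vClk 0 - s'' vClk 0 = u + w by omega]
        nlinarith
      · intro hT t'' s'' hs'' hk' h0'' ht''
        refine hF0 (by omega) t'' s'' hs'' (hk.trans hk') h0'' ?_
        obtain ⟨w, hw⟩ := Nat.exists_eq_add_of_le hk'.2
        rw [show s' vClk 0 - s'' vClk 0 = w by omega] at ht''
        rw [show s vClk 0 - s'' vClk 0 = u + w by omega]
        nlinarith
    · intro hT t' s' hs' hk h0' ht'
      obtain ⟨u, hu⟩ := Nat.exists_eq_add_of_le hk.2
      rw [show s vClk 0 - s' vClk 0 = u by omega] at ht'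
      -- The clock ran out inside `p`, so `q` is no longer compared with the original; the
      -- unconditional bound for clocked programs takes over.
      refine wp_clocked_le q _ v t' s' hs' ?_ fun t'' s'' hs'' hk' ht'' => ?_
      · rw [hu] at ht
        nlinarith
      · refine hF0 (by omega) t'' s'' hs'' (hk.trans hk') (by have := hk'.2; omega) ?_
        obtain ⟨w, hw⟩ := Nat.exists_eq_add_of_le hk'.2
        rw [show s' vClk 0 - s'' vClk 0 = w by omega] at ht''
        rw [show s vClk 0 - s'' vClk 0 = u + w by omega]
        nlinarith
  | branch x y p q hp hq =>
    intro F F₀ v t T s m hs hm ht h0 hv hF hF0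
    simp only [Prog.clockCost] at ht hF hF0
    obtain ⟨t, rfl⟩ : ∃ u, t = u + 1 := ⟨t - 1, by
      have := Nat.le_trans (Nat.le_mul_of_pos_right _ (Nat.succ_pos _)) ht; omega⟩
    cases T with
    | zero => simp [wp]
    | succ T =>
    rw [Prog.clocked, wp, wp, hm.eval_shifted, hm.eval_shifted]
    split_ifs
    · refine hp _ _ v t T s m hs hm (by nlinarith) h0 hv ?_ ?_
      · intro t' s' T' m' hs' hk hm' h0' ht' hT'
        refine hF t' s' T' m' hs' hk hm' h0' ?_ (by omega)
        nlinarith [Nat.zero_le (q.clockCost * (s vClk 0 - s' vClk 0 + 1))]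
      · intro hT t' s' hs' hk h0' ht'
        refine hF0 (by omega) t' s' hs' hk h0' ?_
        nlinarith [Nat.zero_le (q.clockCost * (s vClk 0 - s' vClk 0 + 1))]
    · refine hq _ _ v t T s m hs hm (by nlinarith) h0 hv ?_ ?_
      · intro t' s' T' m' hs' hk hm' h0' ht' hT'
        refine hF t' s' T' m' hs' hk hm' h0' ?_ (by omega)
        nlinarith [Nat.zero_le (p.clockCost * (s vClk 0 - s' vClk 0 + 1))]
      · intro hT t' s' hs' hk h0' ht'
        refine hF0 (by omega) t' s' hs' hk h0' ?_
        nlinarith [Nat.zero_le (p.clockCost * (s vClk 0 - s' vClk 0 + 1))]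
  | loop x y p hp =>
    intro F F₀ v t T s m hs hm ht h0 hv hF hF0
    -- Here the induction is on the fuel of the original program, of which each iteration uses at
    -- least one unit.
    induction T using Nat.strong_induction_on generalizing t s m with
    | _ T ih =>
    simp only [Prog.clockCost] at ht hF hF0 ih
    obtain ⟨t, rfl⟩ : ∃ u, t = u + 1 := ⟨t - 1, by
      have := Nat.le_trans (Nat.le_mul_of_pos_right _ (Nat.succ_pos _)) ht; omega⟩
    cases T with
    | zero => simp [wp]
    | succ T =>
    -- As long as the clock is positive, the guarded test agrees with the original one.
    have hcond : (0 : Expr).eval s < (y.shifted - x.shifted -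
        (y.shifted - x.shifted - .var vClk)).eval s ↔ x.eval m < y.eval m := by
      simp only [Expr.eval_ofNat, Expr.eval_sub, Expr.eval_var, hm.eval_shifted]
      omega
    rw [Prog.clocked, wp_loop, wp_loop]
    simp only [hcond]
    split_ifs with hlt
    · obtain ⟨t, rfl⟩ : ∃ u, t = u + 2 := ⟨t - 2, by
        have := Nat.le_trans (Nat.le_mul_of_pos_right _ (Nat.succ_pos _)) ht; omega⟩
      rw [show t + 2 = t + 1 + 1 from rfl, wp, wp]
      change wp F t (p.clocked :: [(Prog.loop x y p).clocked]) (tick s) ≤ _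
      rw [wp_cons, wp_cons F₀]
      obtain ⟨c, hc⟩ : ∃ c, s vClk 0 = c + 1 := ⟨s vClk 0 - 1, by omega⟩
      have hct : tick s vClk 0 = c := by rw [clk_tick, hc]; omega
      rw [hc] at ht hF hF0
      -- the continuation after the clock has run out
      have hzero : c ≤ T → ∀ t' s', Fresh s' → Keeps (tick s) s' → s' vClk 0 = 0 →
          t ≤ t' + p.clockCost * (c + 1) →
          wp F t' [(Prog.loop x y p).clocked] s' ≤ v := by
        intro hT t' s' hs' hk h0' ht'
        refine wp_clocked_le (.loop x y p) _ v t' s' hs' ?_ fun t'' s'' hs'' hk' ht'' => ?_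
        · rw [h0']
          simp only [Prog.clockCost]
          nlinarith
        · have h0'' : s'' vClk 0 = 0 := by have := hk'.2; omega
          refine hF0 (by omega) t'' s'' hs'' (((keeps_tick s).trans hk).trans hk') h0'' ?_
          rw [h0', h0''] at ht''
          rw [h0'']
          simp only [Prog.clockCost] at ht''
          simp only [Nat.sub_zero, zero_add, mul_one] at ht'' ⊢
          nlinarith
      rcases Nat.eq_zero_or_pos c with rfl | hcpos
      -- This tick used up the clock: the simulation is abandoned, and only the lower bound `v` for
      -- the original side is used.
      · refine le_trans ?_ (le_wp (v := v) (fun _ _ => le_wp hv _ _ _) _ _ _)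
        refine wp_clocked_le p _ v t _ (fresh_tick hs) (by rw [hct]; nlinarith)
          fun t' s' hs' hk ht' => ?_
        have h0' : s' vClk 0 = 0 := by have := hk.2; omega
        refine hzero (by omega) t' s' hs' hk h0' ?_
        rwa [hct, h0'] at ht'
      · refine hp _ _ v t T _ m (fresh_tick hs) hm.tick (by rw [hct]; nlinarith) (by omega)
          (fun _ _ => le_wp hv _ _ _) ?_ ?_
        · intro t' s' T' m' hs' hk hm' h0' ht' hT'
          obtain ⟨w, hw⟩ := Nat.exists_eq_add_of_le hk.2
          rw [hct] at hw hT'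
          rw [hct, show c - s' vClk 0 = w by omega] at ht'
          refine ih T' (by omega) t' s' m' hs' hm' ?_ h0' ?_ ?_
          · rw [hw] at ht
            nlinarith
          · intro t'' s'' T'' m'' hs'' hk' hm'' h0'' ht'' hT''
            refine hF t'' s'' T'' m'' hs'' (((keeps_tick s).trans hk).trans hk') hm'' h0'' ?_
              (by omega)
            obtain ⟨w', hw'⟩ := Nat.exists_eq_add_of_le hk'.2
            rw [show s' vClk 0 - s'' vClk 0 = w' by omega] at ht''
            rw [show c + 1 - s'' vClk 0 = w + w' + 1 by omega]
            nlinarith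
          · intro hT t'' s'' hs'' hk' h0'' ht''
            refine hF0 (by omega) t'' s'' hs'' (((keeps_tick s).trans hk).trans hk') h0'' ?_
            obtain ⟨w', hw'⟩ := Nat.exists_eq_add_of_le hk'.2
            rw [show s' vClk 0 - s'' vClk 0 = w' by omega] at ht''
            rw [show c + 1 - s'' vClk 0 = w + w' + 1 by omega]
            nlinarith
        · intro hT t' s' hs' hk h0' ht'
          rw [hct] at hT
          rw [hct, h0'] at ht'
          exact hzero hT t' s' hs' hk h0' ht'
    · rw [wp_nil, wp_nil]
      refine hF t s T m hs (Keeps.refl s) hm h0 ?_ (by omega)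
      rw [Nat.sub_self]
      omega

/-! ### The distinguisher for planted cliques -/

notation "aAdj" => (1 : ℕ)
notation "aOut" => (2 : ℕ)
notation "aRow" => (3 : ℕ)
notation "aTup" => (4 : ℕ)
notation "aMat" => (5 : ℕ)
notation "vBits" => (6 : ℕ)
notation "vPow" => (7 : ℕ)
notation "vStage" => (8 : ℕ)
notation "vMu" => (9 : ℕ)
notation "vRep" => (10 : ℕ)
notation "vDone" => (11 : ℕ)
notation "vSize" => (15 : ℕ)
notation "vBudget" => (16 : ℕ)
notation "vH" => (17 : ℕ)
notation "vLen" => (18 : ℕ)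
notation "vX" => (19 : ℕ)
notation "vI" => (20 : ℕ)
notation "vJ" => (21 : ℕ)
notation "vA" => (22 : ℕ)
notation "vC" => (23 : ℕ)
notation "vPtrI" => (24 : ℕ)
notation "vPtrJ" => (25 : ℕ)
notation "vIdx" => (26 : ℕ)
notation "vFlag" => (27 : ℕ)
notation "vCnt" => (28 : ℕ)
notation "vTot" => (29 : ℕ)
notation "vAcc" => (30 : ℕ)
notation "vCoin" => (31 : ℕ)
notation "vE" => (32 : ℕ)
notation "vF" => (33 : ℕ)

/-- `bits := ⌈log₂ n⌉`. -/
def logProg : Prog :=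
  .seq (.assign vBits 0 0) (.seq (.assign vPow 0 1)
    (.loop (.var vPow) (.var 0)
      (.seq (.assign vPow 0 (.var vPow + .var vPow)) (.assign vBits 0 (.var vBits + 1)))))

theorem runs_logProg {s : Store} {n : ℕ} (hn : s 0 0 = n) :
    Runs logProg s (n * 4 + 5) fun s' => Frame [vBits, vPow] s s' ∧ s' vBits 0 = Nat.clog 2 n := by
  have hclog : Nat.clog 2 n ≤ n := Nat.clog_le_of_le_pow (Nat.lt_two_pow_self).le
  refine (Runs.seq (c := 1) (d := 1 + (Nat.clog 2 n * 4 + 1) + 1) (Runs.assign rfl)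
    fun s₁ h₁ => Runs.seq (Runs.assign rfl) fun s₂ h₂ => ?_).mono (by omega) fun _ h => h
  subst h₁
  subst h₂
  refine (Runs.loop (c := 3) (m := Nat.clog 2 n) (fun i s' => Frame [vBits, vPow] s s' ∧
    s' vBits 0 = i ∧ s' vPow 0 = 2 ^ i) ?_ ?_ ?_ ?_).mono le_rfl ?_
  · rintro i hi s' ⟨h1, h2, h3⟩
    have := Nat.lt_clog_iff_pow_lt one_lt_two |>.1 hi
    simpa [h3, h1 0, hn] using this
  · rintro s' ⟨h1, h2, h3⟩
    simpa [h3, h1 0, hn] using Nat.le_pow_clog one_lt_two n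
  · rintro i hi s' ⟨h1, h2, h3⟩
    refine Runs.seq (c := 1) (d := 1) (Runs.assign rfl) fun s₁ e₁ => ?_
    subst e₁
    refine Runs.assign ⟨?_, ?_, ?_⟩
    · exact (h1.set _ _ (by simp)).set _ _ (by simp)
    · simp [Store.set_apply, h2]
    · simp [Store.set_apply, h3, pow_succ, mul_two]
  · refine ⟨?_, ?_, ?_⟩
    · exact ((Frame.refl _ _).set _ _ (by simp)).set _ _ (by simp)
    · simp [Store.set_apply]
    · simp [Store.set_apply]
  · rintro s' ⟨h1, h2, h3⟩
    exact ⟨h1, h2⟩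

/-- Put `row[u] := u * n`, and add loops to the adjacency matrix. -/
def rowProg : Prog :=
  .seq (.assign vX 0 0) (forLoop vI (.var 0)
    (.seq (.assign aRow (.var vI) (.var vX))
      (.seq (.assign aAdj (.var vX + .var vI) 1) (.assign vX 0 (.var vX + .var 0)))))

theorem runs_rowProg {s : Store} {n : ℕ} (hn : s 0 0 = n) :
    Runs rowProg s (n * 8 + 5) fun s' => Frame [aRow, aAdj, vX, vI] s s' ∧
      (∀ u < n, s' aRow u = u * n) ∧
      ∀ i, s' aAdj i = if ∃ u < n, i = u * n + u then 1 else s aAdj i := by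
  refine (Runs.seq (c := 1) (d := n * (5 + 3) + 3) (Runs.assign rfl)
    fun s₁ h₁ => ?_).mono (by omega) fun _ h => h
  subst h₁
  refine (Runs.forLoop (c := 5) (m := n) (fun i s' => Frame [aRow, aAdj, vX, vI] s s' ∧
    s' vI 0 = i ∧ s' vX 0 = i * n ∧ (∀ u < i, s' aRow u = u * n) ∧
    ∀ k, s' aAdj k = if ∃ u < i, k = u * n + u then 1 else s aAdj k) ?_ ?_ ?_ ?_).mono le_rfl ?_
  · intro i s' h
    exact h.2.1
  · intro i s' h
    simp [h.1 0, hn]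
  · rintro i hi s' ⟨h1, h2, h3, h4, h5⟩
    refine Runs.seq (c := 1) (d := 3) (Runs.assign rfl) fun s₁ e₁ => ?_
    subst e₁
    refine Runs.seq (c := 1) (d := 1) (Runs.assign rfl) fun s₁ e₁ => ?_
    subst e₁
    refine Runs.assign ⟨?_, ?_, ?_, ?_, ?_⟩
    · exact (((h1.set _ _ (by simp)).set _ _ (by simp)).set _ _ (by simp)).set _ _ (by simp)
    · simp [Store.set_apply, h2]
    · simp [Store.set_apply, h3, h1 0, hn, add_mul]
    · intro u hu
      rcases Nat.lt_succ_iff_lt_or_eq.1 hu with hu | rfl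
      · have : u ≠ i := by omega
        simp [Store.set_apply, h2, h3, this, h4 u hu]
      · simp [Store.set_apply, h2, h3]
    · intro k
      simp only [Store.set_apply, Expr.eval_add, Expr.eval_var, Expr.eval_ofNat]
      simp [h2, h3, h5 k]
      by_cases hk : k = i * n + i
      · subst hk
        rw [if_pos rfl, if_pos ⟨i, le_rfl, rfl⟩]
      · rw [if_neg hk]
        congr 1
        refine propext ⟨fun ⟨u, hu, hu'⟩ => ⟨u, by omega, hu'⟩, fun ⟨u, hu, hu'⟩ => ⟨u, ?_, hu'⟩⟩
        rcases Nat.lt_or_ge u i with h | h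
        · exact h
        · obtain rfl : u = i := by omega
          exact absurd hu' hk
  · refine ⟨?_, ?_, ?_, ?_, ?_⟩
    · exact ((Frame.refl _ _).set _ _ (by simp)).set _ _ (by simp)
    · simp [Store.set_apply]
    · simp [Store.set_apply]
    · simp
    · simp [Store.set_apply]
  · rintro s' ⟨h1, h2, h3, h4, h5⟩
    exact ⟨h1, h4, h5⟩

/-- `d := n ^ e`. -/
def powProg (d : ℕ) (e : Expr) : Prog :=
  .seq (.assign d 0 1) (forLoop vE e
    (.seq (.assign vX 0 0) (.seq (forLoop vF (.var 0) (.assign vX 0 (.var vX + .var d)))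
      (.assign d 0 (.var vX)))))

theorem runs_powProg {s : Store} {n d m : ℕ} {e : Expr} (hn : s 0 0 = n) (hd : 0 < d) (hd' : d < vX)
    (he : ∀ s', Frame [d, vX, vE, vF] s s' → e.eval s' = m) :
    Runs (powProg d e) s (m * (n * 4 + 10) + 5) fun s' => Frame [d, vX, vE, vF] s s' ∧
      s' d 0 = n ^ m := by
  have d0 : 0 ≠ d := by omega
  have d1 : d ≠ vX := by omega
  have d2 : d ≠ vE := by omega
  have d3 : d ≠ vF := by omega
  refine (Runs.seq (c := 1) (d := m * (n * 4 + 10) + 3) (Runs.assign rfl)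
    fun s₁ h₁ => ?_).mono (by omega) fun _ h => h
  subst h₁
  refine (Runs.forLoop (c := n * 4 + 7) (m := m) (fun i s' => Frame [d, vX, vE, vF] s s' ∧
    s' vE 0 = i ∧ s' d 0 = n ^ i) ?_ ?_ ?_ ?_).mono le_rfl ?_
  · intro i s' h
    exact h.2.1
  · intro i s' h
    exact he _ h.1
  · rintro i hi s' ⟨h1, h2, h3⟩
    refine (Runs.seq (c := 1) (d := (n * (1 + 3) + 3) + 1 + 1) (Runs.assign rfl)
      fun s₁ e₁ => ?_).mono (by omega) fun _ h => h
    subst e₁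
    refine Runs.seq (d := 1) (Runs.forLoop (c := 1) (m := n) (fun k s'' =>
      Frame [d, vX, vE, vF] s s'' ∧ s'' vE 0 = i ∧ s'' vF 0 = k ∧ s'' d 0 = n ^ i ∧
      s'' vX 0 = k * n ^ i) ?_ ?_ ?_ ?_) fun s'' h => Runs.assign ⟨?_, ?_, ?_⟩
    · intro i s' h
      exact h.2.2.1
    · intro i s' h
      simp [h.1 0, hn, d0]
    · rintro k hk s'' ⟨g1, g2, g3, g4, g5⟩
      refine Runs.assign ⟨?_, ?_, ?_, ?_, ?_⟩
      · exact (g1.set _ _ (by simp)).set _ _ (by simp)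
      · simp [Store.set_apply, g2]
      · simp [Store.set_apply, g3]
      · simp [Store.set_apply, g4, d1, d3]
      · simp [Store.set_apply, g5, g4, add_mul]
    · refine ⟨?_, ?_, ?_, ?_, ?_⟩
      · exact (h1.set _ _ (by simp)).set _ _ (by simp)
      · simp [Store.set_apply, h2]
      · simp [Store.set_apply]
      · simp [Store.set_apply, h3, d1, d3]
      · simp [Store.set_apply]
    · exact (h.1.set _ _ (by simp)).set _ _ (by simp)
    · simp [Store.set_apply, h.2.1, d2.symm]
    · simp [Store.set_apply, h.2.2.2.2, d2, pow_succ']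
  · refine ⟨?_, ?_, ?_⟩
    · exact ((Frame.refl _ _).set _ _ (by simp)).set _ _ (by simp)
    · simp [Store.set_apply]
    · simp [Store.set_apply, d2]
  · rintro s' ⟨h1, h2, h3⟩
    exact ⟨h1, h3⟩

/-- `h := ⌈c * bits / mu⌉`. -/
def divProg (c : ℕ) : Prog :=
  .seq (.assign vH 0 0) (.seq (.assign vX 0 (.smul c (.var vBits)))
    (.loop 0 (.var vX) (.seq (.assign vX 0 (.var vX - .var vMu)) (.assign vH 0 (.var vH + 1)))))

theorem runs_divProg {s : Store} {b c μ : ℕ} (hb : s vBits 0 = b) (hμ : s vMu 0 = μ) (h0 : 0 < μ) :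
    Runs (divProg c) s (c * b * 4 + 5) fun s' => Frame [vH, vX] s s' ∧
      s' vH 0 = c * b ⌈/⌉ μ := by
  have hle : c * b ⌈/⌉ μ ≤ c * b := by
    rw [ceilDiv_le_iff_le_mul h0]
    exact Nat.le_mul_of_pos_left _ h0
  refine (Runs.seq (c := 1) (d := 1 + (c * b ⌈/⌉ μ * 4 + 1) + 1) (Runs.assign rfl)
    fun s₁ h₁ => Runs.seq (Runs.assign rfl) fun s₂ h₂ => ?_).mono (by omega) fun _ h => h
  subst h₁
  subst h₂
  refine (Runs.loop (c := 3) (m := c * b ⌈/⌉ μ) (fun i s' => Frame [vH, vX] s s' ∧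
    s' vH 0 = i ∧ s' vX 0 = c * b - μ * i) ?_ ?_ ?_ ?_).mono le_rfl ?_
  · rintro i hi s' ⟨h1, h2, h3⟩
    rw [lt_iff_not_ge, ceilDiv_le_iff_le_mul h0, not_le] at hi
    simpa [h3] using hi
  · rintro s' ⟨h1, h2, h3⟩
    have := (ceilDiv_le_iff_le_mul (b := c * b) h0).1 le_rfl
    simpa [h3] using this
  · rintro i hi s' ⟨h1, h2, h3⟩
    refine Runs.seq (c := 1) (d := 1) (Runs.assign rfl) fun s₁ e₁ => ?_
    subst e₁
    refine Runs.assign ⟨?_, ?_, ?_⟩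
    · exact (h1.set _ _ (by simp)).set _ _ (by simp)
    · simp [Store.set_apply, h2]
    · simp [Store.set_apply, h3, h1 vMu, hμ, mul_add, Nat.sub_sub]
  · refine ⟨?_, ?_, ?_⟩
    · exact ((Frame.refl _ _).set _ _ (by simp)).set _ _ (by simp)
    · simp [Store.set_apply]
    · simp [Store.set_apply, hb]
  · rintro s' ⟨h1, h2, h3⟩
    exact ⟨h1, h2⟩

/-- `len := size * (c * mu)`. -/
def lenProg (c : ℕ) : Prog :=
  .seq (.assign vLen 0 0) (forLoop vI (.var vSize)
    (.assign vLen 0 (.var vLen + .smul c (.var vMu))))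

theorem runs_lenProg {s : Store} {N c μ : ℕ} (hN : s vSize 0 = N) (hμ : s vMu 0 = μ) :
    Runs (lenProg c) s (N * 4 + 5) fun s' => Frame [vLen, vI] s s' ∧
      s' vLen 0 = N * (c * μ) := by
  refine (Runs.seq (c := 1) (d := N * (1 + 3) + 3) (Runs.assign rfl)
    fun s₁ h₁ => ?_).mono (by omega) fun _ h => h
  subst h₁
  refine (Runs.forLoop (c := 1) (m := N) (fun i s' => Frame [vLen, vI] s s' ∧
    s' vI 0 = i ∧ s' vLen 0 = i * (c * μ)) ?_ ?_ ?_ ?_).mono le_rfl ?_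
  · intro i s' h
    exact h.2.1
  · intro i s' h
    simp [h.1 vSize, hN]
  · rintro i hi s' ⟨h1, h2, h3⟩
    refine Runs.assign ⟨?_, ?_, ?_⟩
    · exact (h1.set _ _ (by simp)).set _ _ (by simp)
    · simp [Store.set_apply, h2]
    · simp [Store.set_apply, h3, h1 vMu, hμ, add_mul]
  · refine ⟨?_, ?_, ?_⟩
    · exact ((Frame.refl _ _).set _ _ (by simp)).set _ _ (by simp)
    · simp [Store.set_apply]
    · simp [Store.set_apply]
  · rintro s' ⟨h1, h2, h3⟩
    exact ⟨h1, h3⟩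

/-! ### Sampling -/

/-- The vertex encoded by a number `r < 2 n`. -/
def vertexOf (n r : ℕ) : ℕ := if r < n then r else r - n

/-- Append a random bit to the binary number `x`. -/
def bitProg : Prog :=
  .seq (.flip vCoin 0) (.assign vX 0 (.var vX + .var vX + .var vCoin))

/-- `tup[i] :=` a random vertex. -/
def vertexProg : Prog :=
  .seq (.assign vX 0 0) (.seq (forLoop vA (.var vBits) bitProg)
    (.branch (.var vX) (.var 0) (.assign aTup (.var vI) (.var vX))
      (.assign aTup (.var vI) (.var vX - .var 0))))

/-- Fill `tup` with random vertices. -/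
def sampleProg : Prog := forLoop vI (.var vLen) vertexProg

theorem sum_range_two_pow_succ (d x : ℕ) (G : ℕ → ℝ≥0∞) :
    (∑ r ∈ Finset.range (2 ^ (d + 1)), G (2 ^ (d + 1) * x + r)) / 2 ^ (d + 1) =
      2⁻¹ * ((∑ r ∈ Finset.range (2 ^ d), G (2 ^ d * (x + x) + r)) / 2 ^ d) +
      2⁻¹ * ((∑ r ∈ Finset.range (2 ^ d), G (2 ^ d * (x + x + 1) + r)) / 2 ^ d) := by
  rw [pow_succ 2 d, mul_two, Finset.sum_range_add]
  simp only [ENNReal.div_eq_inv_mul]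
  rw [← mul_assoc, ← mul_assoc, ← mul_add]
  congr 1
  · rw [pow_succ, mul_comm, ENNReal.mul_inv] <;> simp
  · congr 1
    · refine Finset.sum_congr rfl fun r _ => ?_
      ring_nf
    · refine Finset.sum_congr rfl fun r _ => ?_
      ring_nf

/-- With `d` tosses to come and prefix `x`, the final number is `2 ^ d * x + r` with `r` uniform
below `2 ^ d`; the right side is the average over `r`. -/
theorem wp_bits_le {F : ℕ → Store → ℝ≥0∞} {K : List Prog} {b : ℕ} (G : ℕ → ℝ≥0∞) (s₀ : Store)
    (hb : s₀ vBits 0 = b) (T : ℕ)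
    (hG : ∀ t s, Frame [vCoin, vX, vA] s₀ s → T ≤ t → wp F t K s ≤ G (s vX 0)) :
    ∀ (d t : ℕ) (s : Store), Frame [vCoin, vX, vA] s₀ s → s vA 0 + d = b → T + d * 6 + 1 ≤ t →
      wp F t (.loop (.var vA) (.var vBits) (.seq bitProg (.assign vA 0 (.var vA + 1))) :: K) s ≤
        (∑ r ∈ Finset.range (2 ^ d), G (2 ^ d * s vX 0 + r)) / 2 ^ d := by
  intro d
  induction d with
  | zero =>
    intro t s hs hd ht
    obtain ⟨t, rfl⟩ : ∃ u, t = u + 1 := ⟨t - 1, by omega⟩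
    have : ¬ s vA 0 < s vBits 0 := by rw [hs vBits (by simp), hb]; omega
    rw [wp_loop, Expr.eval_var, Expr.eval_var, if_neg this]
    simpa using hG t s hs (by omega)
  | succ d ih =>
    intro t s hs hd ht
    obtain ⟨t, rfl⟩ : ∃ u, t = u + 6 := ⟨t - 6, by omega⟩
    have : s vA 0 < s vBits 0 := by rw [hs vBits (by simp), hb]; omega
    rw [show t + 6 = t + 1 + 1 + 1 + 1 + 1 + 1 from rfl, wp_loop, Expr.eval_var, Expr.eval_var,
      if_pos this, bitProg, wp, wp, wp, wp, wp, wp, wp, sum_range_two_pow_succ]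
    gcongr
    · refine (ih t _ ?_ ?_ (by omega)).trans (le_of_eq ?_)
      · exact ((hs.set _ _ (by simp)).set _ _ (by simp)).set _ _ (by simp)
      · simp [Store.set_apply]; omega
      · simp [Store.set_apply]
    · refine (ih t _ ?_ ?_ (by omega)).trans (le_of_eq ?_)
      · exact ((hs.set _ _ (by simp)).set _ _ (by simp)).set _ _ (by simp)
      · simp [Store.set_apply]; omega
      · simp [Store.set_apply]

theorem wp_vertexProg_le {F : ℕ → Store → ℝ≥0∞} {K : List Prog} {b n : ℕ} {s : Store}
    (G : ℕ → ℝ≥0∞) (hb : s vBits 0 = b) (hn : s 0 0 = n) (T t : ℕ) (ht : T + b * 6 + 8 ≤ t)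
    (hG : ∀ t s' r, r < 2 ^ b → Frame [vCoin, vX, vA, aTup] s s' →
      s' aTup = Function.update (s aTup) (s vI 0) (vertexOf n r) → T ≤ t → wp F t K s' ≤ G r) :
    wp F t (vertexProg :: K) s ≤ (∑ r ∈ Finset.range (2 ^ b), G r) / 2 ^ b := by
  obtain ⟨t, rfl⟩ : ∃ u, t = u + 5 := ⟨t - 5, by omega⟩
  rw [vertexProg, show t + 5 = t + 1 + 1 + 1 + 1 + 1 from rfl, wp, wp, wp, forLoop, wp, wp]
  -- The value `⊤` out of range supplies the bound `r < 2 ^ b` to the continuation without carrying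
  -- it through the loop.
  refine (wp_bits_le (b := b) (fun r => if r < 2 ^ b then G r else ⊤) s hb (T + 2) ?_ b t _
    ?_ ?_ (by omega)).trans ?_
  · intro t s' hs' ht
    split_ifs with hr
    swap
    · exact le_top
    obtain ⟨t, rfl⟩ : ∃ u, t = u + 2 := ⟨t - 2, by omega⟩
    rw [show t + 2 = t + 1 + 1 from rfl, wp]
    have hv : ∀ i, (if s' vX 0 < n then s' vX 0 else s' vX 0 - n) = i →
        wp F t K (s'.set aTup (s' vI 0) i) ≤ G (s' vX 0) := by
      rintro i rfl
      refine hG t _ _ hr ?_ ?_ (by omega)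
      · exact (hs'.mono (by simp)).set _ _ (by simp)
      · funext j
        simp [Store.set_apply, Function.update_apply, hs' vI, hs' aTup, vertexOf]
    have h0 : s' 0 0 = n := by rw [hs' 0 (by simp), hn]
    simp only [Expr.eval_var, h0]
    split_ifs with h
    · rw [wp]
      exact hv _ (if_pos h)
    · rw [wp]
      simp only [Expr.eval_sub, Expr.eval_var, h0]
      exact hv _ (if_neg h)
  · exact ((Frame.refl _ _).set _ _ (by simp)).set _ _ (by simp)
  · simp [Store.set_apply]
  · gcongr with r hr
    simp [Store.set_apply, Finset.mem_range.1 hr]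

theorem sum_fin_succ_pi {α : Type*} [Fintype α] (d : ℕ) (f : (Fin (d + 1) → α) → ℝ≥0∞) :
    ∑ r, f r = ∑ a, ∑ r : Fin d → α, f (Fin.cons a r) := by
  rw [← Fintype.sum_prod_type']
  exact (Fintype.sum_equiv (Fin.consEquiv fun _ => α) _ _ fun _ => rfl).symm

theorem wp_sample_le {F : ℕ → Store → ℝ≥0∞} {K : List Prog} {b n M : ℕ} (g : List ℕ → ℝ≥0∞)
    (s₀ : Store) (hb : s₀ vBits 0 = b) (hn : s₀ 0 0 = n) (hM : s₀ vLen 0 = M) (T : ℕ)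
    (hg : ∀ t s, Frame [vCoin, vX, vA, aTup, vI] s₀ s → T ≤ t → ∀ w : List ℕ, w.length = M →
      (∀ i (hi : i < w.length), s aTup i = w[i]) → wp F t K s ≤ g w) :
    ∀ (d t : ℕ) (s : Store) (w : List ℕ), Frame [vCoin, vX, vA, aTup, vI] s₀ s → s vI 0 = w.length →
      w.length + d = M → (∀ i (hi : i < w.length), s aTup i = w[i]) →
      T + d * (b * 6 + 11) + 1 ≤ t →
      wp F t (.loop (.var vI) (.var vLen) (.seq vertexProg (.assign vI 0 (.var vI + 1))) :: K) s ≤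
        (∑ r : Fin d → Fin (2 ^ b), g (w ++ List.ofFn fun i => vertexOf n (r i))) /
          (2 ^ b) ^ d := by
  intro d
  induction d with
  | zero =>
    intro t s w hs hI hd hw ht
    obtain ⟨t, rfl⟩ : ∃ u, t = u + 1 := ⟨t - 1, by omega⟩
    have : ¬ s vI 0 < s vLen 0 := by rw [hs vLen (by simp), hM]; omega
    rw [wp_loop, Expr.eval_var, Expr.eval_var, if_neg this]
    simpa using hg t s hs (by omega) w hd hw
  | succ d ih =>
    intro t s w hs hI hd hw ht
    rw [add_mul, one_mul] at ht
    obtain ⟨t, rfl⟩ : ∃ u, t = u + 2 := ⟨t - 2, by omega⟩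
    have : s vI 0 < s vLen 0 := by rw [hs vLen (by simp), hM]; omega
    rw [show t + 2 = t + 1 + 1 from rfl, wp_loop, Expr.eval_var, Expr.eval_var, if_pos this, wp]
    refine (wp_vertexProg_le (b := b) (n := n) (fun r => (∑ r' : Fin d → Fin (2 ^ b),
      g (w ++ vertexOf n r :: List.ofFn fun i => vertexOf n (r' i))) / (2 ^ b) ^ d)
      (by rw [hs vBits (by simp), hb]) (by rw [hs 0 (by simp), hn])
      (T + d * (b * 6 + 11) + 2) t (by omega) ?_).trans (le_of_eq ?_)
    · intro t s' r hr hs' htup ht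
      obtain ⟨t, rfl⟩ : ∃ u, t = u + 1 := ⟨t - 1, by omega⟩
      have hI' : s' vI 0 = w.length := by rw [hs' vI (by simp), hI]
      rw [wp]
      refine (ih t _ (w ++ [vertexOf n r]) ?_ ?_ ?_ ?_ (by omega)).trans (le_of_eq ?_)
      · exact (hs.trans hs' (by simp)).set _ _ (by simp)
      · simp [Store.set_apply, hI']
      · simp; omega
      · intro i hi
        rw [Store.set_ne _ _ _ (by simp), htup, hI]
        rw [List.length_append, List.length_singleton] at hi
        rcases Nat.lt_succ_iff_lt_or_eq.1 hi with h | rfl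
        · rw [Function.update_of_ne h.ne, hw i h, List.getElem_append_left h]
        · simp
      · simp
    · rw [sum_fin_succ_pi, Finset.sum_range]
      simp only [ENNReal.div_eq_inv_mul, ← Finset.mul_sum, List.ofFn_succ, Fin.cons_zero,
        Fin.cons_succ]
      rw [← mul_assoc]
      congr 1
      rw [pow_succ, mul_comm, ENNReal.mul_inv] <;> simp

theorem wp_sampleProg_le {F : ℕ → Store → ℝ≥0∞} {K : List Prog} {b n M : ℕ} {s : Store}
    (g : (Fin M → Fin (2 ^ b)) → ℝ≥0∞) (hb : s vBits 0 = b) (hn : s 0 0 = n) (hM : s vLen 0 = M)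
    (T t : ℕ) (ht : T + M * (b * 6 + 11) + 3 ≤ t)
    (hg : ∀ t s' r, Frame [vCoin, vX, vA, aTup, vI] s s' → T ≤ t →
      (∀ i : Fin M, s' aTup i = vertexOf n (r i)) → wp F t K s' ≤ g r) :
    wp F t (sampleProg :: K) s ≤ (∑ r, g r) / (2 ^ b) ^ M := by
  obtain ⟨t, rfl⟩ : ∃ u, t = u + 2 := ⟨t - 2, by omega⟩
  rw [sampleProg, forLoop, show t + 2 = t + 1 + 1 from rfl, wp, wp]
  -- The loop bound needs a function of the sampled vertices, whereas `g` depends on the numbers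
  -- that encode them. The infimum over all encodings is such a function, and it is at most `g` at
  -- the numbers drawn.
  refine (wp_sample_le (b := b) (n := n) (M := M) (fun w =>
    ⨅ r : Fin M → Fin (2 ^ b), ⨅ _ : w = List.ofFn fun i => vertexOf n (r i), g r)
    s hb hn hM T ?_ M t _ [] ?_ ?_ ?_ ?_ (by omega)).trans ?_
  · intro t s' hs' ht w hw htup
    refine le_iInf₂ fun r hr => hg t s' r hs' ht fun i => ?_
    rw [htup i (by omega)]
    subst hr
    simp
  · exact (Frame.refl _ _).set _ _ (by simp)
  · simp [Store.set_apply]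
  · simp
  · simp
  · gcongr with r
    exact iInf₂_le (f := fun r' (_ : ([] ++ List.ofFn fun i => vertexOf n (r i)) =
      List.ofFn fun i => vertexOf n (r' i)) => g r') r rfl

/-! ### The product graph -/

/-- Clear the flag unless all cross pairs of the two current tuples are adjacent. -/
def crossProg (c : ℕ) : Prog :=
  forLoop vA (.smul c (.var vMu)) (forLoop vC (.smul c (.var vMu))
    (.assign vFlag 0 (.var vFlag - (1 - .cell aAdj
      (.cell aRow (.cell aTup (.var vPtrI + .var vA)) + .cell aTup (.var vPtrJ + .var vC))))))

/-- All cross pairs of the tuples starting at `p` and `p'` are adjacent. -/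
def CrossAdj (s : Store) (l p p' : ℕ) : Prop :=
  ∀ a < l, ∀ c < l, s aAdj (s aRow (s aTup (p + a)) + s aTup (p' + c)) ≠ 0

theorem runs_crossProg {s : Store} {c μ f : ℕ} (hμ : s vMu 0 = μ) (hf : s vFlag 0 = f)
    (hf1 : f ≤ 1) :
    Runs (crossProg c) s (c * μ * (c * μ * 4 + 6) + 3) fun s' => Frame [vA, vC, vFlag] s s' ∧
      s' vFlag 0 ≤ 1 ∧
      (s' vFlag 0 = 1 ↔ f = 1 ∧ CrossAdj s (c * μ) (s vPtrI 0) (s vPtrJ 0)) := by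
  set l := c * μ with hl
  refine (Runs.forLoop (c := l * (1 + 3) + 3) (m := l) (fun i s' => Frame [vA, vC, vFlag] s s' ∧
    s' vA 0 = i ∧ s' vFlag 0 ≤ 1 ∧ (s' vFlag 0 = 1 ↔ f = 1 ∧ ∀ a < i, ∀ c < l,
      s aAdj (s aRow (s aTup (s vPtrI 0 + a)) + s aTup (s vPtrJ 0 + c)) ≠ 0)) ?_ ?_ ?_ ?_).mono
      (by ring_nf; omega) ?_
  · intro i s' h
    exact h.2.1
  · intro i s' h
    simp [h.1 vMu, hμ, hl]
  · rintro i hi s' ⟨h1, h2, h3, h4⟩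
    refine (Runs.forLoop (c := 1) (m := l) (fun k s'' => Frame [vA, vC, vFlag] s s'' ∧
      s'' vA 0 = i ∧ s'' vC 0 = k ∧ s'' vFlag 0 ≤ 1 ∧ (s'' vFlag 0 = 1 ↔ (f = 1 ∧ ∀ a < i, ∀ c < l,
        s aAdj (s aRow (s aTup (s vPtrI 0 + a)) + s aTup (s vPtrJ 0 + c)) ≠ 0) ∧ ∀ c < k,
        s aAdj (s aRow (s aTup (s vPtrI 0 + i)) + s aTup (s vPtrJ 0 + c)) ≠ 0)) ?_ ?_ ?_ ?_).mono
      le_rfl ?_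
    · intro i s' h
      exact h.2.2.1
    · intro i s' h
      simp [h.1 vMu, hμ, hl]
    · rintro k hk s'' ⟨g1, g2, g3, g4, g5⟩
      refine Runs.assign ⟨?_, ?_, ?_, ?_, ?_⟩
      · exact (g1.set _ _ (by simp)).set _ _ (by simp)
      · simp [Store.set_apply, g2]
      · simp [Store.set_apply, g3]
      · simp [Store.set_apply]
        omega
      · simp only [Store.set_apply, Expr.eval_add, Expr.eval_var, Expr.eval_ofNat, Expr.eval_sub,
          Expr.eval_cell, g2, g3, g1 aAdj (by simp), g1 aRow (by simp), g1 aTup (by simp),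
          g1 vPtrI (by simp), g1 vPtrJ (by simp)]
        simp only [Nat.reduceEqDiff, false_and, if_false, and_self, if_true,
          Order.lt_add_one_iff, Nat.le_iff_lt_or_eq, or_imp, forall_and, forall_eq]
        rw [← and_assoc, ← g5]
        omega
    · refine ⟨?_, ?_, ?_, ?_, ?_⟩
      · exact h1.set _ _ (by simp)
      · simp [Store.set_apply, h2]
      · simp [Store.set_apply]
      · simp [Store.set_apply, h3]
      · simp [Store.set_apply, h4]
    · rintro s'' ⟨g1, g2, g3, g4, g5⟩
      refine ⟨g1.set _ _ (by simp), by simp [Store.set_apply, g2], by simpa [Store.set_apply], ?_⟩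
      rw [Store.set_ne _ _ _ (by simp), g5, and_assoc]
      simp only [Order.lt_add_one_iff, Nat.le_iff_lt_or_eq, or_imp, forall_and, forall_eq]
  · refine ⟨?_, ?_, ?_, ?_⟩
    · exact (Frame.refl _ _).set _ _ (by simp)
    · simp [Store.set_apply]
    · simp [Store.set_apply, hf, hf1]
    · simp [Store.set_apply, hf]
  · rintro s' ⟨h1, h2, h3, h4⟩
    exact ⟨h1, h3, h4⟩

/-- Compute one entry of the adjacency matrix of the product graph. -/
def entryProg (c : ℕ) : Prog :=
  -- The truncated subtractions give 1 if the two indices differ and 0 otherwise.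
  .seq (.assign vFlag 0 (1 - (1 - (.var vI - .var vJ + (.var vJ - .var vI)))))
    (.seq (crossProg c)
      (.seq (.assign aMat (.var vIdx) (.var vFlag))
        -- This copy is the input of the simulated program, which may overwrite it; the copy in
        -- `aMat` is kept for checking the output.
        (.seq (.assign (aAdj + aSim) (.var vOff + .var vIdx) (.var vFlag))
          (.seq (.assign vIdx 0 (.var vIdx + 1))
            (.assign vPtrJ 0 (.var vPtrJ + .smul c (.var vMu)))))))

/-- Compute the adjacency matrix of the product graph. -/
def buildProg (c : ℕ) : Prog :=
  .seq (.assign vIdx 0 0) (.seq (.assign vPtrI 0 0)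
    (forLoop vI (.var vSize)
      (.seq (.assign vPtrJ 0 0) (.seq (forLoop vJ (.var vSize) (entryProg c))
        (.assign vPtrI 0 (.var vPtrI + .smul c (.var vMu)))))))

open Classical in
/-- The entry of the adjacency matrix of the product graph in row `i` and column `j`. -/
def entry (s : Store) (l i j : ℕ) : ℕ := if i ≠ j ∧ CrossAdj s l (i * l) (j * l) then 1 else 0

/-- The arrays modified by `buildProg`. -/
abbrev buildVars : List ℕ :=
  [aMat, aAdj + aSim, vI, vJ, vA, vC, vPtrI, vPtrJ, vIdx, vFlag]

/-- The first `x` entries of the adjacency matrix of the product graph have been written. -/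
def Built (s₀ : Store) (l N x : ℕ) (s : Store) : Prop :=
  Frame buildVars s₀ s ∧ s vIdx 0 = x ∧ (∀ k < x, s aMat k = entry s₀ l (k / N) (k % N)) ∧
    ∀ k, s (aAdj + aSim) (s₀ vOff 0 + k) = if k < x then entry s₀ l (k / N) (k % N) else 0

theorem CrossAdj.congr {s s' : Store} (h : Frame buildVars s s') (l p p' : ℕ) :
    CrossAdj s' l p p' ↔ CrossAdj s l p p' := by
  simp only [CrossAdj, h aAdj (by simp), h aRow (by simp), h aTup (by simp)]

theorem runs_entryProg {s₀ s : Store} {c μ N i j : ℕ} (hμ : s₀ vMu 0 = μ) (hj : j < N)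
    (hs : Built s₀ (c * μ) N (i * N + j) s) (hI : s vI 0 = i) (hJ : s vJ 0 = j)
    (hPI : s vPtrI 0 = i * (c * μ)) (hPJ : s vPtrJ 0 = j * (c * μ)) :
    Runs (entryProg c) s (c * μ * (c * μ * 4 + 6) + 13) fun s' =>
      Built s₀ (c * μ) N (i * N + j + 1) s' ∧ s' vI 0 = i ∧ s' vJ 0 = j ∧
      s' vPtrI 0 = i * (c * μ) ∧ s' vPtrJ 0 = (j + 1) * (c * μ) := by
  obtain ⟨h1, h2, h3, h4⟩ := hs
  refine (Runs.seq (c := 1) (d := (c * μ * (c * μ * 4 + 6) + 3) + 7 + 1) (Runs.assign rfl)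
    fun s₁ e₁ => ?_).mono (by omega) fun _ h => h
  subst e₁
  refine Runs.seq (c := c * μ * (c * μ * 4 + 6) + 3) (d := 7) (runs_crossProg (μ := μ) (f := if i ≠ j then 1 else 0) ?_ ?_ ?_) ?_
  · simp [Store.set_apply, h1 vMu, hμ]
  · simp [Store.set_apply, hI, hJ]
    split_ifs <;> omega
  · split_ifs <;> omega
  rintro s₂ ⟨g1, g2, g3⟩
  have hfr : Frame buildVars s₀ s₂ := (h1.set _ _ (by simp)).trans g1 (by simp)
  have hIdx : s₂ vIdx 0 = i * N + j := by
    rw [g1 vIdx (by simp), Store.set_ne _ _ _ (by simp), h2]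
  have hI₂ : s₂ vI 0 = i := by rw [g1 vI (by simp), Store.set_ne _ _ _ (by simp), hI]
  have hJ₂ : s₂ vJ 0 = j := by rw [g1 vJ (by simp), Store.set_ne _ _ _ (by simp), hJ]
  have hPI₂ : s₂ vPtrI 0 = i * (c * μ) := by
    rw [g1 vPtrI (by simp), Store.set_ne _ _ _ (by simp), hPI]
  have hPJ₂ : s₂ vPtrJ 0 = j * (c * μ) := by
    rw [g1 vPtrJ (by simp), Store.set_ne _ _ _ (by simp), hPJ]
  have hmat : s₂ aMat = s aMat := by rw [g1 aMat (by simp), Store.set_ne _ _ _ (by simp)]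
  have hsim : s₂ (aAdj + aSim) = s (aAdj + aSim) := by
    rw [g1 _ (by simp), Store.set_ne _ _ _ (by simp)]
  have hdiv : (i * N + j) / N = i := by
    rw [mul_comm, Nat.mul_add_div (by omega), Nat.div_eq_of_lt hj, add_zero]
  have hmod : (i * N + j) % N = j := by
    rw [mul_comm, Nat.mul_add_mod, Nat.mod_eq_of_lt hj]
  have hflag : s₂ vFlag 0 = entry s₀ (c * μ) i j := by
    rw [entry, ← CrossAdj.congr (h1.set (a := vFlag) 0 _ (by simp))]
    rw [Store.set_ne (b := vPtrI) _ _ _ (by simp), Store.set_ne (b := vPtrJ) _ _ _ (by simp),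
      hPI, hPJ] at g3
    split_ifs with h
    · exact g3.2 ⟨if_pos h.1, h.2⟩
    · have : ¬ s₂ vFlag 0 = 1 := by
        intro h'
        obtain ⟨h5, h6⟩ := g3.1 h'
        refine h ⟨?_, h6⟩
        rintro rfl
        simp at h5
      omega
  refine Runs.seq (c := 1) (d := 5) (Runs.assign rfl) fun s₃ e₃ => ?_
  subst e₃
  refine Runs.seq (c := 1) (d := 3) (Runs.assign rfl) fun s₃ e₃ => ?_
  subst e₃
  refine Runs.seq (c := 1) (d := 1) (Runs.assign rfl) fun s₃ e₃ => ?_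
  subst e₃
  refine Runs.assign ⟨⟨?_, ?_, ?_, ?_⟩, ?_, ?_, ?_, ?_⟩
  · exact (((hfr.set _ _ (by simp)).set _ _ (by simp)).set _ _ (by simp)).set _ _ (by simp)
  · simp [Store.set_apply, hIdx]
  · intro k hk
    rcases Nat.lt_succ_iff_lt_or_eq.1 hk with hk | rfl
    · simp [Store.set_apply, hIdx, hk.ne, hmat, h3 k hk]
    · simp [Store.set_apply, hIdx, hdiv, hmod, hflag]
  · intro k
    have hoff : s₂ vOff 0 = s₀ vOff 0 := by rw [hfr vOff (by simp)]
    by_cases hk : k = i * N + j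
    · subst hk
      simp [Store.set_apply, hIdx, hoff, hdiv, hmod, hflag]
    · simp [Store.set_apply, hIdx, hoff, hk]
      have := h4 k
      simp at hsim this
      rw [hsim, this]
      congr 1
      exact propext (by omega)
  · simp [Store.set_apply, hI₂]
  · simp [Store.set_apply, hJ₂]
  · simp [Store.set_apply, hPI₂]
  · simp [Store.set_apply, hPJ₂, hfr vMu, hμ, add_mul]

theorem runs_buildProg {s : Store} {c μ N : ℕ} (hμ : s vMu 0 = μ) (hN : s vSize 0 = N)
    (hsim : ∀ k, s (aAdj + aSim) (s vOff 0 + k) = 0) :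
    Runs (buildProg c) s (N * (N * (c * μ * (c * μ * 4 + 6) + 16) + 10) + 7)
      (Built s (c * μ) N (N * N)) := by
  refine (Runs.seq (c := 1) (d := 1 + (N * (N * (c * μ * (c * μ * 4 + 6) + 16) + 10) + 3) + 1)
    (Runs.assign rfl)
    fun s₁ h₁ => Runs.seq (Runs.assign rfl) fun s₂ h₂ => ?_).mono (by omega) fun _ h => h
  subst h₁
  subst h₂
  refine (Runs.forLoop (c := N * (c * μ * (c * μ * 4 + 6) + 16) + 7) (m := N)
    (fun i s' => Built s (c * μ) N (i * N) s' ∧ s' vI 0 = i ∧ s' vPtrI 0 = i * (c * μ))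
    ?_ ?_ ?_ ?_).mono le_rfl ?_
  · intro i s' h
    exact h.2.1
  · intro i s' h
    simp [h.1.1 vSize, hN]
  · rintro i hi s' ⟨⟨h1, h2, h3, h4⟩, h5, h6⟩
    refine (Runs.seq (c := 1) (d := (N * (c * μ * (c * μ * 4 + 6) + 16) + 3) + 1 + 1)
      (Runs.assign rfl) fun s₁ e₁ => ?_).mono (by omega) fun _ h => h
    subst e₁
    refine Runs.seq (d := 1) (Runs.forLoop (c := c * μ * (c * μ * 4 + 6) + 13) (m := N)
      (fun j s'' => Built s (c * μ) N (i * N + j) s'' ∧ s'' vI 0 = i ∧ s'' vJ 0 = j ∧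
        s'' vPtrI 0 = i * (c * μ) ∧ s'' vPtrJ 0 = j * (c * μ)) ?_ ?_ ?_ ?_)
        fun s'' h => Runs.assign ⟨?_, ?_, ?_⟩
    · intro j s'' h
      exact h.2.2.1
    · intro j s'' h
      simp [h.1.1 vSize, hN]
    · rintro j hj s'' ⟨g1, g2, g3, g4, g5⟩
      refine (runs_entryProg hμ hj g1 g2 g3 g4 g5).mono le_rfl ?_
      rintro s₃ ⟨⟨k1, k2, k3, k4⟩, k5, k6, k7, k8⟩
      refine ⟨⟨?_, ?_, ?_, ?_⟩, ?_, ?_, ?_, ?_⟩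
      · exact k1.set _ _ (by simp)
      · rw [Store.set_ne _ _ _ (by simp), k2, add_assoc]
      · rwa [Store.set_ne _ _ _ (by simp), ← add_assoc]
      · rwa [Store.set_ne _ _ _ (by simp), ← add_assoc]
      · rw [Store.set_ne _ _ _ (by simp), k5]
      · rw [Store.set_self, k6]
      · rw [Store.set_ne _ _ _ (by simp), k7]
      · rw [Store.set_ne _ _ _ (by simp), k8]
    · refine ⟨⟨?_, ?_, ?_, ?_⟩, ?_, ?_, ?_, ?_⟩
      · exact (h1.set _ _ (by simp)).set _ _ (by simp)
      · simp [Store.set_apply, h2]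
      · simpa [Store.set_apply] using h3
      · simpa [Store.set_apply] using h4
      · simp [Store.set_apply, h5]
      · simp [Store.set_apply]
      · simp [Store.set_apply, h6]
      · simp [Store.set_apply]
    · obtain ⟨⟨g1, g2, g3, g4⟩, -⟩ := h
      rw [add_mul, one_mul]
      refine ⟨(g1.set _ _ (by simp)).set _ _ (by simp), ?_, ?_, ?_⟩
      · simp [Store.set_apply, g2]
      · simpa [Store.set_apply] using g3
      · simpa [Store.set_apply] using g4
    · simp [Store.set_apply, h.2.1]
    · simp [Store.set_apply, h.2.2.2.1, h.1.1 vMu, hμ, add_mul]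
  · refine ⟨⟨?_, ?_, ?_, ?_⟩, ?_, ?_⟩
    · exact (((Frame.refl _ _).set _ _ (by simp)).set _ _ (by simp)).set _ _ (by simp)
    · simp [Store.set_apply]
    · simp
    · simpa [Store.set_apply] using hsim
    · simp [Store.set_apply]
    · simp [Store.set_apply]
  · rintro s' ⟨h1, -⟩
    exact h1

end RAM

/-- The product graph of `G` for the tuples `y`: two tuples are adjacent if all their cross pairs
are equal or adjacent. -/
def tupleGraph {n N l : ℕ} (G : SimpleGraph (Fin n)) (y : Fin N → Fin l → Fin n) :
    SimpleGraph (Fin N) where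
  -- Shared vertices are allowed, so that any two tuples inside a clique of `G` become adjacent.
  Adj i j := i ≠ j ∧ ∀ a c, y i a = y j c ∨ G.Adj (y i a) (y j c)
  symm := ⟨fun _ _ h => ⟨h.1.symm, fun a c => (h.2 c a).imp Eq.symm SimpleGraph.Adj.symm⟩⟩
  loopless := ⟨fun _ h => h.1 rfl⟩

/-- The tuples of vertices encoded by a sequence of numbers. -/
def tuplesOf (n : ℕ) [NeZero n] {N l R : ℕ} (r : Fin (N * l) → Fin R) (i : Fin N) (a : Fin l) :
    Fin n :=
  Fin.ofNat n (r (finProdFinEquiv (i, a)))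

namespace RAM

/-! ### Checking the output of the simulated program. -/

/-- `1` if `x = 1`, and `0` otherwise. -/
def isOne (x : Expr) : Expr := 1 - (x - 1 + (1 - x))

theorem eval_isOne (s : Store) (x : Expr) :
    (isOne x).eval s = if x.eval s = 1 then 1 else 0 := by
  simp only [isOne, Expr.eval_sub, Expr.eval_add, Expr.eval_ofNat]
  split_ifs <;> omega

/-- The output of the simulated program for the vertex in the variable `v`. -/
def outBit (v : ℕ) : Expr := isOne (.cell (aOut + aSim) (.var vOff + .var v))

/-- Count the vertices and the adjacent pairs of the output of the simulated program. -/
def countProg (c : ℕ) : Prog :=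
  .seq (.assign vCnt 0 0) (.seq (.assign vTot 0 0) (.seq (.assign vAcc 0 0)
    (.seq (.assign vIdx 0 0)
      (forLoop vI (.var vSize) (.seq (.assign vCnt 0 (.var vCnt + outBit vI))
        (forLoop vJ (.var vSize)
          -- For bits, x + y - 1 is the product xy, and x + y + z - 2 below is the product xyz;
          -- multiplication is not available.
          (.seq (.assign vTot 0 (.var vTot + (outBit vI + outBit vJ - 1)))
            (.seq (.assign vAcc 0 (.var vAcc +
                .smul c (outBit vI + outBit vJ + .cell aMat (.var vIdx) - 2)))
              (.assign vIdx 0 (.var vIdx + 1))))))))))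

/-- The arrays modified by `countProg`. -/
abbrev countVars : List ℕ := [vCnt, vTot, vAcc, vIdx, vI, vJ]

theorem eval_outBit {s s' : Store} (h : Frame countVars s s') (v : ℕ) :
    (outBit v).eval s' = if s (aOut + aSim) (s vOff 0 + s' v 0) = 1 then 1 else 0 := by
  simp [outBit, eval_isOne, h (aOut + aSim), h vOff]

theorem runs_countProg {s : Store} {c N : ℕ} (hN : s vSize 0 = N) {o : ℕ → ℕ}
    (ho : ∀ i, o i = if s (aOut + aSim) (s vOff 0 + i) = 1 then 1 else 0) :
    Runs (countProg c) s (N * (N * 8 + 8) + 11) fun s' => Frame countVars s s' ∧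
      s' vCnt 0 = ∑ i ∈ Finset.range N, o i ∧
      s' vTot 0 = ∑ i ∈ Finset.range N, ∑ j ∈ Finset.range N, (o i + o j - 1) ∧
      s' vAcc 0 = ∑ i ∈ Finset.range N, ∑ j ∈ Finset.range N,
        c * (o i + o j + s aMat (i * N + j) - 2) := by
  have hout : ∀ s' v, Frame countVars s s' → (outBit v).eval s' = o (s' v 0) := by
    intro s' v h
    rw [eval_outBit h, ho]
  refine (Runs.seq (c := 1) (d := 1 + (1 + (1 + (N * (N * 8 + 8) + 3) + 1) + 1) + 1)
    (Runs.assign rfl) fun s₁ h₁ => Runs.seq (Runs.assign rfl) fun s₂ h₂ =>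
    Runs.seq (Runs.assign rfl) fun s₃ h₃ => Runs.seq (Runs.assign rfl) fun s₄ h₄ =>
    ?_).mono (by omega) fun _ h => h
  subst h₁ h₂ h₃ h₄
  refine (Runs.forLoop (c := N * 8 + 5) (m := N)
    (fun i s' => Frame countVars s s' ∧ s' vI 0 = i ∧ s' vIdx 0 = i * N ∧
      s' vCnt 0 = ∑ i ∈ Finset.range i, o i ∧
      s' vTot 0 = ∑ i ∈ Finset.range i, ∑ j ∈ Finset.range N, (o i + o j - 1) ∧
      s' vAcc 0 = ∑ i ∈ Finset.range i, ∑ j ∈ Finset.range N,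
        c * (o i + o j + s aMat (i * N + j) - 2)) ?_ ?_ ?_ ?_).mono le_rfl ?_
  · intro i s' h
    exact h.2.1
  · intro i s' h
    simp [h.1 vSize, hN]
  · rintro i hi s' ⟨h1, h2, h3, h4, h5, h6⟩
    refine (Runs.seq (c := 1) (d := N * (5 + 3) + 3) (Runs.assign rfl)
      fun s₁ e₁ => ?_).mono (by omega) fun _ h => h
    subst e₁
    refine (Runs.forLoop (c := 5) (m := N)
      (fun j s'' => Frame countVars s s'' ∧ s'' vI 0 = i ∧ s'' vJ 0 = j ∧ s'' vIdx 0 = i * N + j ∧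
        s'' vCnt 0 = ∑ i ∈ Finset.range (i + 1), o i ∧
        s'' vTot 0 = ∑ i ∈ Finset.range i, ∑ j ∈ Finset.range N, (o i + o j - 1) +
          ∑ j ∈ Finset.range j, (o i + o j - 1) ∧
        s'' vAcc 0 = ∑ i ∈ Finset.range i, ∑ j ∈ Finset.range N,
          c * (o i + o j + s aMat (i * N + j) - 2) +
          ∑ j ∈ Finset.range j, c * (o i + o j + s aMat (i * N + j) - 2)) ?_ ?_ ?_ ?_).mono le_rfl ?_
    · intro j s'' h
      exact h.2.2.1
    · intro j s'' h
      simp [h.1 vSize, hN]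
    · rintro j hj s'' ⟨g1, g2, g3, g4, g5, g6, g7⟩
      refine Runs.seq (c := 1) (d := 3) (Runs.assign rfl) fun s₁ e₁ => ?_
      have f₁ : Frame countVars s s₁ := by
        subst e₁
        exact g1.set _ _ (by simp)
      refine Runs.seq (c := 1) (d := 1) (Runs.assign rfl) fun s₂ e₂ => ?_
      subst e₂
      refine Runs.assign ⟨?_, ?_, ?_, ?_, ?_, ?_, ?_⟩
      · exact ((f₁.set _ _ (by simp)).set _ _ (by simp)).set _ _ (by simp)
      · subst e₁; simp [Store.set_apply, g2]
      · subst e₁; simp [Store.set_apply, g3]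
      · subst e₁; simp [Store.set_apply, g4, add_assoc]
      · subst e₁; simp [Store.set_apply, g5]
      · subst e₁
        rw [Finset.sum_range_succ, ← add_assoc, ← g6]
        simp [Store.set_apply, hout _ _ g1, g2, g3]
      · have : s₁ vAcc 0 = s'' vAcc 0 := by subst e₁; simp [Store.set_apply]
        have hI : s₁ vI 0 = i := by subst e₁; simp [Store.set_apply, g2]
        have hJ : s₁ vJ 0 = j := by subst e₁; simp [Store.set_apply, g3]
        have hX : s₁ vIdx 0 = i * N + j := by subst e₁; simp [Store.set_apply, g4]
        rw [Finset.sum_range_succ, ← add_assoc, ← g7]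
        simp [Store.set_apply, hout _ _ f₁, hI, hJ, this, f₁ aMat, hX]
    · refine ⟨?_, ?_, ?_, ?_, ?_, ?_, ?_⟩
      · exact (h1.set _ _ (by simp)).set _ _ (by simp)
      · simp [Store.set_apply, h2]
      · simp [Store.set_apply]
      · simp [Store.set_apply, h3]
      · rw [Finset.sum_range_succ, ← h4]
        simp [Store.set_apply, hout _ _ h1, h2]
      · simp [Store.set_apply, h5]
      · simp [Store.set_apply, h6]
    · rintro s'' ⟨g1, g2, g3, g4, g5, g6, g7⟩
      refine ⟨g1.set _ _ (by simp), ?_, ?_, ?_, ?_, ?_⟩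
      · simp [Store.set_apply, g2]
      · simp [Store.set_apply, g4, add_mul]
      · simp [Store.set_apply, g5]
      · rw [Finset.sum_range_succ, ← g6]
        simp [Store.set_apply]
      · rw [Finset.sum_range_succ, ← g7]
        simp [Store.set_apply]
  · refine ⟨?_, ?_, ?_, ?_, ?_, ?_⟩
    · exact (((((Frame.refl _ _).set _ _ (by simp)).set _ _ (by simp)).set _ _ (by simp)).set _ _
        (by simp)).set _ _ (by simp)
    all_goals simp [Store.set_apply]
  · rintro s' ⟨h1, h2, h3, h4, h5, h6⟩
    exact ⟨h1, h4, h5, h6⟩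

/-- Evaluate a trial: accept, repeat the trial, reject, or go to the next stage. -/
def updateProg (k μ₀ : ℕ) : Prog :=
  -- This sum is positive iff the output has the wrong size or is not dense enough.
  .branch 0 (.var vCnt - .smul k (.var vH) + (.smul k (.var vH) - .var vCnt) +
      (.var vTot - .var vAcc))
    -- A positive clock means that the run was completed, so the failure counts towards rejection.
    -- An expired clock carries no information and leads to the next width or stage.
    (.branch 0 (.var vClk)
      (.seq (.assign vRep 0 (.var vRep + 1))
        (.branch (.var vRep) (.var vBits) .skip (.assign vDone 0 1)))
      (.seq (.assign vRep 0 0)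
        (.branch (.var vMu) (.var vStage) (.assign vMu 0 (.var vMu + 1))
          (.seq (.assign vStage 0 (.var vStage + 1)) (.assign vMu 0 (.const μ₀))))))
    (.seq (.assign vDone 0 1) (.assign aOut 0 1))

theorem runs_updateProg_accept {s : Store} {k μ₀ : ℕ} (h1 : s vCnt 0 = k * s vH 0)
    (h2 : s vTot 0 ≤ s vAcc 0) :
    Runs (updateProg k μ₀) s 6 fun s' => s' = (s.set vDone 0 1).set aOut 0 1 := by
  refine Runs.branch (c := 5) (fun h => ?_) fun _ => ?_
  · simp at h
    omega
  · exact (Runs.seq (c := 1) (d := 1) (Runs.assign rfl) fun s' e => by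
      subst e; exact Runs.assign rfl).mono (by omega) fun _ h => h

theorem runs_updateProg_repeat {s : Store} {k μ₀ : ℕ}
    (h : ¬ (s vCnt 0 = k * s vH 0 ∧ s vTot 0 ≤ s vAcc 0)) (hc : 0 < s vClk 0) :
    Runs (updateProg k μ₀) s 6 fun s' => s' = if s vRep 0 + 1 < s vBits 0 then
      s.set vRep 0 (s vRep 0 + 1) else (s.set vRep 0 (s vRep 0 + 1)).set vDone 0 1 := by
  refine Runs.branch (c := 5) (fun _ => ?_) fun h' => ?_
  · refine Runs.branch (c := 4) (fun _ => ?_) fun h => absurd hc h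
    refine Runs.seq (c := 1) (d := 2) (Runs.assign rfl) fun s' e => ?_
    subst e
    refine Runs.branch (fun h => Runs.skip ?_) fun h => Runs.assign ?_
    · simp [Store.set_apply] at h
      simp [h]
    · simp [Store.set_apply] at h
      simp [h]
  · simp at h'
    omega

theorem runs_updateProg_next {s : Store} {k μ₀ : ℕ}
    (h : ¬ (s vCnt 0 = k * s vH 0 ∧ s vTot 0 ≤ s vAcc 0)) (hc : s vClk 0 = 0) :
    Runs (updateProg k μ₀) s 8 fun s' => s' = if s vMu 0 < s vStage 0 then
      (s.set vRep 0 0).set vMu 0 (s vMu 0 + 1) else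
      ((s.set vRep 0 0).set vStage 0 (s vStage 0 + 1)).set vMu 0 μ₀ := by
  refine Runs.branch (c := 7) (fun _ => ?_) fun h' => ?_
  · refine Runs.branch (c := 6) (fun h => ?_) fun _ => ?_
    · simp [hc] at h
    refine Runs.seq (c := 1) (d := 4) (Runs.assign rfl) fun s' e => ?_
    subst e
    refine Runs.branch (c := 3) (fun h => ?_) fun h => ?_
    · refine (Runs.assign ?_).mono (by omega : 1 ≤ 3) fun _ h => h
      simp [Store.set_apply] at h
      simp [h, Store.set_apply]
    · refine Runs.seq (c := 1) (d := 1) (Runs.assign rfl) fun s' e => ?_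
      subst e
      refine Runs.assign ?_
      simp [Store.set_apply] at h
      simp [Nat.not_lt.2 h, Store.set_apply]
  · simp at h'
    omega

/-! ### Preparing a trial. -/

/-- The parameters of the distinguisher: for `b = ⌈log₂ n⌉` and the width `μ`, the product graph has
`n ^ (expo * μ)` vertices, which are tuples of length `len * μ`, and the size of the subgraphs is
`mult * ⌈lam * b / μ⌉`. The subgraph counts as dense if it has at least a fraction `1 / dens` of all
ordered pairs. The width is at least `mu0`. -/
structure Params : Type where
  expo : ℕ
  len : ℕ
  lam : ℕ
  mult : ℕ
  dens : ℕ
  mu0 : ℕ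

/-- The number of vertices of the product graph. -/
def Params.size (P : Params) (n μ : ℕ) : ℕ := n ^ (P.expo * μ)

/-- The size of the subgraphs. -/
def Params.sub (P : Params) (n μ : ℕ) : ℕ := P.mult * (P.lam * Nat.clog 2 n ⌈/⌉ μ)

/-- Compute the sizes for a trial. -/
def sizesProg (P : Params) : Prog :=
  .seq (powProg vSize (.smul P.expo (.var vMu))) (.seq (powProg vBudget (.var vStage))
    (.seq (divProg P.lam) (lenProg P.len)))

/-- Build the product graph and the input of the simulated program. -/
def instanceProg (P : Params) : Prog :=
  -- Starting at the bound on the addresses used so far provides zeroed memory without erasing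
  -- anything.
  .seq (.assign vOff 0 (.var vHi)) (.seq (buildProg P.len)
    (.seq (.assign aSim (.var vOff) (.var vSize))
      (.seq (.assign aSim (.var vOff + 1) (.smul P.mult (.var vH)))
        -- After the matrix is built, `vIdx` is its number of entries; 2 more covers the cells of
        -- the two input numbers. The clock exceeds the budget by one because reaching 0 already
        -- counts as a timeout.
        (.seq (.assign vHi 0 (.var vOff + .var vIdx + 2)) (.assign vClk 0 (.var vBudget + 1))))))

open Classical in
/-- The memory holds the preprocessed graph `G`, and the main loop is at stage `j`, width `μ` and
repetition `rep`. -/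
structure Ready {n : ℕ} (G : SimpleGraph (Fin n)) (s : Store) (j μ rep : ℕ) : Prop where
  size : s 0 0 = n
  row : ∀ u < n, s aRow u = u * n
  adj : ∀ u v : Fin n, s aAdj (u * n + v) = if u = v ∨ G.Adj u v then 1 else 0
  bits : s vBits 0 = Nat.clog 2 n
  stage : s vStage 0 = j
  mu : s vMu 0 = μ
  rep : s vRep 0 = rep
  done : s vDone 0 = 0
  out : s aOut 0 = 0

theorem Ready.congr {n : ℕ} {G : SimpleGraph (Fin n)} {s s' : Store} {j μ rep : ℕ}
    (h : Ready G s j μ rep)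
    (hs : ∀ a ∈ [0, aRow, aAdj, vBits, vStage, vMu, vRep, vDone, aOut], s' a = s a) :
    Ready G s' j μ rep := by
  constructor
  · rw [hs 0 (by simp), h.size]
  · rw [hs aRow (by simp)]; exact h.row
  · rw [hs aAdj (by simp)]; exact h.adj
  · rw [hs vBits (by simp), h.bits]
  · rw [hs vStage (by simp), h.stage]
  · rw [hs vMu (by simp), h.mu]
  · rw [hs vRep (by simp), h.rep]
  · rw [hs vDone (by simp), h.done]
  · rw [hs aOut (by simp), h.out]

theorem Ready.frame {n : ℕ} {G : SimpleGraph (Fin n)} {s s' : Store} {j μ rep : ℕ}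
    (h : Ready G s j μ rep) {L : List ℕ} (hs : Frame L s s')
    (hL : ∀ a ∈ [0, aRow, aAdj, vBits, vStage, vMu, vRep, vDone, aOut], a ∉ L) :
    Ready G s' j μ rep :=
  h.congr fun a ha => hs a (hL a ha)

theorem Fresh.frame {s s' : Store} (h : Fresh s) {L : List ℕ} (hs : Frame L s s')
    (hL : ∀ a ∈ L, a < aSim ∧ a ≠ vOff ∧ a ≠ vHi) : Fresh s' := by
  have h1 : vOff ∉ L := fun h => (hL _ h).2.1 rfl
  have h2 : vHi ∉ L := fun h => (hL _ h).2.2 rfl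
  refine ⟨by rw [hs _ h1, hs _ h2]; exact h.1, fun a i hi => ?_⟩
  rw [hs _ h2] at hi
  rw [hs _ fun h => by have := (hL _ h).1; omega]
  exact h.2 a i hi

theorem runs_sizesProg {P : Params} {n : ℕ} {G : SimpleGraph (Fin n)} {s : Store} {j μ rep : ℕ}
    (h : Ready G s j μ rep) (hμ : 0 < μ) :
    Runs (sizesProg P) s ((P.expo * μ + j) * (n * 4 + 10) + P.lam * Nat.clog 2 n * 4 +
        P.size n μ * 4 + 23)
      fun s' => Frame [vSize, vBudget, vH, vLen, vI, vX, vE, vF] s s' ∧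
        s' vSize 0 = P.size n μ ∧ s' vBudget 0 = n ^ j ∧ s' vH 0 = P.lam * Nat.clog 2 n ⌈/⌉ μ ∧
        s' vLen 0 = P.size n μ * (P.len * μ) := by
  refine (Runs.seq (d := (j * (n * 4 + 10) + 5) +
    ((P.lam * Nat.clog 2 n * 4 + 5) + (P.size n μ * 4 + 5) + 1) + 1)
    (runs_powProg (n := n) (m := P.expo * μ) h.size (by omega) (by omega) ?_) ?_).mono ?_
    fun _ h => h
  · intro s' h'
    simp [h' vMu, h.mu]
  · rintro s₁ ⟨f₁, g₁⟩
    have h₁ := h.frame f₁ (by simp)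
    refine Runs.seq (runs_powProg (n := n) (m := j) h₁.size (by omega) (by omega) ?_) ?_
    · intro s' h'
      simp [h' vStage, h₁.stage]
    rintro s₂ ⟨f₂, g₂⟩
    have h₂ := h₁.frame f₂ (by simp)
    refine Runs.seq (runs_divProg h₂.bits h₂.mu hμ) ?_
    rintro s₃ ⟨f₃, g₃⟩
    have h₃ := h₂.frame f₃ (by simp)
    have e₃ : s₃ vSize 0 = P.size n μ := by rw [f₃ vSize (by simp), f₂ vSize (by simp), g₁]; rfl
    refine (runs_lenProg (c := P.len) e₃ h₃.mu).mono le_rfl ?_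
    rintro s₄ ⟨f₄, g₄⟩
    refine ⟨?_, ?_, ?_, ?_, g₄⟩
    · exact (((f₁.mono (by simp)).trans f₂ (by simp)).trans f₃ (by simp)).trans f₄ (by simp)
    · rw [f₄ vSize (by simp), e₃]
    · rw [f₄ vBudget (by simp), f₃ vBudget (by simp), g₂]
    · rw [f₄ vH (by simp), g₃]
  · rw [add_mul]
    omega

open Classical in
/-- The product graph encoded by the sequence `r` has been computed. -/
structure Prepared {n : ℕ} [NeZero n] (G : SimpleGraph (Fin n)) (s : Store) (j μ rep h : ℕ)
    {N l R : ℕ} (r : Fin (N * l) → Fin R) : Prop where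
  ready : Ready G s j μ rep
  size : s vSize 0 = N
  height : s vH 0 = h
  mat : ∀ u v : Fin N, s aMat (u * N + v) =
    if (tupleGraph G (tuplesOf n r)).Adj u v then 1 else 0

theorem Prepared.congr {n : ℕ} [NeZero n] {G : SimpleGraph (Fin n)} {s s' : Store}
    {j μ rep h N l R : ℕ} {r : Fin (N * l) → Fin R} (H : Prepared G s j μ rep h r)
    (hs : ∀ a ∈ [0, aRow, aAdj, vBits, vStage, vMu, vRep, vDone, aOut, vSize, vH, aMat],
      s' a = s a) : Prepared G s' j μ rep h r := by
  refine ⟨H.ready.congr fun a ha => hs a ?_, ?_, ?_, ?_⟩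
  · simp only [List.mem_cons, List.not_mem_nil, or_false] at ha ⊢
    tauto
  · rw [hs vSize (by simp), H.size]
  · rw [hs vH (by simp), H.height]
  · rw [hs aMat (by simp)]
    exact H.mat

theorem vertexOf_eq_mod {n r : ℕ} (hr : r < 2 * n) : vertexOf n r = r % n := by
  rw [vertexOf]
  split_ifs with h
  · rw [Nat.mod_eq_of_lt h]
  · rw [Nat.mod_eq_sub_mod (by omega), Nat.mod_eq_of_lt (by omega)]

-- The loops that `rowProg` adds to the adjacency matrix make equal vertices count as adjacent, as
-- in `tupleGraph`. Since `R ≤ 2 * n`, the single subtraction in `vertexOf` is reduction modulo `n`.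
open Classical in
theorem entry_eq {n : ℕ} [NeZero n] {G : SimpleGraph (Fin n)} {s : Store} {j μ rep N l R : ℕ}
    (h : Ready G s j μ rep) (hR : R ≤ 2 * n) {r : Fin (N * l) → Fin R}
    (hr : ∀ i : Fin _, s aTup i = vertexOf n (r i)) (u v : Fin N) :
    entry s l u v = if (tupleGraph G (tuplesOf n r)).Adj u v then 1 else 0 := by
  have htup : ∀ (u : Fin N) (a : Fin l), s aTup (u * l + a) = (tuplesOf n r u a : Fin n) := by
    intro u a
    have := hr (finProdFinEquiv (u, a))
    rw [vertexOf_eq_mod (by omega)] at this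
    rw [finProdFinEquiv_apply_val, show (a + l * u : ℕ) = u * l + a by ring] at this
    exact this
  have hadj : ∀ u' v' : Fin n, s aAdj (u' * n + v') ≠ 0 ↔ u' = v' ∨ G.Adj u' v' := by
    intro u' v'
    rw [h.adj]
    split_ifs <;> simp_all
  have hcross : CrossAdj s l (u * l) (v * l) ↔ ∀ a c, tuplesOf n r u a = tuplesOf n r v c ∨
      G.Adj (tuplesOf n r u a) (tuplesOf n r v c) := by
    constructor
    · intro H a c
      have := H a a.2 c c.2
      rwa [htup, htup, h.row _ (Fin.is_lt _), hadj] at this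
    · intro H a ha c hc
      have := H ⟨a, ha⟩ ⟨c, hc⟩
      rwa [← hadj, ← htup u ⟨a, ha⟩, ← htup v ⟨c, hc⟩, ← h.row] at this
      rw [htup u ⟨a, ha⟩]
      exact Fin.is_lt _
  have hne : (u : ℕ) ≠ v ↔ u ≠ v := by simp [Fin.ext_iff]
  exact if_congr (by rw [hcross, hne]; rfl) rfl rfl

theorem runs_instanceProg {P : Params} {n : ℕ} [NeZero n] {G : SimpleGraph (Fin n)} {s : Store}
    {j μ rep R N l h : ℕ} {r : Fin (N * l) → Fin R} (hready : Ready G s j μ rep)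
    (hs : Fresh s) (hR : R ≤ 2 * n) (hr : ∀ i : Fin _, s aTup i = vertexOf n (r i))
    (hl : P.len * μ = l) (hN : s vSize 0 = N) (hB : s vBudget 0 = n ^ j) (hH : s vH 0 = h) :
    Runs (instanceProg P) s (N * (N * (l * (l * 4 + 6) + 16) + 10) + 17)
      fun s' => Prepared G s' j μ rep h r ∧ Fresh s' ∧ s' vClk 0 = n ^ j + 1 ∧
        Simulates s' (input (tupleGraph G (tuplesOf n r)) (P.mult * h)) := by
  classical
  refine (Runs.seq (c := 1) (d := (N * (N * (l * (l * 4 + 6) + 16) + 10) + 7) + 7 + 1)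
    (Runs.assign rfl) fun s₁ e₁ => ?_).mono (by omega) fun _ h => h
  have f₁ : Frame [vOff] s s₁ := by
    subst e₁
    exact (Frame.refl _ _).set _ _ (by simp)
  have h₁ := hready.frame f₁ (by simp)
  have o₁ : s₁ vOff 0 = s vHi 0 := by
    subst e₁
    simp [Store.set_apply]
  have hN₁ : s₁ vSize 0 = N := by rw [f₁ vSize (by simp), hN]
  have hbuild := runs_buildProg (c := P.len) h₁.mu hN₁ fun k => by
    rw [o₁, f₁ _ (by simp), hs.2 _ _ (by omega)]
  rw [hl] at hbuild
  refine Runs.seq (c := N * (N * (l * (l * 4 + 6) + 16) + 10) + 7) (d := 7) hbuild ?_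
  rintro s₂ ⟨f₂, hidx, hmat, hsim⟩
  have h₂ := h₁.frame f₂ (by simp)
  have hent : ∀ u v : Fin N, entry s₁ l u v =
      if (tupleGraph G (tuplesOf n r)).Adj u v then 1 else 0 := by
    refine entry_eq h₁ hR fun i => ?_
    rw [f₁ aTup (by simp), hr]
  have o₂ : s₂ vOff 0 = s vHi 0 := by rw [f₂ vOff (by simp), o₁]
  have hN₂ : s₂ vSize 0 = N := by rw [f₂ vSize (by simp), f₁ vSize (by simp), hN]
  have hB₂ : s₂ vBudget 0 = n ^ j := by rw [f₂ vBudget (by simp), f₁ vBudget (by simp), hB]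
  have hH₂ : s₂ vH 0 = h := by
    rw [f₂ vH (by simp), f₁ vH (by simp), hH]
  have hz : ∀ a, a ≠ 1 → ∀ i, s vHi 0 ≤ i → s₂ (a + aSim) i = 0 := by
    intro a ha i hi
    rw [f₂ _ (by simp; omega), f₁ _ (by simp), hs.2 a i hi]
  refine Runs.seq (c := 1) (d := 5) (Runs.assign rfl) fun s₃ e₃ => ?_
  refine Runs.seq (c := 1) (d := 3) (Runs.assign rfl) fun s₄ e₄ => ?_
  refine Runs.seq (c := 1) (d := 1) (Runs.assign rfl) fun s₅ e₅ => ?_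
  have f₅ : Frame [aSim, vHi] s₂ s₅ := by
    subst e₅ e₄ e₃
    exact (((Frame.refl _ _).set _ _ (by simp)).set _ _ (by simp)).set _ _ (by simp)
  have hhi : s₅ vHi 0 = s vHi 0 + N * N + 2 := by
    subst e₅ e₄ e₃
    simp [Store.set_apply, o₂, hidx]
  have hsim0 : ∀ i, s₅ aSim (s vHi 0 + i) =
      if i = 0 then N else if i = 1 then P.mult * h else 0 := by
    intro i
    subst e₅ e₄ e₃
    have := hz 0 (by simp) (s vHi 0 + i) (by omega)
    simp only [zero_add] at this
    simp [Store.set_apply, o₂, hN₂, hH₂, this]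
    split_ifs <;> omega
  refine Runs.assign ?_
  have hs5B : s₅ vBudget 0 = n ^ j := by rw [f₅ vBudget (by simp), hB₂]
  set s₆ := s₅.set vClk ((0 : Expr).eval s₅) ((Expr.var vBudget + 1).eval s₅) with hs₆
  have f₆ : Frame [aSim, vHi, vClk] s₂ s₆ := (f₅.mono (by simp)).set _ _ (by simp)
  have g₆ : Frame [vClk] s₅ s₆ := (Frame.refl _ _).set _ _ (by simp)
  refine ⟨⟨h₂.frame f₆ (by simp), ?_, ?_, ?_⟩, ⟨?_, ?_⟩, ?_, ?_⟩
  · rw [f₆ vSize (by simp), hN₂]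
  · rw [f₆ vH (by simp), hH₂]
  · intro u v
    have hdiv : (u * N + v : ℕ) / N = u := by
      rw [mul_comm, Nat.mul_add_div v.pos, Nat.div_eq_of_lt v.2, add_zero]
    have hmod : (u * N + v : ℕ) % N = v := by
      rw [mul_comm, Nat.mul_add_mod, Nat.mod_eq_of_lt v.2]
    rw [f₆ aMat (by simp), hmat, hdiv, hmod, hent]
    nlinarith [u.2, v.2]
  · rw [f₆ vOff (by simp), g₆ vHi (by simp), hhi, o₂]
    omega
  · intro a i hi
    rw [g₆ vHi (by simp), hhi] at hi
    obtain ⟨k, rfl⟩ := Nat.exists_eq_add_of_le (show s vHi 0 ≤ i by omega)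
    rw [g₆ _ (by simp)]
    by_cases ha0 : a = 0
    · subst ha0
      have := hsim0 k
      rw [if_neg (by omega), if_neg (by omega)] at this
      simpa using this
    by_cases ha1 : a = 1
    · subst ha1
      have := hsim k
      rw [if_neg (by omega), o₁] at this
      rw [f₅ _ (by simp), this]
    · rw [f₅ _ (by simp; omega), hz a ha1 _ (by omega)]
  · rw [hs₆]
    simp [Store.set_apply, hs5B]
  · intro a i
    rw [f₆ vOff (by simp), o₂, g₆ _ (by simp)]
    by_cases ha0 : a = 0
    · subst ha0
      have := hsim0 i
      simp only [zero_add]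
      rw [this]
      simp [input]
    by_cases ha1 : a = 1
    · subst ha1
      have := hsim i
      rw [o₁] at this
      rw [f₅ _ (by simp), this]
      simp only [input, one_ne_zero, false_and, if_false, true_and]
      split_ifs with h1 h2 h2
      · obtain ⟨u, v, rfl, huv⟩ := h2
        have hdiv : (u * N + v : ℕ) / N = u := by
          rw [mul_comm, Nat.mul_add_div v.pos, Nat.div_eq_of_lt v.2, add_zero]
        have hmod : (u * N + v : ℕ) % N = v := by
          rw [mul_comm, Nat.mul_add_mod, Nat.mod_eq_of_lt v.2]
        rw [hdiv, hmod, hent, if_pos huv]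
      · have hN0 : 0 < N := by
          rcases Nat.eq_zero_or_pos N with h | h
          · rw [h] at h1; omega
          · exact h
        have hi1 : i / N < N := Nat.div_lt_of_lt_mul h1
        have hi2 : i % N < N := Nat.mod_lt _ hN0
        have := hent ⟨i / N, hi1⟩ ⟨i % N, hi2⟩
        dsimp only at this
        rw [this, if_neg]
        intro hadj
        exact h2 ⟨⟨i / N, hi1⟩, ⟨i % N, hi2⟩, (Nat.div_add_mod' i N).symm, hadj⟩
      · obtain ⟨u, v, rfl, huv⟩ := h2
        exact absurd (by nlinarith [u.2, v.2]) h1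
      · rfl
    · rw [f₅ _ (by simp; omega), hz a ha1 _ (by omega)]
      simp [input, ha0, ha1]

end RAM

/-! ### Dense sets and the verdict of a trial. -/

open Classical in
/-- The number of ordered pairs of adjacent vertices in `S`. -/
def adjPairs {N : ℕ} (H : SimpleGraph (Fin N)) (S : Finset (Fin N)) : ℕ :=
  ((S ×ˢ S).filter fun p => H.Adj p.1 p.2).card

/-- `S` has `k` vertices and spans at least a fraction `1 / c` of all ordered pairs. -/
def IsDenseSet {N : ℕ} (H : SimpleGraph (Fin N)) (c k : ℕ) (S : Finset (Fin N)) : Prop :=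
  S.card = k ∧ k * k ≤ c * adjPairs H S

namespace RAM

/-- The set of vertices output by the simulated program. -/
def simOut (s : Store) (N : ℕ) : Finset (Fin N) :=
  Finset.univ.filter fun v => s (aOut + aSim) (s vOff 0 + v) = 1

theorem Simulates.simOut_eq {s m : Store} (h : Simulates s m) (N : ℕ) :
    simOut s N = outputSet N m := by
  ext v
  simp only [simOut, outputSet, Finset.mem_filter, Finset.mem_univ, true_and]
  rw [h]

theorem _root_.Finset.sum_ite_mem_one {α : Type*} [Fintype α] [DecidableEq α] (S : Finset α) :
    ∑ a, (if a ∈ S then 1 else 0) = S.card := by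
  simp

theorem sum_range_ite_mem {N : ℕ} {S : Finset (Fin N)} {o : ℕ → ℕ}
    (ho : ∀ v : Fin N, o v = if v ∈ S then 1 else 0) : ∑ i ∈ Finset.range N, o i = S.card := by
  rw [Finset.sum_range]
  simp [ho]

theorem sum_range_pairs {N : ℕ} {S : Finset (Fin N)} {o : ℕ → ℕ}
    (ho : ∀ v : Fin N, o v = if v ∈ S then 1 else 0) :
    ∑ i ∈ Finset.range N, ∑ j ∈ Finset.range N, (o i + o j - 1) = S.card * S.card := by
  rw [← Finset.card_product, ← Finset.sum_ite_mem_one, Fintype.sum_prod_type, Finset.sum_range]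
  simp only [Finset.sum_range]
  refine Finset.sum_congr rfl fun i _ => Finset.sum_congr rfl fun j _ => ?_
  rw [ho, ho]
  simp only [Finset.mem_product]
  split_ifs <;> simp_all

open Classical in
theorem sum_range_adjPairs {N c : ℕ} {S : Finset (Fin N)} {o e : ℕ → ℕ} {H : SimpleGraph (Fin N)}
    (ho : ∀ v : Fin N, o v = if v ∈ S then 1 else 0)
    (he : ∀ u v : Fin N, e (u * N + v) = if H.Adj u v then 1 else 0) :
    ∑ i ∈ Finset.range N, ∑ j ∈ Finset.range N, c * (o i + o j + e (i * N + j) - 2) =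
      c * adjPairs H S := by
  simp only [← Finset.mul_sum]
  rw [adjPairs, ← Finset.sum_ite_mem_one, Fintype.sum_prod_type, Finset.sum_range]
  simp only [Finset.sum_range]
  congr 1
  refine Finset.sum_congr rfl fun i _ => Finset.sum_congr rfl fun j _ => ?_
  rw [ho, ho, he]
  simp only [Finset.mem_product, Finset.mem_filter]
  split_ifs <;> simp_all

/-- The evaluation of a trial. -/
def evalProg (P : Params) : Prog := .seq (countProg P.dens) (updateProg P.mult P.mu0)

theorem runs_countProg_of_prepared {P : Params} {n : ℕ} [NeZero n] {G : SimpleGraph (Fin n)}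
    {s : Store} {j μ rep h N l R : ℕ} {r : Fin (N * l) → Fin R} (H : Prepared G s j μ rep h r) :
    Runs (countProg P.dens) s (N * (N * 8 + 8) + 11) fun s' => Frame countVars s s' ∧
      (IsDenseSet (tupleGraph G (tuplesOf n r)) P.dens (P.mult * h) (simOut s N) ↔
        s' vCnt 0 = P.mult * s' vH 0 ∧ s' vTot 0 ≤ s' vAcc 0) := by
  classical
  refine (runs_countProg (c := P.dens) H.size (o := fun i =>
    if s (aOut + aSim) (s vOff 0 + i) = 1 then 1 else 0) fun i => rfl).mono le_rfl ?_
  rintro s' ⟨h1, h2, h3, h4⟩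
  refine ⟨h1, ?_⟩
  have ho : ∀ v : Fin N, (fun i => if s (aOut + aSim) (s vOff 0 + i) = 1 then 1 else 0) (v : ℕ) =
      if v ∈ simOut s N then 1 else 0 := by
    intro v
    simp [simOut]
  rw [sum_range_ite_mem ho] at h2
  rw [sum_range_pairs ho] at h3
  rw [sum_range_adjPairs ho H.mat] at h4
  rw [IsDenseSet, h2, h3, h4, h1 vH (by simp), H.height]
  exact and_congr_right fun hc => by rw [hc]

/-- What a trial does after the simulated program. -/
theorem runs_evalProg {P : Params} {n : ℕ} [NeZero n] {G : SimpleGraph (Fin n)}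
    {s : Store} {j μ rep h N l R : ℕ} {r : Fin (N * l) → Fin R} (H : Prepared G s j μ rep h r)
    (hs : Fresh s) :
    Runs (evalProg P) s (N * (N * 8 + 8) + 20) fun s' =>
      (IsDenseSet (tupleGraph G (tuplesOf n r)) P.dens (P.mult * h) (simOut s N) ∧
        s' vDone 0 = 1 ∧ s' aOut 0 = 1) ∨
      (¬ IsDenseSet (tupleGraph G (tuplesOf n r)) P.dens (P.mult * h) (simOut s N) ∧
        ((0 < s vClk 0 ∧ rep + 1 < Nat.clog 2 n ∧ Ready G s' j μ (rep + 1) ∧ Fresh s') ∨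
          (0 < s vClk 0 ∧ ¬ rep + 1 < Nat.clog 2 n ∧ s' vDone 0 = 1 ∧ s' aOut 0 = 0) ∨
          (s vClk 0 = 0 ∧ μ < j ∧ Ready G s' j (μ + 1) 0 ∧ Fresh s') ∨
          (s vClk 0 = 0 ∧ ¬ μ < j ∧ Ready G s' (j + 1) P.mu0 0 ∧ Fresh s'))) := by
  refine (Runs.seq (d := 8) (runs_countProg_of_prepared (P := P) H) ?_).mono (by omega) fun _ h => h
  rintro s₁ ⟨f₁, hd⟩
  have hR := H.ready.frame f₁ (by simp)
  have hF := hs.frame f₁ (by simp)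
  have hclk : s₁ vClk 0 = s vClk 0 := by rw [f₁ vClk (by simp)]
  by_cases hdense : IsDenseSet (tupleGraph G (tuplesOf n r)) P.dens (P.mult * h) (simOut s N)
  · obtain ⟨g1, g2⟩ := hd.1 hdense
    refine (runs_updateProg_accept g1 g2).mono (by omega) fun s' e => Or.inl ⟨hdense, ?_⟩
    subst e
    simp [Store.set_apply]
  · have hnd := mt hd.2 hdense
    rcases Nat.eq_zero_or_pos (s₁ vClk 0) with hc | hc
    · refine (runs_updateProg_next hnd hc).mono le_rfl fun s' e => Or.inr ⟨hdense, ?_⟩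
      right; right
      rw [hR.mu, hR.stage] at e
      rw [hclk] at hc
      split_ifs at e with hlt
      · have f' : Frame [vRep, vMu] s₁ s' := by
          subst e
          exact ((Frame.refl _ _).set _ _ (by simp)).set _ _ (by simp)
        refine Or.inl ⟨hc, hlt, ?_, hF.frame f' (by simp)⟩
        subst e
        constructor <;> simp [Store.set_apply, hR.size, hR.bits, hR.stage, hR.done, hR.out]
        · exact fun u hu => hR.row u hu
        · exact fun u v => hR.adj u v
      · have f' : Frame [vRep, vMu, vStage] s₁ s' := by
          subst e
          exact (((Frame.refl _ _).set _ _ (by simp)).set _ _ (by simp)).set _ _ (by simp)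
        refine Or.inr ⟨hc, hlt, ?_, hF.frame f' (by simp)⟩
        subst e
        constructor <;> simp [Store.set_apply, hR.size, hR.bits, hR.done, hR.out]
        · exact fun u hu => hR.row u hu
        · exact fun u v => hR.adj u v
    · refine (runs_updateProg_repeat hnd hc).mono (by omega) fun s' e => Or.inr ⟨hdense, ?_⟩
      rw [hR.rep, hR.bits] at e
      rw [hclk] at hc
      split_ifs at e with hlt
      · have f' : Frame [vRep] s₁ s' := by
          subst e
          exact (Frame.refl _ _).set _ _ (by simp)
        refine Or.inl ⟨hc, hlt, ?_, hF.frame f' (by simp)⟩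
        subst e
        constructor <;> simp [Store.set_apply, hR.size, hR.bits, hR.stage, hR.done, hR.out, hR.mu]
        · exact fun u hu => hR.row u hu
        · exact fun u v => hR.adj u v
      · refine Or.inr (Or.inl ⟨hc, hlt, ?_⟩)
        subst e
        simp [Store.set_apply, hR.out]

end RAM

theorem adjPairs_eq {N : ℕ} (H : SimpleGraph (Fin N)) (S : Finset (Fin N)) :
    adjPairs H S = 2 * inducedEdges H S := by
  classical
  have h1 := (H.induce (S : Set (Fin N))).sum_degrees_eq_twice_card_edges
  rw [inducedEdges, Set.ncard_eq_toFinset_card', ← SimpleGraph.edgeFinset, ← h1, adjPairs,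
    Finset.card_filter, Finset.sum_product, ← Finset.sum_coe_sort S]
  refine Finset.sum_congr rfl fun v _ => ?_
  rw [← Finset.card_filter, ← SimpleGraph.card_neighborFinset_eq_degree]
  refine (Finset.card_bij (s := (H.induce (S : Set (Fin N))).neighborFinset v)
    (fun w _ => (w : Fin N)) ?_ ?_ ?_).symm
  · intro w hw
    simpa using hw
  · intro w _ w' _ h
    exact Subtype.ext h
  · intro w hw
    rw [Finset.mem_filter] at hw
    exact ⟨⟨w, hw.1⟩, by simpa using hw.2, rfl⟩

theorem adjPairs_of_isNClique {N k : ℕ} {H : SimpleGraph (Fin N)} {S : Finset (Fin N)}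
    (hS : H.IsNClique k S) : adjPairs H S = k * k - k := by
  classical
  rw [adjPairs, ← hS.card_eq, ← Finset.offDiag_card]
  congr 1
  ext p
  simp only [Finset.mem_filter, Finset.mem_product, Finset.mem_offDiag]
  constructor
  · rintro ⟨⟨h1, h2⟩, h3⟩
    exact ⟨h1, h2, h3.ne⟩
  · rintro ⟨h1, h2, h3⟩
    exact ⟨⟨h1, h2⟩, hS.isClique h1 h2 h3⟩

/-- In a graph with a `k`-clique, approximate solutions are dense. -/
theorem IsApproxDensest.isDenseSet {N k C₀ : ℕ} {C : ℝ} {H : SimpleGraph (Fin N)}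
    {S : Finset (Fin N)} (h : IsApproxDensest C H k S) (hC : C ≤ C₀) (hk : 2 ≤ k)
    (hcl : ∃ S' : Finset (Fin N), H.IsNClique k S') : IsDenseSet H (2 * C₀) k S := by
  obtain ⟨S', hS'⟩ := hcl
  refine ⟨h.1, ?_⟩
  have h1 := h.2 S' hS'.card_eq
  have h2 := adjPairs_of_isNClique hS'
  rw [adjPairs_eq] at h2 ⊢
  have h3 : (inducedEdges H S' : ℝ) ≤ C₀ * inducedEdges H S :=
    h1.trans (by gcongr)
  have h4 : inducedEdges H S' ≤ C₀ * inducedEdges H S := by exact_mod_cast h3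
  -- A clique has k² - k ordered pairs, at least half of k²; this is the factor 2 in the density.
  have h5 : 2 * k ≤ k * k := Nat.mul_le_mul_right k hk
  have h6 : 2 * C₀ * (2 * inducedEdges H S) = 4 * (C₀ * inducedEdges H S) := by ring
  omega

namespace RAM

/-! ### Analysis of a single trial. -/

/-- One trial of the distinguisher that uses the program `A`. -/
def trialProg (P : Params) (A : Prog) : Prog :=
  .seq (sizesProg P) (.seq sampleProg (.seq (instanceProg P) (.seq A.clocked (evalProg P))))

/-- A bound for the running time of a trial. -/
def trialCost (P : Params) (A : Prog) (n j μ : ℕ) : ℕ :=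
  ((P.expo * μ + j) * (n * 4 + 10) + P.lam * Nat.clog 2 n * 4 + P.size n μ * 4 + 23) +
  (P.size n μ * (P.len * μ) * (Nat.clog 2 n * 6 + 11) + 3) +
  (P.size n μ * (P.size n μ * (P.len * μ * (P.len * μ * 4 + 6) + 16) + 10) + 17) +
  A.clockCost * (n ^ j + 2) + (P.size n μ * (P.size n μ * 8 + 8) + 20) + 4

theorem two_pow_clog_le {n : ℕ} (hn : 2 ≤ n) : 2 ^ Nat.clog 2 n ≤ 2 * n := by
  have h := Nat.pow_pred_clog_lt_self one_lt_two (show 1 < n by omega)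
  have h' : 0 < Nat.clog 2 n := Nat.clog_pos one_lt_two (by omega)
  calc 2 ^ Nat.clog 2 n = 2 * 2 ^ (Nat.clog 2 n).pred := by
        rw [← pow_succ']; congr 1; simp; omega
    _ ≤ 2 * n := by omega

open Classical in
/-- The probability that the product graph of `G` for random tuples has a dense set. -/
def denseProb (P : Params) {n : ℕ} [NeZero n] (G : SimpleGraph (Fin n)) (μ : ℕ) : ℝ≥0∞ :=
  (∑ r : Fin (P.size n μ * (P.len * μ)) → Fin (2 ^ Nat.clog 2 n),
    if ∃ S, IsDenseSet (tupleGraph G (tuplesOf n r)) P.dens (P.sub n μ) S then 1 else 0) /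
      (2 ^ Nat.clog 2 n) ^ (P.size n μ * (P.len * μ))

open Classical in
/-- The probability that the product graph of `G` for random tuples has no clique. -/
def noCliqueProb (P : Params) {n : ℕ} [NeZero n] (G : SimpleGraph (Fin n)) (μ : ℕ) : ℝ≥0∞ :=
  (∑ r : Fin (P.size n μ * (P.len * μ)) → Fin (2 ^ Nat.clog 2 n),
    if ∃ S, (tupleGraph G (tuplesOf n r)).IsNClique (P.sub n μ) S then 0 else 1) /
      (2 ^ Nat.clog 2 n) ^ (P.size n μ * (P.len * μ))

open Classical in
/-- The effect of a trial, once the tuples have been chosen. -/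
theorem wp_run_le {P : Params} {A : Prog} {f e : ℕ → ℝ} {C : ℝ} {C₀ : ℕ}
    (hA : RunsInTimeDkS A f e) (hA' : ApproximatesDkSPerfectCompleteness A C) (hC : C ≤ C₀)
    (hP : P.dens = 2 * C₀) {n : ℕ} [NeZero n] {G : SimpleGraph (Fin n)} {s : Store}
    {j μ rep h N l R : ℕ} {r : Fin (N * l) → Fin R} (H : Prepared G s j μ rep h r) (hs : Fresh s)
    (hclk : s vClk 0 = n ^ j + 1)
    (hsim : Simulates s (input (tupleGraph G (tuplesOf n r)) (P.mult * h)))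
    (hk : 2 ≤ P.mult * h) (hkN : P.mult * h ≤ N)
    {F : ℕ → Store → ℝ≥0∞} {u v w : ℝ≥0∞} {T t : ℕ}
    (ht : T + A.clockCost * (n ^ j + 2) + (N * (N * 8 + 8) + 20) ≤ t)
    (hacc : ∀ t' s', T ≤ t' → s' vDone 0 = 1 → s' aOut 0 = 1 → F t' s' ≤ v + u)
    (hrep : ∀ t' s', T ≤ t' → rep + 1 < Nat.clog 2 n → Ready G s' j μ (rep + 1) → Fresh s' →
      F t' s' ≤ v + w)
    (hrej : ∀ t' s', T ≤ t' → ¬ rep + 1 < Nat.clog 2 n → s' vDone 0 = 1 → s' aOut 0 = 0 →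
      F t' s' ≤ v + w)
    (hnext : (n : ℝ) ^ j < f (P.mult * h) * (N : ℝ) ^ e (P.mult * h) → ∀ t' s', T ≤ t' → Fresh s' →
      ((μ < j ∧ Ready G s' j (μ + 1) 0) ∨ (¬ μ < j ∧ Ready G s' (j + 1) P.mu0 0)) → F t' s' ≤ v) :
    wp F t [A.clocked, evalProg P] s ≤ v +
      (u * (if ∃ S, IsDenseSet (tupleGraph G (tuplesOf n r)) P.dens (P.mult * h) S then 1 else 0) +
      w * (3⁻¹ + if ∃ S, (tupleGraph G (tuplesOf n r)).IsNClique (P.mult * h) S then 0 else 1)) := by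
  set G' := tupleGraph G (tuplesOf n r) with hG'
  set k := P.mult * h with hkdef
  -- The price of acceptance is charged in advance whenever a dense set exists. This covers a dense
  -- output regardless of whether the clock has run out.
  set β : ℝ≥0∞ := u * (if ∃ S, IsDenseSet G' P.dens k S then 1 else 0) with hβ
  obtain ⟨T₀, hT₀, hwp⟩ := exists_wp_le_of_outputProb (hA N k (by omega) hkN G')
  set E : Set Store := {m | IsDenseSet G' P.dens k (outputSet N m)} with hE
  have hbound : wp (fun _ m => v + β + w * if m ∈ E then 0 else 1) T₀ [A]
      (input G' k) ≤ v + (β + w * (3⁻¹ + if ∃ S, G'.IsNClique k S then 0 else 1)) := by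
    rw [← add_assoc]
    by_cases hcl : ∃ S, G'.IsNClique k S
    · rw [if_pos hcl, add_zero]
      refine (hwp E (v + β) w).2 ((hA' N k (by omega) hkN G' hcl).trans ?_)
      refine iSup_mono fun t => ?_
      refine measure_mono fun c hc => ⟨hc.1, ?_⟩
      have := IsApproxDensest.isDenseSet hc.2 hC hk hcl
      rwa [← hP] at this
    -- Without a clique nothing is known about the output of `A`, but the factor of `w` is then at
    -- least 1 and the trivial bound suffices.
    · rw [if_neg hcl]
      refine (hwp E (v + β) w).1.trans ?_
      gcongr
      exact le_mul_of_one_le_right' le_add_self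
  refine le_trans ?_ hbound
  rw [wp_cons]
  have heval : ∀ t' s', Prepared G s' j μ rep h r → Fresh s' → T + (N * (N * 8 + 8) + 20) ≤ t' →
      ∀ x, (IsDenseSet G' P.dens k (simOut s' N) → v + u ≤ x) →
        (¬ IsDenseSet G' P.dens k (simOut s' N) → 0 < s' vClk 0 → v + w ≤ x) →
        (s' vClk 0 = 0 → ∀ t'' s'', T ≤ t'' → Fresh s'' →
          ((μ < j ∧ Ready G s'' j (μ + 1) 0) ∨ (¬ μ < j ∧ Ready G s'' (j + 1) P.mu0 0)) →
          F t'' s'' ≤ x) →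
        wp F t' [evalProg P] s' ≤ x := by
    intro t' s' H' hs' ht' x hx1 hx2 hx3
    refine (runs_evalProg (P := P) H' hs').wp_le (by omega) fun s'' t'' hQ ht'' => ?_
    rw [wp_nil]
    rcases hQ with ⟨q1, q2, q3⟩ | ⟨q0, ⟨q1, q2, q3, q4⟩ | ⟨q1, q2, q3, q4⟩ | ⟨q1, q2, q3, q4⟩ |
      ⟨q1, q2, q3, q4⟩⟩
    · exact (hacc t'' s'' (by omega) q2 q3).trans (hx1 q1)
    · exact (hrep t'' s'' (by omega) q2 q3 q4).trans (hx2 q0 q1)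
    · exact (hrej t'' s'' (by omega) q2 q3 q4).trans (hx2 q0 q1)
    · exact hx3 q1 t'' s'' (by omega) q4 (Or.inl ⟨q2, q3⟩)
    · exact hx3 q1 t'' s'' (by omega) q4 (Or.inr ⟨q2, q3⟩)
  have hprep : ∀ s', Keeps s s' → Prepared G s' j μ rep h r := by
    intro s' hk
    refine H.congr fun a ha => hk.1 a ?_ ?_ ?_ <;> revert ha <;> simp <;> omega
  have hβ' : ∀ s' : Store, IsDenseSet G' P.dens k (simOut s' N) → β = u := by
    intro s' hd
    rw [hβ, if_pos ⟨_, hd⟩, mul_one]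
  have htime : ∀ x, x ≤ s vClk 0 →
      A.clockCost * (s vClk 0 - x + 1) ≤ A.clockCost * (n ^ j + 2) := by
    intro x _
    refine Nat.mul_le_mul_left _ ?_
    omega
  refine wp_clocked_le_wp A _ _ (v + β) t T₀ s _ hs hsim ?_ (by omega) (fun _ _ => le_self_add)
    ?_ ?_
  · rw [hclk, add_assoc, one_add_one_eq_two]
    omega
  · intro t' s' T' m hs' hk hm h0 ht' _
    have := htime (s' vClk 0) hk.2
    refine heval t' s' (hprep s' hk) hs' (by omega) _ ?_ ?_ (by omega)
    · intro hd
      rw [hβ' s' hd]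
      exact le_self_add
    · intro hd _
      rw [hm.simOut_eq] at hd
      rw [if_neg (by exact hd), mul_one, add_assoc, add_comm β w, ← add_assoc]
      exact le_self_add
  · intro hT t' s' hs' hk h0 ht'
    have := htime (s' vClk 0) hk.2
    refine heval t' s' (hprep s' hk) hs' (by omega) _ ?_ (by omega) ?_
    · intro hd
      rw [hβ' s' hd]
    · intro _ t'' s'' ht'' hs'' hr
      -- The clock `n ^ j + 1` can only run out if it is at most `T₀`, which is at most the
      -- guaranteed running time of `A`.
      refine (hnext ?_ t'' s'' ht'' hs'' hr).trans le_self_add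
      refine lt_of_lt_of_le ?_ hT₀
      have : n ^ j < T₀ := by omega
      exact_mod_cast this

/-- Here `v` bounds the value after a timeout, `u` is the surcharge for acceptance and `w` the
surcharge for a completed trial without a dense output. In the last case `A` has erred, with
probability at most 1/3, or the product graph has no `k`-clique. Averaging `wp_run_le` over the
sampled tuples gives the two probabilities. -/
theorem wp_trialProg_le {P : Params} {A : Prog} {f e : ℕ → ℝ} {C : ℝ} {C₀ : ℕ}
    (hA : RunsInTimeDkS A f e) (hA' : ApproximatesDkSPerfectCompleteness A C) (hC : C ≤ C₀)
    (hP : P.dens = 2 * C₀) {n : ℕ} [NeZero n] (hn : 2 ≤ n) {G : SimpleGraph (Fin n)} {s : Store}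
    {j μ rep : ℕ} (H : Ready G s j μ rep) (hs : Fresh s) (hμ : 0 < μ)
    (hk : 2 ≤ P.sub n μ) (hkN : P.sub n μ ≤ P.size n μ)
    {F : ℕ → Store → ℝ≥0∞} {u v w : ℝ≥0∞} {T t : ℕ}
    (ht : T + trialCost P A n j μ ≤ t)
    (hacc : ∀ t' s', T ≤ t' → s' vDone 0 = 1 → s' aOut 0 = 1 → F t' s' ≤ v + u)
    (hrep : ∀ t' s', T ≤ t' → rep + 1 < Nat.clog 2 n → Ready G s' j μ (rep + 1) → Fresh s' →
      F t' s' ≤ v + w)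
    (hrej : ∀ t' s', T ≤ t' → ¬ rep + 1 < Nat.clog 2 n → s' vDone 0 = 1 → s' aOut 0 = 0 →
      F t' s' ≤ v + w)
    (hnext : (n : ℝ) ^ j < f (P.sub n μ) * (P.size n μ : ℝ) ^ e (P.sub n μ) →
      ∀ t' s', T ≤ t' → Fresh s' →
      ((μ < j ∧ Ready G s' j (μ + 1) 0) ∨ (¬ μ < j ∧ Ready G s' (j + 1) P.mu0 0)) → F t' s' ≤ v) :
    wp F t [trialProg P A] s ≤ v + (u * denseProb P G μ + w * (3⁻¹ + noCliqueProb P G μ)) := by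
  classical
  rw [trialCost] at ht
  obtain ⟨t, rfl⟩ : ∃ x, t = x + 1 := ⟨t - 1, by omega⟩
  rw [trialProg, wp]
  refine (runs_sizesProg (P := P) H hμ).wp_le (by omega) ?_
  rintro s₁ t₁ ⟨f₁, hN, hB, hH, hM⟩ ht₁
  have H₁ := H.frame f₁ (by simp)
  have hs₁ := hs.frame f₁ (by simp)
  obtain ⟨t₁, rfl⟩ : ∃ x, t₁ = x + 1 := ⟨t₁ - 1, by omega⟩
  rw [wp]
  refine (wp_sampleProg_le (b := Nat.clog 2 n) (n := n) (fun r => v +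
      (u * (if ∃ S, IsDenseSet (tupleGraph G (tuplesOf n r)) P.dens (P.sub n μ) S then 1 else 0) +
      w * (3⁻¹ + if ∃ S, (tupleGraph G (tuplesOf n r)).IsNClique (P.sub n μ) S then 0 else 1)))
    H₁.bits H₁.size hM
    (T + A.clockCost * (n ^ j + 2) + (P.size n μ * (P.size n μ * 8 + 8) + 20) + 2 +
      (P.size n μ * (P.size n μ * (P.len * μ * (P.len * μ * 4 + 6) + 16) + 10) + 17)) t₁
    (by omega) ?_).trans (le_of_eq ?_)
  · intro t₂ s₂ r f₂ ht₂ hr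
    obtain ⟨t₂, rfl⟩ : ∃ x, t₂ = x + 1 := ⟨t₂ - 1, by omega⟩
    rw [wp]
    have hN₂ : s₂ vSize 0 = P.size n μ := by rw [f₂ vSize (by simp), hN]
    have hB₂ : s₂ vBudget 0 = n ^ j := by rw [f₂ vBudget (by simp), hB]
    have hH₂ : s₂ vH 0 = P.lam * Nat.clog 2 n ⌈/⌉ μ := by rw [f₂ vH (by simp), hH]
    refine (runs_instanceProg (P := P) (H₁.frame f₂ (by simp)) (hs₁.frame f₂ (by simp))
      (two_pow_clog_le hn) hr rfl hN₂ hB₂ hH₂).wp_le (by omega) ?_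
    rintro s₃ t₃ ⟨g1, g2, g3, g4⟩ ht₃
    obtain ⟨t₃, rfl⟩ : ∃ x, t₃ = x + 1 := ⟨t₃ - 1, by omega⟩
    rw [wp]
    exact wp_run_le hA hA' hC hP g1 g2 g3 g4 hk hkN (by omega) hacc hrep hrej hnext
  · have hne0 : ((2 : ℝ≥0∞) ^ Nat.clog 2 n) ^ (P.size n μ * (P.len * μ)) ≠ 0 := by positivity
    have hnet : ((2 : ℝ≥0∞) ^ Nat.clog 2 n) ^ (P.size n μ * (P.len * μ)) ≠ ⊤ := by finiteness
    have hconst : ∀ x : ℝ≥0∞, (∑ _r : Fin (P.size n μ * (P.len * μ)) → Fin (2 ^ Nat.clog 2 n), x) /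
        (2 ^ Nat.clog 2 n) ^ (P.size n μ * (P.len * μ)) = x := by
      intro x
      rw [Finset.sum_const, nsmul_eq_mul, Finset.card_univ, Fintype.card_fun, Fintype.card_fin,
        Fintype.card_fin]
      push_cast
      rw [mul_comm, ENNReal.mul_div_cancel_right hne0 hnet]
    rw [Finset.sum_add_distrib, Finset.sum_add_distrib, ← Finset.mul_sum, ← Finset.mul_sum,
      Finset.sum_add_distrib, ENNReal.add_div, ENNReal.add_div, hconst, mul_div_assoc,
      mul_div_assoc, ENNReal.add_div, hconst]
    rfl

/-! ### The main loop. -/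

/-- The main loop of the distinguisher. -/
def mainLoop (P : Params) (A : Prog) : Prog := .loop (.var vDone) 1 (trialProg P A)

/-- The distinguisher for planted cliques that uses the program `A`. -/
def mainProg (P : Params) (A : Prog) : Prog :=
  .seq logProg (.seq rowProg (.seq (.assign vStage 0 (.const P.mu0))
    (.seq (.assign vMu 0 (.const P.mu0)) (mainLoop P A))))

/-- A bound for the number of pairs of a stage and a width from `(j, μ)` on, up to stage `J`. -/
def stagesLeft (J j μ : ℕ) : ℕ := (J - j) * (J + 1) + (J - μ)

theorem stagesLeft_succ_lt {J j μ : ℕ} (hμ : μ < j) (hj : j ≤ J) :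
    stagesLeft J j (μ + 1) + 1 ≤ stagesLeft J j μ := by
  rw [stagesLeft, stagesLeft]
  omega

theorem stagesLeft_next_lt {J j μ μ₀ : ℕ} (hμ : μ ≤ j) (hj : j < J) :
    stagesLeft J (j + 1) μ₀ + 1 ≤ stagesLeft J j μ := by
  obtain ⟨d, rfl⟩ := Nat.exists_eq_add_of_lt hj
  rw [stagesLeft, stagesLeft, show j + d + 1 - (j + 1) = d by omega,
    show j + d + 1 - j = d + 1 by omega, add_mul]
  omega

/-- `a` and `c` are the prices of acceptance and rejection, and `D` bounds the number of trials to
come, each of which accepts at expected price at most `a * β`. Rejection requires either the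
remaining `b - rep` failures for the current stage and width, or `b` failures for one of the at most
`stagesLeft` later pairs, each failure having probability at most 1/2. The loop cannot pass stage
`J` and width `M`, since by `hJ` no timeout is possible there. -/
theorem wp_mainLoop_le {P : Params} {A : Prog} {f e : ℕ → ℝ} {C : ℝ} {C₀ : ℕ}
    (hA : RunsInTimeDkS A f e) (hA' : ApproximatesDkSPerfectCompleteness A C) (hC : C ≤ C₀)
    (hP : P.dens = 2 * C₀) (hP0 : 0 < P.mu0) {n : ℕ} [NeZero n] (hn : 2 ≤ n)
    {G : SimpleGraph (Fin n)} {J M X : ℕ} (hM0 : P.mu0 ≤ M) (hMJ : M ≤ J)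
    (hsub : ∀ μ, P.mu0 ≤ μ → μ ≤ J → 2 ≤ P.sub n μ ∧ P.sub n μ ≤ P.size n μ)
    (hX : ∀ j μ, j ≤ J → μ ≤ J → trialCost P A n j μ ≤ X)
    (hJ : f (P.sub n M) * (P.size n M : ℝ) ^ e (P.sub n M) ≤ (n : ℝ) ^ J)
    {Φ : Store → ℝ≥0∞} {a c β : ℝ≥0∞}
    (hacc : ∀ s, s vDone 0 = 1 → s aOut 0 = 1 → Φ s ≤ a)
    (hrej : ∀ s, s vDone 0 = 1 → s aOut 0 = 0 → Φ s ≤ c)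
    (hβ : ∀ μ, P.mu0 ≤ μ → μ ≤ J → a * denseProb P G μ ≤ a * β)
    (hcl : ∀ μ, P.mu0 ≤ μ → μ ≤ J → c * (3⁻¹ + noCliqueProb P G μ) ≤ c * 2⁻¹) :
    ∀ (D j μ rep t : ℕ) (s : Store), Ready G s j μ rep → Fresh s → P.mu0 ≤ μ → μ ≤ j → j ≤ J →
      (j = J → μ ≤ M) → rep < Nat.clog 2 n →
      stagesLeft J j μ * Nat.clog 2 n + (Nat.clog 2 n - rep) ≤ D → D * (X + 1) + 1 ≤ t →
      wp (fun _ => Φ) t [mainLoop P A] s ≤ a * (D * β) +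
        c * (2⁻¹ ^ (Nat.clog 2 n - rep) + stagesLeft J j μ * 2⁻¹ ^ Nat.clog 2 n) := by
  set b := Nat.clog 2 n with hb
  intro D
  induction D with
  | zero =>
    intro j μ rep t s _ _ _ _ _ _ hrep hD
    omega
  | succ D ih =>
    intro j μ rep t s hs hfr h0μ hμj hjJ hM hrep hD ht
    rw [add_mul, one_mul] at ht
    obtain ⟨t, rfl⟩ : ∃ x, t = x + 1 := ⟨t - 1, by omega⟩
    have hdone : s vDone 0 = 0 := hs.done
    rw [mainLoop, wp_loop, if_pos (by simp [hdone]), wp_cons]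
    obtain ⟨h2, hN⟩ := hsub μ h0μ (hμj.trans hjJ)
    set L := stagesLeft J j μ with hL
    obtain ⟨x, hx⟩ : ∃ x, b - rep = x + 1 := ⟨b - rep - 1, by omega⟩
    have hexit : ∀ t' s', 1 ≤ t' → s' vDone 0 = 1 →
        wp (fun _ => Φ) t' [mainLoop P A] s' = Φ s' := by
      intro t' s' ht' hd
      obtain ⟨t', rfl⟩ : ∃ x, t' = x + 1 := ⟨t' - 1, by omega⟩
      rw [mainLoop, wp_loop, if_neg (by simp [hd]), wp_nil]
    refine (wp_trialProg_le hA hA' hC hP hn hs hfr (by omega) h2 hN (u := a)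
      (v := a * (D * β) + c * (L * 2⁻¹ ^ b)) (w := c * 2⁻¹ ^ x) (T := D * (X + 1) + 1)
      (by have := hX j μ hjJ (hμj.trans hjJ); omega) ?_ ?_ ?_ ?_).trans ?_
    · intro t' s' ht' hd ho
      rw [← mainLoop, hexit t' s' (by omega) hd]
      exact (hacc s' hd ho).trans le_add_self
    · intro t' s' ht' hlt hr hf
      rw [← mainLoop]
      refine (ih j μ (rep + 1) t' s' hr hf h0μ hμj hjJ hM hlt ?_ ht').trans ?_
      · rw [← hL]; omega
      · rw [show b - (rep + 1) = x by omega, mul_add c, ← hL, add_assoc,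
          add_comm (c * 2⁻¹ ^ x)]
    · intro t' s' ht' hlt hd ho
      rw [← mainLoop, hexit t' s' (by omega) hd]
      obtain rfl : x = 0 := by omega
      rw [pow_zero, mul_one]
      exact (hrej s' hd ho).trans le_add_self
    · intro hτ t' s' ht' hf hr
      rw [← mainLoop]
      have hne : ¬ (j = J ∧ μ = M) := by
        rintro ⟨rfl, rfl⟩
        exact absurd hJ (not_le.2 hτ)
      have key : ∀ j' μ', stagesLeft J j' μ' + 1 ≤ L → Ready G s' j' μ' 0 → P.mu0 ≤ μ' → μ' ≤ j' →
          j' ≤ J → (j' = J → μ' ≤ M) →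
          wp (fun _ => Φ) t' [mainLoop P A] s' ≤ a * (D * β) + c * (L * 2⁻¹ ^ b) := by
        intro j' μ' hlt hr' h1 h2 h3 h4
        refine (ih j' μ' 0 t' s' hr' hf h1 h2 h3 h4 (by omega) ?_ ht').trans ?_
        · have := Nat.mul_le_mul_right b hlt
          rw [add_mul, one_mul] at this
          omega
        · gcongr
          rw [Nat.sub_zero]
          calc 2⁻¹ ^ b + (stagesLeft J j' μ' : ℝ≥0∞) * 2⁻¹ ^ b
              = ((stagesLeft J j' μ' + 1 : ℕ) : ℝ≥0∞) * 2⁻¹ ^ b := by push_cast; ring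
            _ ≤ L * 2⁻¹ ^ b := by gcongr
      rcases hr with ⟨hlt, hr⟩ | ⟨hlt, hr⟩
      · exact key j (μ + 1) (stagesLeft_succ_lt hlt hjJ) hr (by omega) (by omega) hjJ (by omega)
      · have hj : j < J := by omega
        exact key (j + 1) P.mu0 (stagesLeft_next_lt hμj hj) hr le_rfl (by omega) (by omega)
          (by omega)
    · have h1 := hβ μ h0μ (hμj.trans hjJ)
      have h2 : c * 2⁻¹ ^ x * (3⁻¹ + noCliqueProb P G μ) ≤ c * 2⁻¹ ^ (x + 1) := by
        calc c * 2⁻¹ ^ x * (3⁻¹ + noCliqueProb P G μ)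
            = 2⁻¹ ^ x * (c * (3⁻¹ + noCliqueProb P G μ)) := by ring
          _ ≤ 2⁻¹ ^ x * (c * 2⁻¹) := mul_le_mul' le_rfl (hcl μ h0μ (hμj.trans hjJ))
          _ = c * 2⁻¹ ^ (x + 1) := by rw [pow_succ]; ring
      calc a * (D * β) + c * (L * 2⁻¹ ^ b) +
            (a * denseProb P G μ + c * 2⁻¹ ^ x * (3⁻¹ + noCliqueProb P G μ))
          ≤ a * (D * β) + c * (L * 2⁻¹ ^ b) + (a * β + c * 2⁻¹ ^ (x + 1)) := by gcongr
        _ = a * ((D + 1 : ℕ) * β) + c * (2⁻¹ ^ (b - rep) + L * 2⁻¹ ^ b) := by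
            rw [hx]; push_cast; ring

theorem mul_add_inj {n u v u' v' : ℕ} (hv : v < n) (hv' : v' < n) (h : u * n + v = u' * n + v') :
    u = u' ∧ v = v' := by
  have h1 : (u * n + v) / n = u := by
    rw [mul_comm, Nat.mul_add_div (by omega), Nat.div_eq_of_lt hv, add_zero]
  have h2 : (u' * n + v') / n = u' := by
    rw [mul_comm, Nat.mul_add_div (by omega), Nat.div_eq_of_lt hv', add_zero]
  have h3 : u = u' := by rw [← h1, h, h2]
  subst h3
  exact ⟨rfl, by omega⟩

theorem wp_mainProg_le {P : Params} {A : Prog} {n : ℕ} {G : SimpleGraph (Fin n)}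
    {F : ℕ → Store → ℝ≥0∞} {v : ℝ≥0∞} {T t : ℕ} (ht : T + n * 12 + 16 ≤ t)
    (h : ∀ t' s', T ≤ t' → Ready G s' P.mu0 P.mu0 0 → Fresh s' → wp F t' [mainLoop P A] s' ≤ v) :
    wp F t [mainProg P A] (input G 0) ≤ v := by
  classical
  obtain ⟨t, rfl⟩ : ∃ x, t = x + 1 := ⟨t - 1, by omega⟩
  have hn : input G 0 0 0 = n := by simp [input]
  rw [mainProg, wp]
  refine (runs_logProg hn).wp_le (by omega) ?_
  rintro s₁ t₁ ⟨f₁, hb⟩ ht₁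
  obtain ⟨t₁, rfl⟩ : ∃ x, t₁ = x + 1 := ⟨t₁ - 1, by omega⟩
  rw [wp]
  have hn₁ : s₁ 0 0 = n := by rw [f₁ 0 (by simp), hn]
  refine (runs_rowProg hn₁).wp_le (by omega) ?_
  rintro s₂ t₂ ⟨f₂, hrow, hadj⟩ ht₂
  obtain ⟨t₂, rfl⟩ : ∃ x, t₂ = x + 4 := ⟨t₂ - 4, by omega⟩
  rw [show t₂ + 4 = t₂ + 1 + 1 + 1 + 1 from rfl, wp, wp, wp, wp]
  have f₃ : Frame [vBits, vPow, aRow, aAdj, vX, vI, vStage, vMu] (input G 0)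
      ((s₂.set vStage 0 P.mu0).set vMu 0 P.mu0) :=
    (((f₁.mono (by simp)).trans f₂ (by simp)).set _ _ (by simp)).set _ _ (by simp)
  change wp F t₂ [mainLoop P A] ((s₂.set vStage 0 P.mu0).set vMu 0 P.mu0) ≤ v
  refine h t₂ _ (by omega) ⟨?_, ?_, ?_, ?_, ?_, ?_, ?_, ?_, ?_⟩ ⟨?_, fun a i _ => ?_⟩
  · exact (congrFun (f₃ 0 (by simp)) 0).trans hn
  · simpa [Store.set_apply] using hrow
  · intro u v
    rw [Store.set_ne _ _ _ (by simp), Store.set_ne _ _ _ (by simp), hadj, f₁ aAdj (by simp)]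
    have e1 : (∃ w < n, (u * n + v : ℕ) = w * n + w) ↔ u = v := by
      constructor
      · rintro ⟨w, hw, hw'⟩
        obtain ⟨h1, h2⟩ := mul_add_inj v.2 hw hw'
        exact Fin.ext (h1.trans h2.symm)
      · rintro rfl
        exact ⟨u, u.2, rfl⟩
    have e2 : (∃ u' v' : Fin n, (u * n + v : ℕ) = u' * n + v' ∧ G.Adj u' v') ↔ G.Adj u v := by
      constructor
      · rintro ⟨u', v', hw, hw'⟩
        obtain ⟨h1, h2⟩ := mul_add_inj v.2 v'.2 hw
        rwa [Fin.ext h1, Fin.ext h2]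
      · intro h
        exact ⟨u, v, rfl, h⟩
    simp only [e1, input, e2]
    by_cases h1 : u = v <;> simp [h1]
  · simp [Store.set_apply, f₂ vBits, hb]
  · simp [Store.set_apply]
  · simp [Store.set_apply]
  · rw [f₃ vRep (by simp)]; simp [input]
  · rw [f₃ vDone (by simp)]; simp [input]
  · rw [f₃ aOut (by simp)]; simp [input]
  · rw [f₃ vOff (by simp), f₃ vHi (by simp)]; simp [input]
  · rw [f₃ (a + aSim) (by simp)]; simp [input]

end RAM

/-! ### Completeness: large cliques give cliques in the product graph. -/

/-- Sequences of length `N * l` as sequences of `N` tuples of length `l`. -/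
def tuplesEquiv (N l : ℕ) (α : Type*) : (Fin (N * l) → α) ≃ (Fin N → Fin l → α) :=
  (Equiv.arrowCongr finProdFinEquiv.symm (Equiv.refl α)).trans (Equiv.curry _ _ _)

/-- The fraction of sequences with a given property, as a sum. -/
theorem sum_tuples_eq_card {N l R : ℕ} (p : (Fin N → Fin l → Fin R) → Prop) [DecidablePred p] :
    (∑ r : Fin (N * l) → Fin R, if p (tuplesEquiv N l _ r) then (1 : ℝ≥0∞) else 0) =
      (Finset.univ.filter p).card := by
  rw [← Finset.sum_boole]
  exact Fintype.sum_equiv (tuplesEquiv N l (Fin R)) _ _ fun r => rfl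

/-- With p = m / (y + m) this is (1 - p)^a ≤ 1 / (ap), a division-free substitute for the
exponential bound that is strong enough here. -/
theorem mul_mul_pow_le_add_pow (y m a : ℕ) : a * m * y ^ a ≤ (y + m) ^ (a + 1) := by
  induction a with
  | zero => simp
  | succ a ih =>
    have h : y ^ (a + 1) ≤ (y + m) ^ (a + 1) := Nat.pow_le_pow_left (by omega) _
    calc (a + 1) * m * y ^ (a + 1) = y * (a * m * y ^ a) + m * y ^ (a + 1) := by ring
      _ ≤ y * (y + m) ^ (a + 1) + m * (y + m) ^ (a + 1) := by gcongr
      _ = (y + m) ^ (a + 1 + 1) := by ring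

theorem card_le_card_ofNat_mem {n R : ℕ} [NeZero n] (hR : n ≤ R) (S : Finset (Fin n)) :
    S.card ≤ (Finset.univ.filter fun x : Fin R => Fin.ofNat n x ∈ S).card := by
  refine Finset.card_le_card_of_injOn (fun v => ⟨v, v.2.trans_le hR⟩) ?_ ?_
  · intro v hv
    simpa [Fin.ofNat_val_eq_self] using hv
  · intro v _ w _ h
    simpa [Fin.ext_iff] using h

theorem card_forall_mem {N : ℕ} {β : Type*} [Fintype β] [DecidableEq β] (X : Finset β)
    (B : Finset (Fin N)) :
    (Finset.univ.filter fun z : Fin N → β => ∀ i ∈ B, z i ∈ X).card =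
      X.card ^ B.card * Fintype.card β ^ (N - B.card) := by
  have : (Finset.univ.filter fun z : Fin N → β => ∀ i ∈ B, z i ∈ X) =
      Fintype.piFinset fun i => if i ∈ B then X else Finset.univ := by
    ext z
    simp only [Finset.mem_filter, Finset.mem_univ, true_and, Fintype.mem_piFinset]
    refine forall_congr' fun i => ?_
    by_cases hi : i ∈ B <;> simp [hi]
  rw [this, Fintype.card_piFinset, ← Finset.prod_mul_prod_compl B,
    Finset.prod_congr rfl (g := fun _ => X.card), Finset.prod_const,
    Finset.prod_congr rfl (g := fun _ => Fintype.card β) (s₁ := Bᶜ), Finset.prod_const,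
    Finset.card_compl, Fintype.card_fin]
  · intro i hi
    simp [Finset.mem_compl.1 hi]
  · intro i hi
    rw [if_pos hi]

/-- Few sequences of tuples avoid the product set of `T` on a set of indices. -/
theorem card_forall_not_mem {N l R : ℕ} (T : Finset (Fin R)) (B : Finset (Fin N)) :
    (Finset.univ.filter fun z : Fin N → Fin l → Fin R => ∀ i ∈ B, ¬ ∀ a, z i a ∈ T).card =
      (R ^ l - T.card ^ l) ^ B.card * (R ^ l) ^ (N - B.card) := by
  have h := card_forall_mem (Fintype.piFinset fun _ : Fin l => T)ᶜ B
  simp only [Finset.mem_compl, Fintype.mem_piFinset, Finset.card_compl, Fintype.card_piFinset] at h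
  simpa using h

open Classical in
/-- If the graph contains a large clique then a few tuples in the clique are found with good
probability. -/
theorem card_no_clique_le {n N l R k a : ℕ} [NeZero n] {G : SimpleGraph (Fin n)}
    {S : Finset (Fin n)} (hS : G.IsClique S) (hR : n ≤ R) (hk : k * a ≤ N)
    (ha : n * R ^ l ≤ a * S.card ^ l) :
    n * (Finset.univ.filter fun z : Fin N → Fin l → Fin R =>
      ¬ ∃ S', (tupleGraph G fun i c => Fin.ofNat n (z i c)).IsNClique k S').card ≤
        k * (R ^ l) ^ N := by
  classical
  set T := Finset.univ.filter fun x : Fin R => Fin.ofNat n x ∈ S with hT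
  -- The first k·a indices are cut into k blocks of length a. One tuple inside the clique from each
  -- block gives a k-clique, so only a union bound over blocks without such a tuple is needed.
  let B : Fin k → Finset (Fin N) := fun j => Finset.univ.filter fun i => (i : ℕ) / a = j
  have hn : 0 < n := Nat.pos_of_ne_zero (NeZero.ne n)
  have hRl : 0 < R ^ l := pow_pos (by omega) _
  have ha0 : 0 < a := by
    rcases Nat.eq_zero_or_pos a with rfl | h
    · have := Nat.mul_pos hn hRl; omega
    · exact h
  have hTR : T.card ≤ R := by
    simpa using Finset.card_le_univ T
  have hB : ∀ j, (B j).card = a := by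
    intro j
    have hj : (j + 1) * a ≤ k * a := Nat.mul_le_mul_right a j.2
    rw [add_mul, one_mul] at hj
    let g : Fin a → Fin N := fun x => ⟨j * a + x, by have := x.2; omega⟩
    have hg : Function.Injective g := fun x y h => by
      have h' : (j * a + x : ℕ) = j * a + y := congrArg Fin.val h
      exact Fin.ext (by omega)
    have e : B j = (Finset.univ : Finset (Fin a)).map ⟨g, hg⟩ := by
      ext i
      simp only [B, Finset.mem_filter, Finset.mem_univ, true_and, Finset.mem_map]
      rw [Nat.div_eq_iff ha0]
      constructor
      · intro h
        exact ⟨⟨i - j * a, by omega⟩, Fin.ext (by simp [g]; omega)⟩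
      · rintro ⟨x, rfl⟩
        have := x.2
        simp only [g, Function.Embedding.coeFn_mk]
        omega
    rw [e, Finset.card_map, Finset.card_univ, Fintype.card_fin]
  have hsub : (Finset.univ.filter fun z : Fin N → Fin l → Fin R =>
      ¬ ∃ S', (tupleGraph G fun i c => Fin.ofNat n (z i c)).IsNClique k S') ⊆
      Finset.univ.biUnion fun j : Fin k => Finset.univ.filter fun z : Fin N → Fin l → Fin R =>
        ∀ i ∈ B j, ¬ ∀ c, z i c ∈ T := by
    intro z hz
    simp only [Finset.mem_filter, Finset.mem_univ, true_and, Finset.mem_biUnion] at hz ⊢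
    by_contra! hcon
    choose g hgB hgT using hcon
    have hgj : ∀ j, (g j : ℕ) / a = j := fun j => by simpa [B] using hgB j
    have hinj : Function.Injective g := fun x y h => by
      apply Fin.ext
      rw [← hgj x, ← hgj y, h]
    refine hz ⟨Finset.univ.map ⟨g, hinj⟩, ?_, by simp⟩
    intro i hi i' hi' hne
    simp only [Finset.coe_map, Finset.coe_univ, Set.image_univ, Set.mem_range,
      Function.Embedding.coeFn_mk] at hi hi'
    obtain ⟨x, rfl⟩ := hi
    obtain ⟨y, rfl⟩ := hi'
    refine ⟨hne, fun c d => ?_⟩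
    have h1 : Fin.ofNat n (z (g x) c) ∈ S := by simpa [hT] using hgT x c
    have h2 : Fin.ofNat n (z (g y) d) ∈ S := by simpa [hT] using hgT y d
    exact or_iff_not_imp_left.2 fun h => hS h1 h2 h
  have hcard := (Finset.card_le_card hsub).trans Finset.card_biUnion_le
  simp only [card_forall_not_mem, hB, Finset.sum_const, Finset.card_univ, Fintype.card_fin,
    smul_eq_mul] at hcard
  rcases Nat.eq_zero_or_pos k with rfl | hk0
  · simp only [zero_mul, Nat.le_zero] at hcard ⊢
    rw [hcard, mul_zero]
  have haN : a ≤ N := (Nat.le_mul_of_pos_left a hk0).trans hk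
  set y := R ^ l - T.card ^ l with hy
  have hym : y + T.card ^ l = R ^ l := by
    have := Nat.pow_le_pow_left hTR l
    omega
  -- A block contains no tuple inside the clique with probability at most 1/n.
  have hkey : n * y ^ a ≤ (R ^ l) ^ a := by
    have h1 := mul_mul_pow_le_add_pow y (T.card ^ l) a
    rw [hym, pow_succ] at h1
    have h2 : n * R ^ l ≤ a * T.card ^ l :=
      ha.trans (Nat.mul_le_mul_left _ (Nat.pow_le_pow_left (card_le_card_ofNat_mem hR S) l))
    refine Nat.le_of_mul_le_mul_right ?_ hRl
    calc n * y ^ a * R ^ l = n * R ^ l * y ^ a := by ring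
      _ ≤ a * T.card ^ l * y ^ a := by gcongr
      _ ≤ _ := h1
  calc _ ≤ n * (k * (y ^ a * (R ^ l) ^ (N - a))) := Nat.mul_le_mul_left _ hcard
    _ = k * (n * y ^ a * (R ^ l) ^ (N - a)) := by ring
    _ ≤ k * ((R ^ l) ^ a * (R ^ l) ^ (N - a)) := by gcongr
    _ = k * (R ^ l) ^ N := by rw [← pow_add, Nat.add_sub_cancel' haN]

namespace RAM

/-- A tuple lies in the clique with probability at least |S|^l / R^l, where |S|^l ≥ n^(8μ) and R^l ≤
n^(l+μ). Blocks of N/n tuples then contain at least n such tuples on average, so each block fails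
with probability at most 1/n, and at most n/6 blocks are needed. -/
theorem noCliqueProb_le {P : Params} {n μ q : ℕ} [NeZero n] {G : SimpleGraph (Fin n)}
    {S : Finset (Fin n)} (hS : G.IsClique S) (hq : 2 ≤ q) (hμ : 0 < μ)
    (hexpo : P.expo = 4 * (q - 1)) (hlen : P.len = 4 * q) (hn : 2 ^ (4 * q) ≤ n)
    (hSq : n ^ 2 ≤ S.card ^ q) (hk : 6 * P.sub n μ ≤ n) : noCliqueProb P G μ ≤ 6⁻¹ := by
  classical
  have hn2 : 2 ≤ n := 
    (Nat.pow_le_pow_right (n := 2) (by norm_num) (show 1 ≤ 4 * q by omega)).trans hn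
  set R := 2 ^ Nat.clog 2 n with hRdef
  have hR : n ≤ R := Nat.le_pow_clog (by norm_num) n
  have hR2 : R ≤ 2 * n := two_pow_clog_le hn2
  set l := P.len * μ with hl
  set N := P.size n μ with hN
  obtain ⟨x, hx⟩ : ∃ x, P.expo * μ = x + 1 :=
    ⟨P.expo * μ - 1, by have : 0 < P.expo * μ := Nat.mul_pos (by omega) hμ; omega⟩
  have hNx : N = n * n ^ x := by rw [hN, Params.size, hx, pow_succ']
  have hlx : l + 4 * μ = x + 1 + 8 * μ := by
    rw [← hx, hl, hlen, hexpo]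
    obtain ⟨q, rfl⟩ : ∃ y, q = y + 1 := ⟨q - 1, by omega⟩
    rw [Nat.add_sub_cancel]; ring
  have hsmall : n * R ^ l ≤ n ^ x * S.card ^ l := by
    have h1 : n ^ (8 * μ) ≤ S.card ^ l := by
      rw [show 8 * μ = 2 * (4 * μ) by ring, hl, hlen, show 4 * q * μ = q * (4 * μ) by ring,
        pow_mul n, pow_mul S.card]
      exact Nat.pow_le_pow_left hSq _
    have h2 : 2 ^ l ≤ n ^ μ := by
      rw [hl, hlen, pow_mul]
      exact Nat.pow_le_pow_left hn _
    calc n * R ^ l ≤ n * (2 * n) ^ l := by gcongr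
      _ = n ^ (l + 1) * 2 ^ l := by rw [mul_pow]; ring
      _ ≤ n ^ (l + 1) * n ^ μ := by gcongr
      _ = n ^ (l + 1 + μ) := by rw [← pow_add]
      -- By `hlx` the inequality between the exponents is 2 + 5μ ≤ 8μ.
      _ ≤ n ^ (x + 8 * μ) := Nat.pow_le_pow_right (by omega) (by omega)
      _ = n ^ x * n ^ (8 * μ) := by rw [pow_add]
      _ ≤ _ := by gcongr
  have hmain := card_no_clique_le (k := P.sub n μ) (N := N) (l := l) hS hR
    (by rw [hNx]; exact Nat.mul_le_mul_right _ (by omega)) hsmall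
  set c := (Finset.univ.filter fun z : Fin N → Fin l → Fin R =>
      ¬ ∃ S', (tupleGraph G fun i c => Fin.ofNat n (z i c)).IsNClique (P.sub n μ) S').card with hc
  have hsum : noCliqueProb P G μ = c / (2 ^ Nat.clog 2 n) ^ (N * l) := by
    rw [noCliqueProb, hc, ← sum_tuples_eq_card]
    congr 1
    refine Finset.sum_congr rfl fun r _ => ?_
    by_cases h : ∃ S, (tupleGraph G (tuplesOf n r)).IsNClique (P.sub n μ) S
    · rw [if_pos h, if_neg]
      exact not_not.2 h
    · rw [if_neg h, if_pos]
      exact h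
  have hc6 : c * 6 ≤ R ^ (N * l) := by
    rw [mul_comm N l, pow_mul]
    have h1 : n * (c * 6) ≤ n * (R ^ l) ^ N := by
      calc n * (c * 6) = 6 * (n * c) := by ring
        _ ≤ 6 * (P.sub n μ * (R ^ l) ^ N) := by gcongr
        _ = 6 * P.sub n μ * (R ^ l) ^ N := by ring
        _ ≤ _ := by gcongr
    exact Nat.le_of_mul_le_mul_left h1 (by omega)
  rw [hsum, ENNReal.div_le_iff (by positivity) (by finiteness), ← ENNReal.div_eq_inv_mul,
    ENNReal.le_div_iff_mul_le (by simp) (by simp)]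
  exact_mod_cast hc6

end RAM

/-! ### Soundness: dense sets in spread families force many edges. -/

section Spread

variable {ι α : Type*} [DecidableEq α]

/-- Elements that lie in many members of a family are few. -/
theorem card_heavy_mul_le [Fintype α] (V : ι → Finset α) (I : Finset ι) {l D : ℕ}
    (hV : ∀ i ∈ I, (V i).card ≤ l) :
    D * (Finset.univ.filter fun v => D ≤ (I.filter fun i => v ∈ V i).card).card ≤ I.card * l := by
  set W := Finset.univ.filter fun v => D ≤ (I.filter fun i => v ∈ V i).card with hW
  calc D * W.card = ∑ _v ∈ W, D := by rw [Finset.sum_const, smul_eq_mul, mul_comm]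
    _ ≤ ∑ v ∈ W, (I.filter fun i => v ∈ V i).card :=
        Finset.sum_le_sum fun v hv => (Finset.mem_filter.1 hv).2
    _ = ∑ i ∈ I, (W.filter fun v => v ∈ V i).card :=
        (Finset.sum_card_bipartiteAbove_eq_sum_card_bipartiteBelow fun i v => v ∈ V i).symm
    _ ≤ ∑ _i ∈ I, l := Finset.sum_le_sum fun i hi =>
        (Finset.card_le_card fun v hv => (Finset.mem_filter.1 hv).2).trans (hV i hi)
    _ = I.card * l := by rw [Finset.sum_const, smul_eq_mul]

/-- In a spread family few members have few elements outside a small set. -/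
theorem card_few_outside_lt (V : ι → Finset α) (I : Finset ι) (W : Finset α) {h μ : ℕ} (hh : 0 < h)
    (hμ : 0 < μ) (hW : W.card ≤ h * μ)
    (hV : ∀ J ⊆ I, J.card = h → 2 * μ * h ≤ (J.biUnion V).card) :
    (I.filter fun i => (V i \ W).card < μ).card < h := by
  by_contra! hcon
  obtain ⟨J, hJ, hJh⟩ := Finset.exists_subset_card_eq hcon
  -- Such `h` members would cover at most hμ + h(μ - 1) elements, fewer than the 2μh required.
  have h1 := hV J (hJ.trans (Finset.filter_subset _ _)) hJh
  have h2 : J.biUnion V ⊆ W ∪ J.biUnion fun i => V i \ W := by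
    intro v hv
    obtain ⟨i, hi, hvi⟩ := Finset.mem_biUnion.1 hv
    by_cases hw : v ∈ W
    · exact Finset.mem_union_left _ hw
    · exact Finset.mem_union_right _
        (Finset.mem_biUnion.2 ⟨i, hi, Finset.mem_sdiff.2 ⟨hvi, hw⟩⟩)
  have h3 : (J.biUnion fun i => V i \ W).card ≤ J.card * (μ - 1) :=
    Finset.card_biUnion_le_card_mul _ _ _ fun i hi => by
      have := (Finset.mem_filter.1 (hJ hi)).2
      omega
  have h4 := (Finset.card_le_card h2).trans (Finset.card_union_le _ _)
  rw [hJh] at h3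
  obtain ⟨μ, rfl⟩ : ∃ x, μ = x + 1 := ⟨μ - 1, by omega⟩
  rw [Nat.add_sub_cancel] at h3
  nlinarith

theorem card_offDiag_ge (A B : Finset α) :
    A.card * (B.card - 1) ≤ ((A ×ˢ B).filter fun p => p.1 ≠ p.2).card := by
  have e : ((A ×ˢ B).filter fun p => p.1 ≠ p.2) = A.biUnion fun u => (B.erase u).image (Prod.mk u)
      := by
    ext ⟨u, v⟩
    simp only [Finset.mem_filter, Finset.mem_product, Finset.mem_biUnion, Finset.mem_image,
      Finset.mem_erase, Prod.mk.injEq]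
    constructor
    · rintro ⟨⟨h1, h2⟩, h3⟩
      exact ⟨u, h1, v, ⟨Ne.symm h3, h2⟩, rfl, rfl⟩
    · rintro ⟨u', h1, v', ⟨h2, h3⟩, rfl, rfl⟩
      exact ⟨⟨h1, h3⟩, Ne.symm h2⟩
  rw [e, Finset.card_biUnion]
  · rw [← smul_eq_mul, ← Finset.sum_const]
    refine Finset.sum_le_sum fun u _ => ?_
    rw [Finset.card_image_of_injective _ (Prod.mk_right_injective u)]
    exact Finset.pred_card_le_card_erase
  · intro u _ u' _ hne
    rw [Function.onFun, Finset.disjoint_left]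
    intro p hp hp'
    obtain ⟨v, _, rfl⟩ := Finset.mem_image.1 hp
    obtain ⟨v', _, h⟩ := Finset.mem_image.1 hp'
    exact hne (Prod.ext_iff.1 h).1.symm

/-- Each of the two orientations of the pair leaves at most `d` choices for the first component. -/
theorem card_sym2_fiber_le {κ : Type*} [DecidableEq κ] (X : Finset (κ × (α × α))) (u v : α) {d : ℕ}
    (T : α → α → Finset κ) (hT : ∀ x ∈ X, x.1 ∈ T x.2.1 x.2.2) (hd : ∀ x ∈ X,
      (T x.2.1 x.2.2).card ≤ d) :
    (X.filter fun x => s(x.2.1, x.2.2) = s(u, v)).card ≤ 2 * d := by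
  have key : ∀ u v, (X.filter fun x => x.2 = (u, v)).card ≤ d := by
    intro u v
    rcases Finset.eq_empty_or_nonempty (X.filter fun x => x.2 = (u, v)) with h | ⟨x, hx⟩
    · simp [h]
    · obtain ⟨hx, hxe⟩ := Finset.mem_filter.1 hx
      have h1 := hd x hx
      rw [hxe] at h1
      refine le_trans (Finset.card_le_card_of_injOn Prod.fst ?_ ?_) h1
      · intro x' hx'
        obtain ⟨hx', hxe'⟩ := Finset.mem_filter.1 (Finset.mem_coe.1 hx')
        have := hT x' hx'
        rwa [hxe'] at this
      · intro x' hx' x'' hx'' he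
        have e1 := (Finset.mem_filter.1 (Finset.mem_coe.1 hx')).2
        have e2 := (Finset.mem_filter.1 (Finset.mem_coe.1 hx'')).2
        exact Prod.ext he (e1.trans e2.symm)
  have hsub : (X.filter fun x => s(x.2.1, x.2.2) = s(u, v)) ⊆
      (X.filter fun x => x.2 = (u, v)) ∪ (X.filter fun x => x.2 = (v, u)) := by
    intro x hx
    obtain ⟨hx, he⟩ := Finset.mem_filter.1 hx
    rw [Finset.mem_union, Finset.mem_filter, Finset.mem_filter]
    rcases Sym2.eq_iff.1 he with ⟨h1, h2⟩ | ⟨h1, h2⟩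
    · exact Or.inl ⟨hx, Prod.ext h1 h2⟩
    · exact Or.inr ⟨hx, Prod.ext h1 h2⟩
  have := (Finset.card_le_card hsub).trans (Finset.card_union_le _ _)
  have h1 := key u v
  have h2 := key v u
  omega

/-- Many pairs of members of a spread family have many cross pairs. -/
theorem exists_many_edges [DecidableEq ι] [Fintype α] (V : ι → Finset α) (I : Finset ι) (H : Finset (ι × ι))
    {h μ q c : ℕ} (hh : 0 < h) (hμ : 2 ≤ μ) (hq : 0 < q) (hc : 0 < c) (hI : I.card = 8 * c * h)
    (hV : ∀ i ∈ I, (V i).card ≤ 4 * q * μ)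
    (hspread : ∀ J ⊆ I, J.card = h → 2 * μ * h ≤ (J.biUnion V).card)
    (hH : H ⊆ I ×ˢ I) (hHc : I.card * I.card ≤ 2 * c * H.card) :
    ∃ F : Finset (Sym2 α), (h * μ) ^ 2 ≤ F.card * (256 * c * q ^ 2) ∧
      ∀ x ∈ F, ∃ p ∈ H, ∃ u ∈ V p.1, ∃ v ∈ V p.2, u ≠ v ∧ x = s(u, v) := by
  -- The 8ch members have at most 8ch·4qμ = D·hμ incidences, so at most hμ vertices are heavy, that
  -- is, lie in `D` or more members.
  set D := 32 * c * q with hD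
  set W := Finset.univ.filter fun v => D ≤ (I.filter fun i => v ∈ V i).card with hW
  set B := I.filter fun i => (V i \ W).card < μ with hB
  have hWc : W.card ≤ h * μ := by
    have h1 := card_heavy_mul_le V I (D := D) hV
    rw [← hW, hI, show 8 * c * h * (4 * q * μ) = D * (h * μ) by rw [hD]; ring] at h1
    exact Nat.le_of_mul_le_mul_left h1 (by rw [hD]; positivity)
  have hBc : B.card < h := card_few_outside_lt V I W hh (by omega) hWc hspread
  -- `H` has at least (8ch)²/(2c) = 32ch² pairs, and the fewer than h indices in `B` spoil at most
  -- 2·h·8ch = 16ch² of them.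
  set H' := H.filter fun p => p.1 ∉ B ∧ p.2 ∉ B with hH'
  have hHH' : H.card ≤ H'.card + 2 * (B.card * I.card) := by
    have : H ⊆ H' ∪ (B ×ˢ I ∪ I ×ˢ B) := by
      intro p hp
      have := Finset.mem_product.1 (hH hp)
      simp only [hH', Finset.mem_union, Finset.mem_filter, Finset.mem_product]
      tauto
    have h1 := (Finset.card_le_card this).trans (Finset.card_union_le _ _)
    have h2 := Finset.card_union_le (B ×ˢ I) (I ×ˢ B)
    rw [Finset.card_product, Finset.card_product, mul_comm I.card B.card] at h2
    omega
  have hH'c : 16 * c * h ^ 2 ≤ H'.card := by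
    have h1 : B.card * I.card ≤ h * I.card := Nat.mul_le_mul_right _ hBc.le
    rw [hI] at h1 hHc hHH'
    have h2 : 2 * c * H.card ≤ 2 * c * (H'.card + 2 * (h * (8 * c * h))) := by
      gcongr; omega
    have h3 : 2 * c * (16 * c * h ^ 2) ≤ 2 * c * H'.card := by nlinarith
    exact Nat.le_of_mul_le_mul_left h3 (by positivity)
  -- Every remaining pair of members yields at least μ(μ - 1) ordered pairs of distinct light
  -- vertices. A light vertex lies in at most `D` members, so an edge is counted at most 2D² times.
  set X := H'.biUnion fun p =>
    ((((V p.1 \ W) ×ˢ (V p.2 \ W)).filter fun x => x.1 ≠ x.2).image (Prod.mk p)) with hX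
  have hXmem : ∀ x ∈ X, x.1 ∈ H' ∧ x.2.1 ∈ V x.1.1 \ W ∧ x.2.2 ∈ V x.1.2 \ W ∧
      x.2.1 ≠ x.2.2 := by
    intro x hx
    obtain ⟨p, hp, hx⟩ := Finset.mem_biUnion.1 hx
    obtain ⟨y, hy, rfl⟩ := Finset.mem_image.1 hx
    obtain ⟨hy, hne⟩ := Finset.mem_filter.1 hy
    obtain ⟨h1, h2⟩ := Finset.mem_product.1 hy
    exact ⟨hp, h1, h2, hne⟩
  have hXc : 16 * c * h ^ 2 * (μ * (μ - 1)) ≤ X.card := by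
    rw [hX, Finset.card_biUnion]
    · refine (Nat.mul_le_mul_right _ hH'c).trans ?_
      rw [← smul_eq_mul, ← Finset.sum_const]
      refine Finset.sum_le_sum fun p hp => ?_
      rw [Finset.card_image_of_injective _ (Prod.mk_right_injective p)]
      refine le_trans ?_ (card_offDiag_ge _ _)
      obtain ⟨hp, hp1, hp2⟩ := Finset.mem_filter.1 hp
      obtain ⟨hi1, hi2⟩ := Finset.mem_product.1 (hH hp)
      have g1 : μ ≤ (V p.1 \ W).card := by
        by_contra hcon
        exact hp1 (Finset.mem_filter.2 ⟨hi1, not_le.1 hcon⟩)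
      have g2 : μ ≤ (V p.2 \ W).card := by
        by_contra hcon
        exact hp2 (Finset.mem_filter.2 ⟨hi2, not_le.1 hcon⟩)
      exact Nat.mul_le_mul g1 (by omega)
    · intro p _ p' _ hne
      rw [Function.onFun, Finset.disjoint_left]
      intro x hx hx'
      obtain ⟨v, _, rfl⟩ := Finset.mem_image.1 hx
      obtain ⟨v', _, h⟩ := Finset.mem_image.1 hx'
      exact hne (Prod.ext_iff.1 h).1.symm
  refine ⟨X.image fun x => s(x.2.1, x.2.2), ?_, ?_⟩
  · have hfib := Finset.card_le_mul_card_image (f := fun x => s(x.2.1, x.2.2)) X (2 * (D * D)) ?_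
    · have hμ' : μ ^ 2 ≤ 2 * (μ * (μ - 1)) := by
        obtain ⟨m, rfl⟩ : ∃ x, μ = x + 2 := ⟨μ - 2, by omega⟩
        rw [show m + 2 - 1 = m + 1 by omega]
        nlinarith
      have h1 := hXc.trans hfib
      set Fc := (X.image fun x => s(x.2.1, x.2.2)).card
      have h2 : 8 * c * (h * μ) ^ 2 ≤ 8 * c * (Fc * (256 * c * q ^ 2)) := by
        calc 8 * c * (h * μ) ^ 2 = 8 * c * h ^ 2 * μ ^ 2 := by ring
          _ ≤ 8 * c * h ^ 2 * (2 * (μ * (μ - 1))) := by gcongr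
          _ = 16 * c * h ^ 2 * (μ * (μ - 1)) := by ring
          _ ≤ 2 * (D * D) * Fc := h1
          _ = 8 * c * (Fc * (256 * c * q ^ 2)) := by rw [hD]; ring
      exact Nat.le_of_mul_le_mul_left h2 (by positivity)
    · intro e _
      induction e using Sym2.ind with
      | _ u v =>
        refine card_sym2_fiber_le X u v
          (fun u v => (I.filter fun i => u ∈ V i) ×ˢ (I.filter fun i => v ∈ V i)) ?_ ?_
        · intro x hx
          obtain ⟨h1, h2, h3, _⟩ := hXmem x hx
          obtain ⟨i1, i2⟩ := Finset.mem_product.1 (hH (Finset.mem_filter.1 h1).1)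
          exact Finset.mem_product.2 ⟨Finset.mem_filter.2 ⟨i1, (Finset.mem_sdiff.1 h2).1⟩,
            Finset.mem_filter.2 ⟨i2, (Finset.mem_sdiff.1 h3).1⟩⟩
        · intro x hx
          obtain ⟨_, h2, h3, _⟩ := hXmem x hx
          have g : ∀ v, v ∉ W → (I.filter fun i => v ∈ V i).card ≤ D := by
            intro v hv
            by_contra hcon
            exact hv (Finset.mem_filter.2 ⟨Finset.mem_univ _, by omega⟩)
          rw [Finset.card_product]
          exact Nat.mul_le_mul (g _ (Finset.mem_sdiff.1 h2).2) (g _ (Finset.mem_sdiff.1 h3).2)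
  · intro e he
    obtain ⟨x, hx, rfl⟩ := Finset.mem_image.1 he
    obtain ⟨h1, h2, h3, h4⟩ := hXmem x hx
    exact ⟨x.1, (Finset.mem_filter.1 h1).1, x.2.1, (Finset.mem_sdiff.1 h2).1, x.2.2,
      (Finset.mem_sdiff.1 h3).1, h4, rfl⟩

end Spread

/-! ### Random graphs and random tuples. -/

instance discreteMeasurableSpace_simpleGraph (V : Type*) [Finite V] :
    DiscreteMeasurableSpace (SimpleGraph V) := by
  have : MeasurableSingletonClass (SimpleGraph V) := ⟨fun G => by
    have h : MeasurableSet ({G.edgeSet} : Set (Set (Sym2 V))) := MeasurableSet.singleton _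
    have h2 := SimpleGraph.measurableEmbedding_edgeSet.measurable h
    convert h2 using 1
    ext G'
    simp⟩
  infer_instance

instance (n : ℕ) : IsProbabilityMeasure (erdosRenyiHalf n) := by
  rw [erdosRenyiHalf]
  infer_instance

/-- The probability that a random graph contains a given set of edges. -/
theorem erdosRenyiHalf_subset_edgeSet_le {n : ℕ} (F : Finset (Sym2 (Fin n))) :
    erdosRenyiHalf n {G | ∀ x ∈ F, x ∈ G.edgeSet} ≤ 2⁻¹ ^ F.card := by
  rw [erdosRenyiHalf, SimpleGraph.binomialRandom_apply]
  refine (measure_mono (t := (F : Set (Sym2 (Fin n))).pi fun _ => {True}) ?_).trans ?_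
  · rintro _ ⟨G, hG, rfl⟩ x hx
    simpa using hG x hx
  · rw [Measure.infinitePi_pi _ fun _ _ => MeasurableSet.singleton _, ← Finset.prod_const]
    refine Finset.prod_le_prod' fun x _ => ?_
    have h : unitInterval.toNNReal ⟨2⁻¹, by norm_num, by norm_num⟩ = (2⁻¹ : NNReal) := by
      ext; simp
    simp only [Measure.coe_add, Pi.add_apply, Measure.smul_apply]
    simp [Set.indicator]
    simp [h]
    split_ifs <;> simp

/-- Reduction modulo `n` maps at most two numbers below 2n to each vertex, so the non-uniform
sampling costs at most a factor 2. -/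
theorem card_ofNat_mem_le {n R : ℕ} [NeZero n] (hR : R ≤ 2 * n) (U : Finset (Fin n)) :
    (Finset.univ.filter fun x : Fin R => Fin.ofNat n x ∈ U).card ≤ 2 * U.card := by
  classical
  set X : Finset (Fin R) := Finset.univ.filter fun x : Fin R => Fin.ofNat n x ∈ U with hX
  refine Finset.card_le_mul_card_image_of_maps_to (f := fun x : Fin R => Fin.ofNat n x)
    (fun x hx => (Finset.mem_filter.1 hx).2) 2 fun v _ => ?_
  have hinj : Set.InjOn (fun x : Fin R => (x : ℕ) / n)
      (X.filter fun x : Fin R => Fin.ofNat n x = v : Finset (Fin R)) := by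
    intro x hx y hy hxy
    have h1 : (x : ℕ) % n = v := congrArg Fin.val (Finset.mem_filter.1 (Finset.mem_coe.1 hx)).2
    have h2 : (y : ℕ) % n = v := congrArg Fin.val (Finset.mem_filter.1 (Finset.mem_coe.1 hy)).2
    have hxy : (x : ℕ) / n = y / n := hxy
    apply Fin.ext
    rw [← Nat.div_add_mod x n, ← Nat.div_add_mod y n, h1, h2, hxy]
  refine (Finset.card_le_card_of_injOn (t := Finset.range 2) _ ?_ hinj).trans (by simp)
  intro x _
  rw [Finset.coe_range, Set.mem_Iio, Nat.div_lt_iff_lt_mul (Nat.pos_of_ne_zero (NeZero.ne n))]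
  exact x.2.trans_le hR

/-- The set of vertices of a tuple of numbers. -/
def tupleSet (n : ℕ) [NeZero n] {l R : ℕ} (z : Fin l → Fin R) : Finset (Fin n) :=
  Finset.univ.image fun a => Fin.ofNat n (z a)

theorem card_tupleSet_le (n : ℕ) [NeZero n] {l R : ℕ} (z : Fin l → Fin R) :
    (tupleSet n z).card ≤ l :=
  Finset.card_image_le.trans (by simp)

/-- Every `h` tuples contain together at least `m` vertices. -/
def IsSpread (n : ℕ) [NeZero n] {N l R : ℕ} (z : Fin N → Fin l → Fin R) (h m : ℕ) : Prop :=
  ∀ I : Finset (Fin N), I.card = h → m ≤ (I.biUnion fun i => tupleSet n (z i)).card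

/-- A finset with at most `m` elements is contained in the range of a sequence of length `m`. -/
theorem exists_subset_image_fin {α : Type*} [DecidableEq α] [Nonempty α] (U : Finset α) {m : ℕ}
    (h : U.card ≤ m) : ∃ u : Fin m → α, U ⊆ Finset.univ.image u := by
  classical
  refine ⟨fun i => if hi : (i : ℕ) < U.card then U.equivFin.symm ⟨i, hi⟩
    else Classical.arbitrary α, fun v hv => ?_⟩
  rw [Finset.mem_image]
  refine ⟨⟨U.equivFin ⟨v, hv⟩, (U.equivFin ⟨v, hv⟩).2.trans_le h⟩, Finset.mem_univ _, ?_⟩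
  simp

-- Union bound: choose `h` indices, in at most N^h ways, and `m` vertices that contain all entries
-- of their tuples, in at most n^m ways. Each of these entries then has at most 2m possible values.
open Classical in
theorem card_not_isSpread_le {n N l R h m : ℕ} [NeZero n] (hR : R ≤ 2 * n) :
    (Finset.univ.filter fun z : Fin N → Fin l → Fin R => ¬ IsSpread n z h m).card ≤
      N ^ h * (n ^ m * (((2 * m) ^ l) ^ h * (R ^ l) ^ (N - h))) := by
  have hsub : (Finset.univ.filter fun z : Fin N → Fin l → Fin R => ¬ IsSpread n z h m) ⊆
      ((Finset.univ : Finset (Fin N)).powersetCard h).biUnion fun I =>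
        (Finset.univ : Finset (Fin m → Fin n)).biUnion fun u =>
          Finset.univ.filter fun z : Fin N → Fin l → Fin R => ∀ i ∈ I, z i ∈
            Fintype.piFinset fun _ => Finset.univ.filter fun x : Fin R =>
              Fin.ofNat n x ∈ Finset.univ.image u := by
    intro z hz
    have hz := (Finset.mem_filter.1 hz).2
    rw [IsSpread] at hz
    push Not at hz
    obtain ⟨I, hI, hlt⟩ := hz
    obtain ⟨u, hu⟩ := exists_subset_image_fin _ hlt.le
    refine Finset.mem_biUnion.2 ⟨I, Finset.mem_powersetCard.2 ⟨Finset.subset_univ _, hI⟩,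
      Finset.mem_biUnion.2 ⟨u, Finset.mem_univ _, Finset.mem_filter.2 ⟨Finset.mem_univ _, ?_⟩⟩⟩
    intro i hi
    refine Fintype.mem_piFinset.2 fun a => Finset.mem_filter.2 ⟨Finset.mem_univ _, hu (Finset.mem_biUnion.2 ⟨i, hi, ?_⟩)⟩
    exact Finset.mem_image.2 ⟨a, Finset.mem_univ _, rfl⟩
  refine (Finset.card_le_card hsub).trans ?_
  refine (Finset.card_biUnion_le_card_mul _ _
    (n ^ m * (((2 * m) ^ l) ^ h * (R ^ l) ^ (N - h))) fun I hI => ?_).trans ?_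
  · have hI := (Finset.mem_powersetCard.1 hI).2
    refine (Finset.card_biUnion_le_card_mul _ _
      (((2 * m) ^ l) ^ h * (R ^ l) ^ (N - h)) fun u _ => ?_).trans ?_
    · rw [card_forall_mem, hI, Fintype.card_piFinset_const, Fintype.card_pi_const,
        Fintype.card_fin]
      have h1 := card_ofNat_mem_le hR (Finset.univ.image u)
      have h2 : (Finset.univ.image u).card ≤ m := by
        simpa using (Finset.card_image_le (s := Finset.univ) (f := u))
      gcongr
      omega
    · simp
  · rw [Finset.card_powersetCard, Finset.card_univ, Fintype.card_fin]
    exact Nat.mul_le_mul_right _ (Nat.choose_le_pow N h)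

/-- For spread tuples, the product graph of a random graph is unlikely to contain a dense set. -/
theorem erdosRenyiHalf_exists_isDenseSet_le {n N R h μ q c f : ℕ} [NeZero n]
    {z : Fin N → Fin (4 * q * μ) → Fin R} (hz : IsSpread n z h (2 * μ * h))
    (hh : 0 < h) (hμ : 2 ≤ μ) (hq : 0 < q) (hc : 0 < c)
    (hf : f * (256 * c * q ^ 2) ≤ (h * μ) ^ 2) :
    erdosRenyiHalf n {G | ∃ S, IsDenseSet (tupleGraph G fun i a => Fin.ofNat n (z i a)) (2 * c)
      (8 * c * h) S} ≤ N ^ (8 * c * h) * (2 ^ (8 * c * h) ^ 2 * 2⁻¹ ^ f) := by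
  classical
  set k := 8 * c * h with hk
  -- Union bound over the k-set `I` and the set `H` of its adjacent pairs, at most N^k · 2^(k²)
  -- choices. For fixed `I` and `H` the edges forced in `G` are determined by the tuples.
  have hsub : {G : SimpleGraph (Fin n) | ∃ S,
      IsDenseSet (tupleGraph G fun i a => Fin.ofNat n (z i a)) (2 * c) k S} ⊆
      ⋃ I ∈ (Finset.univ : Finset (Fin N)).powersetCard k, ⋃ H ∈ (I ×ˢ I).powerset,
        {G | k * k ≤ 2 * c * H.card ∧
          ∀ p ∈ H, (tupleGraph G fun i a => Fin.ofNat n (z i a)).Adj p.1 p.2} := by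
    rintro G ⟨S, hS, hd⟩
    rw [adjPairs] at hd
    refine Set.mem_biUnion (Finset.mem_powersetCard.2 ⟨Finset.subset_univ _, hS⟩)
      (Set.mem_biUnion (Finset.mem_powerset.2 (Finset.filter_subset _ _)) ⟨hd, fun p hp => ?_⟩)
    exact (Finset.mem_filter.1 hp).2
  refine (measure_mono hsub).trans ?_
  refine (measure_biUnion_finset_le _ _).trans ?_
  refine (Finset.sum_le_card_nsmul _ _ (2 ^ k ^ 2 * 2⁻¹ ^ f) fun I hI => ?_).trans ?_
  · have hI := (Finset.mem_powersetCard.1 hI).2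
    refine (measure_biUnion_finset_le _ _).trans ?_
    refine (Finset.sum_le_card_nsmul _ _ (2⁻¹ ^ f) fun H hH => ?_).trans ?_
    · by_cases hHc : k * k ≤ 2 * c * H.card
      · obtain ⟨F, hF, hFe⟩ := exists_many_edges (fun i => tupleSet n (z i)) I H hh hμ hq hc hI
          (fun i _ => by simpa using card_tupleSet_le n (z i)) (fun J _ => hz J) (Finset.mem_powerset.1 hH)
          (by rwa [hI])
        have hfF : f ≤ F.card := Nat.le_of_mul_le_mul_right (hf.trans hF) (by positivity)
        refine (measure_mono ?_).trans ((erdosRenyiHalf_subset_edgeSet_le F).trans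
          (pow_le_pow_right_of_le_one' (by simp) hfF))
        rintro G ⟨_, hG⟩ x hx
        obtain ⟨p, hp, u, hu, v, hv, hne, rfl⟩ := hFe x hx
        obtain ⟨a, _, rfl⟩ := Finset.mem_image.1 hu
        obtain ⟨b, _, rfl⟩ := Finset.mem_image.1 hv
        exact ((hG p hp).2 a b).resolve_left hne
      · have : {G : SimpleGraph (Fin n) | k * k ≤ 2 * c * H.card ∧
            ∀ p ∈ H, (tupleGraph G fun i a => Fin.ofNat n (z i a)).Adj p.1 p.2} = ∅ := by
          ext G
          simp [hHc]
        rw [this, measure_empty]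
        exact zero_le
    · rw [Finset.card_powerset, Finset.card_product, hI, nsmul_eq_mul, sq]
      push_cast
      rfl
  · rw [Finset.card_powersetCard, Finset.card_univ, Fintype.card_fin, nsmul_eq_mul]
    gcongr
    exact_mod_cast Nat.choose_le_pow N k

namespace RAM

/-! ### The choice of parameters and the soundness of a trial. -/

/-- The parameters of the distinguisher for the approximation factor `c` and cliques with more
than `n ^ (2 / q)` vertices. -/
def params (c q : ℕ) : Params where
  expo := 4 * (q - 1)
  len := 4 * q
  lam := 2 ^ 15 * c ^ 2 * q ^ 3
  mult := 8 * c
  dens := 2 * c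
  mu0 := 2 ^ 8 * c ^ 2 * q

/-- The forced edges have to pay for the choice of k = 8ch out of N ≤ 2^(b·4qμ) tuples, for the k²
bits of their adjacencies, and for a final factor 2^(-b) ≤ 1/n. Each term takes at most a quarter of
(hμ)²; the first dictates the constant `lam` and the second the constant `mu0`. -/
theorem edge_bound {c q h μ b : ℕ} (hc : 0 < c) (hq : 0 < q) (hμ : 2 ^ 8 * c ^ 2 * q ≤ μ)
    (hb : 2 ^ 15 * c ^ 2 * q ^ 3 * b ≤ h * μ) :
    (b * (4 * q * μ) * (8 * c * h) + (8 * c * h) ^ 2 + b) * (256 * c * q ^ 2) ≤ (h * μ) ^ 2 := by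
  have hcq : c ≤ c ^ 2 := Nat.le_self_pow (by norm_num) c
  have hqq : q ^ 2 ≤ q ^ 3 := Nat.pow_le_pow_right hq (by norm_num)
  have h1 : 4 * (b * (4 * q * μ) * (8 * c * h) * (256 * c * q ^ 2)) ≤ (h * μ) ^ 2 := by
    calc 4 * (b * (4 * q * μ) * (8 * c * h) * (256 * c * q ^ 2))
        = 2 ^ 15 * c ^ 2 * q ^ 3 * b * (h * μ) := by ring
      _ ≤ h * μ * (h * μ) := by gcongr
      _ = _ := by ring
  have h2 : 4 * ((8 * c * h) ^ 2 * (256 * c * q ^ 2)) ≤ (h * μ) ^ 2 := by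
    have : c ^ 3 ≤ c ^ 4 := Nat.pow_le_pow_right hc (by norm_num)
    calc 4 * ((8 * c * h) ^ 2 * (256 * c * q ^ 2)) = h ^ 2 * (2 ^ 16 * c ^ 3 * q ^ 2) := by ring
      _ ≤ h ^ 2 * (2 ^ 16 * c ^ 4 * q ^ 2) := by gcongr
      _ = h ^ 2 * (2 ^ 8 * c ^ 2 * q) ^ 2 := by ring
      _ ≤ h ^ 2 * μ ^ 2 := by gcongr
      _ = _ := by ring
  have h3 : 4 * (b * (256 * c * q ^ 2)) ≤ (h * μ) ^ 2 := by
    calc 4 * (b * (256 * c * q ^ 2)) ≤ 4 * (b * (256 * c ^ 2 * q ^ 3)) := by gcongr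
      _ = 2 ^ 10 * c ^ 2 * q ^ 3 * b := by ring
      _ ≤ 2 ^ 15 * c ^ 2 * q ^ 3 * b := by gcongr <;> norm_num
      _ ≤ h * μ := hb
      _ ≤ (h * μ) ^ 2 := Nat.le_self_pow (by norm_num) _
  rw [add_mul, add_mul]
  omega

/-- The tuples are independent of the graph, so the integral can be taken for fixed tuples first.
Tuples that are not spread contribute at most 1/n, and spread ones have a dense set with probability
at most 1/n. -/
theorem lintegral_denseProb_le {n μ q c : ℕ} [NeZero n] (hq : 2 ≤ q) (hc : 0 < c) (hn : 2 ≤ n)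
    (hμ : (params c q).mu0 ≤ μ)
    (hsmall : (4 * (μ * ((params c q).lam * Nat.clog 2 n ⌈/⌉ μ))) ^ (4 * q) ≤ n) :
    ∫⁻ G, denseProb (params c q) G μ ∂erdosRenyiHalf n ≤ 2 * (n : ℝ≥0∞)⁻¹ := by
  classical
  set P := params c q with hP
  set b := Nat.clog 2 n with hb
  set R := 2 ^ b with hRdef
  set N := P.size n μ with hN
  set h := P.lam * b ⌈/⌉ μ with hh
  have hlen : P.len * μ = 4 * q * μ := rfl
  have hsub : P.sub n μ = 8 * c * h := rfl
  have hdens : P.dens = 2 * c := rfl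
  have hR : n ≤ R := Nat.le_pow_clog (by norm_num) n
  have hR2 : R ≤ 2 * n := two_pow_clog_le hn
  have hμ' : 2 ^ 8 * c ^ 2 * q ≤ μ := hμ
  have hcq : 0 < c ^ 2 * q := by positivity
  have hμ2 : 2 ≤ μ := by
    have : 2 ^ 8 * c ^ 2 * q = 2 ^ 8 * (c ^ 2 * q) := by ring
    omega
  have hb0 : 0 < b := Nat.clog_pos (by norm_num) hn
  have hbh : 2 ^ 15 * c ^ 2 * q ^ 3 * b ≤ h * μ := by
    have : P.lam * b ≤ μ • h := le_smul_ceilDiv (by omega)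
    rwa [smul_eq_mul, mul_comm μ] at this
  have hhμ : 0 < h * μ := lt_of_lt_of_le (by positivity) hbh
  have hh0 : 0 < h := Nat.pos_of_mul_pos_right hhμ
  set l := 4 * q * μ with hl
  let Q : (Fin N → Fin l → Fin R) → SimpleGraph (Fin n) → Prop := fun z G =>
    ∃ S, IsDenseSet (tupleGraph G fun i a => Fin.ofNat n (z i a)) (2 * c) (8 * c * h) S
  have hdp : ∀ G, denseProb P G μ =
      (∑ z : Fin N → Fin l → Fin R, if Q z G then (1 : ℝ≥0∞) else 0) / (R : ℝ≥0∞) ^ (N * l) := by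
    intro G
    rw [denseProb]
    congr 1
    · exact Fintype.sum_equiv (tuplesEquiv N l (Fin R)) _ _ fun r => rfl
    · rw [hRdef]; push_cast; rfl
  have hind : ∀ z, ∫⁻ G, (if Q z G then (1 : ℝ≥0∞) else 0) ∂erdosRenyiHalf n =
      erdosRenyiHalf n {G | Q z G} := by
    intro z
    rw [← lintegral_indicator_one (MeasurableSet.of_discrete)]
    exact lintegral_congr fun G => by simp [Set.indicator]
  have hspr : ∀ z, IsSpread n z h (2 * μ * h) →
      erdosRenyiHalf n {G | Q z G} ≤ (n : ℝ≥0∞)⁻¹ := by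
    intro z hz
    refine (erdosRenyiHalf_exists_isDenseSet_le hz hh0 hμ2 (by omega) hc
      (edge_bound hc (by omega) hμ' hbh)).trans ?_
    have hN2 : N ≤ 2 ^ (b * (4 * q * μ)) := by
      calc N = n ^ (4 * (q - 1) * μ) := rfl
        _ ≤ R ^ (4 * (q - 1) * μ) := Nat.pow_le_pow_left hR _
        _ ≤ R ^ (4 * q * μ) := Nat.pow_le_pow_right (by omega)
            (Nat.mul_le_mul_right _ (by omega))
        _ = _ := by rw [hRdef, ← pow_mul]
    have hN3 : (N : ℝ≥0∞) ≤ 2 ^ (b * (4 * q * μ)) := by exact_mod_cast hN2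
    have hRn : (n : ℝ≥0∞) ≤ 2 ^ b := by exact_mod_cast hR
    calc (N : ℝ≥0∞) ^ (8 * c * h) * (2 ^ (8 * c * h) ^ 2 *
          2⁻¹ ^ (b * (4 * q * μ) * (8 * c * h) + (8 * c * h) ^ 2 + b))
        ≤ (2 ^ (b * (4 * q * μ))) ^ (8 * c * h) * (2 ^ (8 * c * h) ^ 2 *
          2⁻¹ ^ (b * (4 * q * μ) * (8 * c * h) + (8 * c * h) ^ 2 + b)) := by gcongr
      _ = (2 * 2⁻¹) ^ (b * (4 * q * μ) * (8 * c * h)) * ((2 * 2⁻¹) ^ (8 * c * h) ^ 2 *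
          2⁻¹ ^ b) := by
          rw [← pow_mul, pow_add, pow_add, mul_pow, mul_pow]; ring
      _ = (2 ^ b)⁻¹ := by
          rw [ENNReal.mul_inv_cancel (by norm_num) (by norm_num), one_pow, one_pow, one_mul,
            one_mul, ENNReal.inv_pow]
      _ ≤ _ := ENNReal.inv_le_inv.2 hRn
  have hcnt : (Finset.univ.filter fun z : Fin N → Fin l → Fin R =>
      ¬ IsSpread n z h (2 * μ * h)).card * n ≤ R ^ (N * l) := by
    have hhN : h ≤ N ∨ N < h := le_or_gt h N
    rcases hhN with hhN | hhN
    · refine (Nat.mul_le_mul_right n (card_not_isSpread_le hR2)).trans ?_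
      have e1 : N ^ h = n ^ (4 * (q - 1) * μ * h) := by
        rw [pow_mul]; rfl
      have e2 : ((2 * (2 * μ * h)) ^ l) ^ h ≤ n ^ (μ * h) := by
        calc ((2 * (2 * μ * h)) ^ l) ^ h = ((4 * (μ * h)) ^ (4 * q)) ^ (μ * h) := by
              rw [← pow_mul, ← pow_mul, hl]; congr 1 <;> ring
          _ ≤ n ^ (μ * h) := Nat.pow_le_pow_left hsmall _
      -- The exponents of n come from the choice of the tuples, the choice of the covering vertices,
      -- the (4μh)^(lh) values of the entries, and the desired gain 1/n. They fit because 4q - 1 <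
      -- 4q and hμ ≥ 1.
      have e3 : 4 * (q - 1) * μ * h + 2 * μ * h + μ * h + 1 ≤ l * h := by
        rw [hl]
        obtain ⟨q, rfl⟩ : ∃ x, q = x + 1 := ⟨q - 1, by omega⟩
        rw [Nat.add_sub_cancel]
        nlinarith
      calc N ^ h * (n ^ (2 * μ * h) * (((2 * (2 * μ * h)) ^ l) ^ h * (R ^ l) ^ (N - h))) * n
          ≤ n ^ (4 * (q - 1) * μ * h) * (n ^ (2 * μ * h) * (n ^ (μ * h) * (R ^ l) ^ (N - h))) * n
              := by rw [e1]; gcongr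
        _ = n ^ (4 * (q - 1) * μ * h + 2 * μ * h + μ * h + 1) * (R ^ l) ^ (N - h) := by ring
        _ ≤ n ^ (l * h) * (R ^ l) ^ (N - h) := by gcongr; omega
        _ ≤ R ^ (l * h) * (R ^ l) ^ (N - h) := by gcongr
        _ = R ^ (N * l) := by
            rw [← pow_mul R, ← pow_add, ← mul_add, Nat.add_sub_cancel' hhN, mul_comm]
    · rw [Finset.filter_false_of_mem, Finset.card_empty, zero_mul]
      · exact Nat.zero_le _
      · intro z _
        rw [not_not]
        intro I hI
        have := Finset.card_le_univ I
        rw [Fintype.card_fin] at this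
        omega
  have hRpos : (R : ℝ≥0∞) ^ (N * l) ≠ 0 := by
    have : R ≠ 0 := by omega
    positivity
  have hRtop : (R : ℝ≥0∞) ^ (N * l) ≠ ⊤ := by finiteness
  have hsum : ∑ z : Fin N → Fin l → Fin R, erdosRenyiHalf n {G | Q z G} ≤
      2 * (n : ℝ≥0∞)⁻¹ * (R : ℝ≥0∞) ^ (N * l) := by
    calc ∑ z : Fin N → Fin l → Fin R, erdosRenyiHalf n {G | Q z G}
        ≤ ∑ z : Fin N → Fin l → Fin R, ((n : ℝ≥0∞)⁻¹ +
          if ¬ IsSpread n z h (2 * μ * h) then 1 else 0) := by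
          refine Finset.sum_le_sum fun z _ => ?_
          by_cases hz : IsSpread n z h (2 * μ * h)
          · exact (hspr z hz).trans le_self_add
          · rw [if_pos hz]
            exact prob_le_one.trans le_add_self
      _ = (R : ℝ≥0∞) ^ (N * l) * (n : ℝ≥0∞)⁻¹ + (Finset.univ.filter fun z :
          Fin N → Fin l → Fin R => ¬ IsSpread n z h (2 * μ * h)).card := by
          rw [Finset.sum_add_distrib, Finset.sum_boole, Finset.sum_const, nsmul_eq_mul,
            Finset.card_univ, Fintype.card_pi_const, Fintype.card_pi_const, Fintype.card_fin,
            ← pow_mul, mul_comm l N]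
          push_cast
          rfl
      _ ≤ (R : ℝ≥0∞) ^ (N * l) * (n : ℝ≥0∞)⁻¹ + (R : ℝ≥0∞) ^ (N * l) * (n : ℝ≥0∞)⁻¹ := by
          gcongr
          rw [← div_eq_mul_inv, ENNReal.le_div_iff_mul_le (by simp [NeZero.ne n]) (by simp)]
          exact_mod_cast hcnt
      _ = _ := by ring
  simp only [hdp, div_eq_mul_inv]
  rw [lintegral_mul_const _ .of_discrete, lintegral_finsetSum _ fun _ _ => .of_discrete]
  simp only [hind]
  rw [← div_eq_mul_inv, ENNReal.div_le_iff hRpos hRtop]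
  exact hsum

/-! ### Running time and error bounds for fixed n. -/

/-- The number `n` of vertices is large compared to the constants `c`, `q` and `a` and to its
logarithm. -/
structure IsLarge (c q a n : ℕ) : Prop where
  large : 400 ≤ n
  clock : a ≤ n
  two_pow : 2 ^ (4 * q) ≤ n
  lam : 48 * c * ((params c q).lam * Nat.clog 2 n) ≤ n
  small : (4 * (((params c q).lam + 1) * Nat.clog 2 n)) ^ (4 * q) ≤ n
  poly : 6 * (Nat.clog 2 n + 1) ^ 4 ≤ n

theorem trialCost_poly_le {Y : ℕ} (hY : 400 ≤ Y) :
    (Y ^ 2 * (Y * 4 + 10) + Y ^ 2 * 4 + Y * 4 + 23) + (Y * Y ^ 2 * (Y * 6 + 11) + 3) +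
      (Y * (Y * (Y ^ 2 * (Y ^ 2 * 4 + 6) + 16) + 10) + 17) + Y * (Y + 2) +
      (Y * (Y * 8 + 8) + 20) + 4 ≤ Y ^ 7 := by
  have h0 : 1 ≤ Y := by omega
  have h (i : ℕ) (hi : i ≤ 6) : Y ^ i ≤ Y ^ 6 := Nat.pow_le_pow_right h0 hi
  have h7 : 400 * Y ^ 6 ≤ Y ^ 7 := by
    rw [pow_succ' Y 6]
    gcongr
  have e0 := h 0 (by norm_num)
  have e1 := h 1 (by norm_num)
  have e2 := h 2 (by norm_num)
  have e3 := h 3 (by norm_num)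
  have e4 := h 4 (by norm_num)
  have e5 := h 5 (by norm_num)
  ring_nf at *
  omega

theorem trialCost_le {c q n j μ J : ℕ} {A : Prog} (hq : 0 < q) (hc : 0 < c)
    (hn : IsLarge c q A.clockCost n) (hj : j ≤ J) (hμ : μ ≤ J) (hJ : J ≤ Nat.clog 2 n) :
    trialCost (params c q) A n j μ ≤ n ^ (7 * (4 * q * J + 1)) := by
  set Y := n ^ (4 * q * J + 1) with hYdef
  have hn0 := hn.large
  have hYJ : ∀ i, i ≤ 4 * q * J + 1 → n ^ i ≤ Y := fun i hi =>
    Nat.pow_le_pow_right (by omega) hi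
  have hnY : n ≤ Y := by simpa using hYJ 1 (by omega)
  have hb : Nat.clog 2 n ≤ n := by
    have h1 := hn.poly
    have h2 := Nat.le_self_pow (n := 4) (by norm_num) (Nat.clog 2 n + 1)
    omega
  have hb1 : 1 ≤ Nat.clog 2 n := Nat.clog_pos (by norm_num) (by omega)
  have hq4 : 4 * q ≤ n := (Nat.lt_two_pow_self).le.trans hn.two_pow
  have hqJ : 4 * q * J ≤ Y ^ 2 := by
    rw [sq]
    exact Nat.mul_le_mul (hq4.trans hnY) (hJ.trans (hb.trans hnY))
  have h1 : (params c q).expo * μ + j ≤ Y ^ 2 := by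
    refine le_trans ?_ hqJ
    calc (params c q).expo * μ + j ≤ 4 * (q - 1) * J + J := by
          gcongr; exact le_rfl
      _ ≤ 4 * (q - 1) * J + 4 * J := by omega
      _ = 4 * q * J := by
          obtain ⟨q, rfl⟩ : ∃ x, q = x + 1 := ⟨q - 1, by omega⟩
          rw [Nat.add_sub_cancel]; ring
  have h2 : (params c q).lam * Nat.clog 2 n ≤ Y ^ 2 := by
    have g1 := hn.lam
    have g2 : (params c q).lam * Nat.clog 2 n ≤ 48 * c * ((params c q).lam * Nat.clog 2 n) :=
      Nat.le_mul_of_pos_left _ (by positivity)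
    have g3 := Nat.le_self_pow (n := 2) (by norm_num) Y
    omega
  have h3 : (params c q).size n μ ≤ Y := hYJ _ (by
    have : (params c q).expo * μ ≤ 4 * q * J :=
      Nat.mul_le_mul (show 4 * (q - 1) ≤ 4 * q by omega) hμ
    omega)
  have h4 : (params c q).len * μ ≤ Y ^ 2 :=
    (Nat.mul_le_mul_left (4 * q) hμ).trans hqJ
  have h5 : n ^ j ≤ Y := hYJ _ (by nlinarith)
  have h6 := hb.trans hnY
  have h7 := hn.clock.trans hnY
  rw [mul_comm, pow_mul, ← hYdef]
  refine le_trans ?_ (trialCost_poly_le (hn0.trans hnY))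
  rw [trialCost]
  gcongr

/-- The budget of the distinguisher: the first stage at which the program `A` is certain to halt
for some width. -/
def IsBudget (c q : ℕ) (f e : ℕ → ℝ) (n J : ℕ) : Prop :=
  ∃ M, (params c q).mu0 ≤ M ∧ M ≤ J ∧
    f ((params c q).sub n M) * ((params c q).size n M : ℝ) ^ e ((params c q).sub n M) ≤ (n : ℝ) ^ J

theorem stagesLeft_add_one_le {J μ₀ b : ℕ} (hJ : J ≤ b) :
    stagesLeft J μ₀ μ₀ + 1 ≤ (b + 1) ^ 2 := by
  have h1 : (J - μ₀) * (J + 1) ≤ b * (b + 1) := Nat.mul_le_mul (by omega) (by omega)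
  rw [stagesLeft]
  nlinarith [Nat.sub_le J μ₀]

section FixedSize

variable {A : Prog} {f e : ℕ → ℝ} {C : ℝ} {c q n J : ℕ}

/-- The combined analysis of the distinguisher. -/
theorem wp_mainProg_params_le [NeZero n] (hA : RunsInTimeDkS A f e)
    (hA' : ApproximatesDkSPerfectCompleteness A C) (hC : C ≤ c) (hc : 0 < c) (hq : 2 ≤ q)
    (hn : IsLarge c q A.clockCost n) (hJ : J ≤ Nat.clog 2 n) (hB : IsBudget c q f e n J)
    {G : SimpleGraph (Fin n)} {Φ : Store → ℝ≥0∞} {u w β : ℝ≥0∞}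
    (hacc : ∀ s, s vDone 0 = 1 → s aOut 0 = 1 → Φ s ≤ u)
    (hrej : ∀ s, s vDone 0 = 1 → s aOut 0 = 0 → Φ s ≤ w)
    (hβ : ∀ μ, (params c q).mu0 ≤ μ → μ ≤ J →
      u * denseProb (params c q) G μ ≤ u * β)
    (hcl : ∀ μ, (params c q).mu0 ≤ μ → μ ≤ J →
      w * (3⁻¹ + noCliqueProb (params c q) G μ) ≤ w * 2⁻¹) :
    wp (fun _ => Φ) (n ^ (9 * (4 * q * J + 1))) [mainProg (params c q) A] (input G 0) ≤
      u * (((Nat.clog 2 n + 1) ^ 3 : ℕ) * β) + w * 3⁻¹ := by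
  set P := params c q with hP
  set b := Nat.clog 2 n with hb
  set Y := n ^ (4 * q * J + 1) with hYdef
  obtain ⟨M, hM0, hMJ, hM⟩ := hB
  have hn0 := hn.large
  have hb1 : 1 ≤ b := Nat.clog_pos (by norm_num) (by omega)
  have hpoly : 6 * (b + 1) ^ 4 ≤ n := hn.poly
  have hmu0 : 0 < P.mu0 := by
    change 0 < 2 ^ 8 * c ^ 2 * q
    positivity
  have hlam : 0 < P.lam := by
    change 0 < 2 ^ 15 * c ^ 2 * q ^ 3
    positivity
  set L := stagesLeft J P.mu0 P.mu0 with hL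
  have hL2 : L + 1 ≤ (b + 1) ^ 2 := stagesLeft_add_one_le hJ
  have hD : L * b + (b - 0) ≤ (b + 1) ^ 3 := by
    calc L * b + (b - 0) = (L + 1) * b := by rw [Nat.sub_zero]; ring
      _ ≤ (b + 1) ^ 2 * (b + 1) := Nat.mul_le_mul hL2 (by omega)
      _ = _ := by ring
  have hnY : n ≤ Y := by
    simpa using Nat.pow_le_pow_right (n := n) (by omega) (show 1 ≤ 4 * q * J + 1 by omega)
  have hbn : (b + 1) ^ 3 ≤ Y := by
    have : (b + 1) ^ 3 ≤ (b + 1) ^ 4 := Nat.pow_le_pow_right (by omega) (by norm_num)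
    omega
  have hsub : ∀ μ, P.mu0 ≤ μ → μ ≤ J → 2 ≤ P.sub n μ ∧ P.sub n μ ≤ P.size n μ := by
    intro μ hμ _
    have hμ0 : 0 < μ := by omega
    have h1 : P.lam * b ⌈/⌉ μ ≤ P.lam * b := by
      refine (ceilDiv_le_iff_le_mul hμ0).2 ?_
      exact Nat.le_mul_of_pos_left _ hμ0
    have h2 : 0 < P.lam * b ⌈/⌉ μ := by
      by_contra hcon
      have := (ceilDiv_le_iff_le_mul hμ0).1 (not_lt.1 hcon)
      rw [mul_zero] at this
      have := Nat.mul_pos hlam hb1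
      omega
    have h3 : P.sub n μ = 8 * c * (P.lam * b ⌈/⌉ μ) := rfl
    refine ⟨?_, ?_⟩
    · rw [h3]
      have : 0 < c * (P.lam * b ⌈/⌉ μ) := Nat.mul_pos hc h2
      rw [mul_assoc]
      omega
    · have h4 : P.sub n μ ≤ n := by
        refine le_trans ?_ hn.lam
        rw [h3]
        exact Nat.mul_le_mul (by omega) h1
      refine h4.trans ?_
      change n ≤ n ^ (4 * (q - 1) * μ)
      refine Nat.le_self_pow ?_ n
      have : 0 < 4 * (q - 1) * μ := Nat.mul_pos (by omega) hμ0
      omega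
  have ht : ((b + 1) ^ 3 * (Y ^ 7 + 1) + 1) + n * 12 + 16 ≤ n ^ (9 * (4 * q * J + 1)) := by
    rw [mul_comm 9, pow_mul, ← hYdef]
    have hY0 : 400 ≤ Y := hn0.trans hnY
    calc ((b + 1) ^ 3 * (Y ^ 7 + 1) + 1) + n * 12 + 16
        ≤ (Y * (Y ^ 7 + 1) + 1) + Y * 12 + 16 := by gcongr
      _ = Y ^ 8 + 13 * Y + 17 := by ring
      _ ≤ Y ^ 8 + 13 * Y ^ 8 + 17 * Y ^ 8 := by
          have h1 : Y ≤ Y ^ 8 := Nat.le_self_pow (by norm_num) Y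
          omega
      _ = 31 * Y ^ 8 := by ring
      _ ≤ Y * Y ^ 8 := by gcongr; omega
      _ = Y ^ 9 := by ring
  refine wp_mainProg_le ht fun t' s' ht' hr hf => ?_
  refine (wp_mainLoop_le hA hA' hC rfl hmu0 (by omega) hM0 hMJ hsub
    (X := Y ^ 7) (fun j μ hj hμ => ?_) hM hacc hrej hβ hcl _ P.mu0 P.mu0 0 t' s' hr hf le_rfl
    le_rfl (hM0.trans hMJ) (fun _ => hM0) hb1 hD ht').trans ?_
  · refine (trialCost_le (by omega) hc hn hj hμ hJ).trans ?_
    rw [mul_comm, pow_mul]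
  · gcongr
    rw [← hL, Nat.sub_zero]
    -- At most `L + 1` ≤ (b + 1)² pairs of stage and width can lead to rejection, each with
    -- probability at most 2^(-b) ≤ 1/n.
    calc 2⁻¹ ^ b + (L : ℝ≥0∞) * 2⁻¹ ^ b = ((L + 1 : ℕ) : ℝ≥0∞) / 2 ^ b := by
          rw [div_eq_mul_inv, ← ENNReal.inv_pow]; push_cast; ring
      _ ≤ 3⁻¹ := by
          rw [ENNReal.div_le_iff (by positivity) (by finiteness), ← ENNReal.div_eq_inv_mul,
            ENNReal.le_div_iff_mul_le (by simp) (by simp)]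
          have h1 : (L + 1) * 3 ≤ 2 ^ b := by
            have g1 : n ≤ 2 ^ b := Nat.le_pow_clog (by norm_num) n
            have g2 : (b + 1) ^ 2 ≤ (b + 1) ^ 4 := Nat.pow_le_pow_right (by omega) (by norm_num)
            omega
          exact_mod_cast h1

/-- With both prices 0 the only content of the bound is that `wp` is finite, which means that the
fuel suffices for all coin tosses. -/
theorem haltsWithin_mainProg (hA : RunsInTimeDkS A f e)
    (hA' : ApproximatesDkSPerfectCompleteness A C) (hC : C ≤ c) (hc : 0 < c) (hq : 2 ≤ q)
    (hn : IsLarge c q A.clockCost n) (hJ : J ≤ Nat.clog 2 n) (hB : IsBudget c q f e n J)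
    (G : SimpleGraph (Fin n)) :
    HaltsWithin (mainProg (params c q) A) (input G 0) ((n ^ (9 * (4 * q * J + 1)) : ℕ) : ℝ) := by
  have : NeZero n := ⟨by have := hn.large; omega⟩
  refine ⟨n ^ (9 * (4 * q * J + 1)), le_rfl, halts_of_wp_lt_top (F := 0) ?_⟩
  refine (wp_mainProg_params_le hA hA' hC hc hq hn hJ hB (u := 0) (w := 0) (β := 0)
    (fun _ _ _ => le_rfl) (fun _ _ _ => le_rfl) (fun _ _ _ => by simp)
    (fun _ _ _ => by simp)).trans_lt ?_
  simp

/-- Only rejection is charged. The failure probability per completed trial is at most 1/3 for an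
error of `A` plus 1/6 for a missing clique. The bound holds for every graph with a large clique, not
just for random ones. -/
theorem two_thirds_le_outputProb (hA : RunsInTimeDkS A f e)
    (hA' : ApproximatesDkSPerfectCompleteness A C) (hC : C ≤ c) (hc : 0 < c) (hq : 2 ≤ q)
    (hn : IsLarge c q A.clockCost n) (hJ : J ≤ Nat.clog 2 n) (hB : IsBudget c q f e n J)
    {G : SimpleGraph (Fin n)} {S : Finset (Fin n)} (hS : G.IsClique S)
    (hSq : n ^ 2 ≤ S.card ^ q) :
    2 / 3 ≤ outputProb (mainProg (params c q) A) (input G 0) accepting := by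
  have : NeZero n := ⟨by have := hn.large; omega⟩
  have h := wp_mainProg_params_le hA hA' hC hc hq hn hJ hB (G := G) (Φ := acceptingᶜ.indicator 1)
    (u := 0) (w := 1) (β := 0) ?_ ?_ (fun _ _ _ => by simp) ?_
  · rw [zero_mul, zero_add, one_mul] at h
    have h1 := (one_le_outputProb_add_wp _ _ _ _).trans (add_le_add_right h _)
    have h2 : (2 / 3 : ℝ≥0∞) + 3⁻¹ = 1 := by
      rw [← one_div, ← ENNReal.add_div, show (2 + 1 : ℝ≥0∞) = 3 by norm_num,
        ENNReal.div_self (by norm_num) (by norm_num)]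
    rw [← h2] at h1
    exact (ENNReal.add_le_add_iff_right (by simp)).1 h1
  · intro s _ hs
    have : s ∈ accepting := hs
    simp [this]
  · intro s _ _
    exact Set.indicator_le_self _ _ _
  · intro μ hμ _
    have hμ0 : 0 < μ := lt_of_lt_of_le (show 0 < 2 ^ 8 * c ^ 2 * q by positivity) hμ
    have h1 := noCliqueProb_le (P := params c q) (μ := μ) hS hq hμ0 rfl rfl hn.two_pow hSq (by
      refine le_trans ?_ hn.lam
      rw [show (params c q).sub n μ = 8 * c * ((params c q).lam * Nat.clog 2 n ⌈/⌉ μ) from rfl,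
        ← mul_assoc, ← mul_assoc]
      exact Nat.mul_le_mul (by omega)
        ((ceilDiv_le_iff_le_mul hμ0).2 (Nat.le_mul_of_pos_left _ hμ0)))
    rw [one_mul, one_mul]
    refine (add_le_add_right h1 _).trans (le_of_eq ?_)
    rw [← ENNReal.toReal_eq_toReal_iff' (by finiteness) (by finiteness),
      ENNReal.toReal_add (by finiteness) (by finiteness)]
    simp
    norm_num

/-- Only acceptance is charged. Which widths are tried depends on the coin tosses, so every trial is
charged for all widths at once: (b + 1)³ trials, at most b + 1 widths and 2/n for each give at most
1/3. -/
theorem lintegral_outputProb_le (hA : RunsInTimeDkS A f e)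
    (hA' : ApproximatesDkSPerfectCompleteness A C) (hC : C ≤ c) (hc : 0 < c) (hq : 2 ≤ q)
    (hn : IsLarge c q A.clockCost n) (hJ : J ≤ Nat.clog 2 n) (hB : IsBudget c q f e n J) :
    ∫⁻ G, outputProb (mainProg (params c q) A) (input G 0) accepting ∂erdosRenyiHalf n ≤ 1 / 3 := by
  have : NeZero n := ⟨by have := hn.large; omega⟩
  set b := Nat.clog 2 n with hb
  set I := (Finset.range (J + 1)).filter fun μ => (params c q).mu0 ≤ μ with hI
  have h (G : SimpleGraph (Fin n)) :
      outputProb (mainProg (params c q) A) (input G 0) accepting ≤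
        ((b + 1) ^ 3 : ℕ) * ∑ μ ∈ I, denseProb (params c q) G μ := by
    refine (outputProb_le_wp _ _ (n ^ (9 * (4 * q * J + 1))) _).trans ?_
    refine (wp_mainProg_params_le hA hA' hC hc hq hn hJ hB (G := G) (u := 1) (w := 0)
      (β := ∑ μ ∈ I, denseProb (params c q) G μ) ?_ ?_ ?_ (fun _ _ _ => by simp)).trans
        (le_of_eq ?_)
    · intro s _ _
      exact Set.indicator_le_self _ _ _
    · intro s _ hs
      have : s ∉ accepting := by
        intro h
        have h : s 2 0 = 1 := h
        have hs : s 2 0 = 0 := hs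
        omega
      simp [this]
    · intro μ hμ hμJ
      gcongr
      exact Finset.single_le_sum (f := fun μ => denseProb (params c q) G μ)
        (fun _ _ => zero_le) (Finset.mem_filter.2 ⟨Finset.mem_range.2 (by omega), hμ⟩)
    · rw [one_mul, zero_mul, add_zero]
  refine (lintegral_mono h).trans ?_
  rw [lintegral_const_mul _ .of_discrete, lintegral_finsetSum _ fun _ _ => .of_discrete]
  have hsum : ∑ μ ∈ I, ∫⁻ G, denseProb (params c q) G μ ∂erdosRenyiHalf n ≤
      (b + 1 : ℕ) * (2 * (n : ℝ≥0∞)⁻¹) := by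
    refine (Finset.sum_le_card_nsmul _ _ (2 * (n : ℝ≥0∞)⁻¹) fun μ hμ => ?_).trans ?_
    · obtain ⟨hμJ, hμ⟩ := Finset.mem_filter.1 hμ
      rw [Finset.mem_range] at hμJ
      have hμ0 : 0 < μ := lt_of_lt_of_le (show 0 < 2 ^ 8 * c ^ 2 * q by positivity) hμ
      refine lintegral_denseProb_le hq hc (by have := hn.large; omega) hμ
        (le_trans (Nat.pow_le_pow_left (Nat.mul_le_mul_left _ ?_) _) hn.small)
      have h1 : μ * ((params c q).lam * Nat.clog 2 n ⌈/⌉ μ) ≤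
          (params c q).lam * Nat.clog 2 n + μ := by
        rw [Nat.ceilDiv_eq_add_pred_div]
        exact (Nat.mul_div_le _ _).trans (by omega)
      rw [add_mul, one_mul]
      omega
    · rw [nsmul_eq_mul]
      gcongr
      refine (Finset.card_filter_le _ _).trans ?_
      rw [Finset.card_range]
      omega
  calc (((b + 1) ^ 3 : ℕ) : ℝ≥0∞) * ∑ μ ∈ I, ∫⁻ G, denseProb (params c q) G μ ∂erdosRenyiHalf n
      ≤ (((b + 1) ^ 3 : ℕ) : ℝ≥0∞) * ((b + 1 : ℕ) * (2 * (n : ℝ≥0∞)⁻¹)) := by gcongr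
    _ = ((2 * (b + 1) ^ 4 : ℕ) : ℝ≥0∞) / n := by
        rw [div_eq_mul_inv]; push_cast; ring
    _ ≤ 1 / 3 := by
        rw [ENNReal.div_le_iff (by simp [NeZero.ne n]) (by simp), one_div,
          ← ENNReal.div_eq_inv_mul, ENNReal.le_div_iff_mul_le (by simp) (by simp)]
        have h1 : 2 * (b + 1) ^ 4 * 3 ≤ n := by
          have : 6 * (b + 1) ^ 4 ≤ n := hn.poly
          omega
        exact_mod_cast h1

end FixedSize

/-! ### The distinguisher stops at stage o(log n). -/

theorem tendsto_clog : Tendsto (fun n : ℕ => Nat.clog 2 n) atTop atTop := by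
  refine tendsto_atTop.2 fun b => ?_
  filter_upwards [eventually_ge_atTop (2 ^ b)] with n hn
  have h := hn.trans (Nat.le_pow_clog (by norm_num : 1 < 2) n)
  exact (Nat.pow_le_pow_iff_right (by norm_num)).1 h

theorem eventually_mul_clog_pow_le (K d : ℕ) :
    ∀ᶠ n : ℕ in atTop, K * (Nat.clog 2 n + 1) ^ d ≤ n := by
  have h : ∀ᶠ b : ℕ in atTop, 4 * K * (b + 1) ^ d ≤ 2 ^ (b + 1) := by
    have h1 := tendsto_pow_const_div_const_pow_of_one_lt d (show (1 : ℝ) < 2 by norm_num)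
    have h2 := (h1.comp (tendsto_add_atTop_nat 1)).const_mul (4 * K : ℝ)
    rw [mul_zero] at h2
    filter_upwards [h2.eventually (gt_mem_nhds one_pos)] with b hb
    simp only [Function.comp_apply] at hb
    rw [← mul_div_assoc, div_lt_one (by positivity)] at hb
    exact_mod_cast hb.le
  filter_upwards [tendsto_clog.eventually h, eventually_ge_atTop 2] with n hn hn2
  have := two_pow_clog_le hn2
  rw [pow_succ, mul_assoc] at hn
  omega

theorem eventually_isLarge (c q a : ℕ) : ∀ᶠ n in atTop, IsLarge c q a n := by
  have h0 := eventually_mul_clog_pow_le (48 * c * (params c q).lam) 1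
  have h1 := eventually_mul_clog_pow_le ((4 * ((params c q).lam + 1)) ^ (4 * q)) (4 * q)
  filter_upwards [eventually_ge_atTop 400, eventually_ge_atTop a,
    eventually_ge_atTop (2 ^ (4 * q)), h0, h1, eventually_mul_clog_pow_le 6 4]
    with n e1 e2 e3 e4 e5 e6
  refine ⟨e1, e2, e3, le_trans ?_ e4, le_trans ?_ e5, e6⟩
  · rw [pow_one, ← mul_assoc]
    gcongr
    omega
  · rw [← mul_pow, ← mul_assoc]
    gcongr
    omega

/-- With m = ⌈x/h⌉, rounding gives hm < x + h, and x ≥ h² gives m ≥ h, so (h - 1)m < x. Hence every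
fixed `h` is realised exactly by some width once n is large, and `f k` becomes a constant. -/
theorem ceilDiv_ceilDiv {x h : ℕ} (hh : 0 < h) (hx : h * h ≤ x) : x ⌈/⌉ (x ⌈/⌉ h) = h := by
  have h1 : x ≤ h * (x ⌈/⌉ h) := le_smul_ceilDiv hh
  have h2 : h * (x ⌈/⌉ h) < x + h := by
    rw [Nat.ceilDiv_eq_add_pred_div]
    exact (Nat.mul_div_le _ _).trans_lt (by omega)
  set m := x ⌈/⌉ h
  have hm : 0 < m := by
    by_contra hcon
    have : m = 0 := by omega
    rw [this] at h1
    nlinarith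
  refine le_antisymm ((ceilDiv_le_iff_le_mul hm).2 (by rwa [mul_comm])) ?_
  by_contra! hlt
  have h3 : x ≤ m * (x ⌈/⌉ m) := le_smul_ceilDiv hm
  have h4 : m * (x ⌈/⌉ m) ≤ m * (h - 1) := Nat.mul_le_mul_left _ (by omega)
  obtain ⟨h, rfl⟩ : ∃ y, h = y + 1 := ⟨h - 1, by omega⟩
  rw [Nat.add_sub_cancel] at h4
  have h5 : h + 1 ≤ m := by nlinarith
  nlinarith

theorem eventually_exists_isBudget {c q : ℕ} (hc : 0 < c) (hq : 2 ≤ q) (f : ℕ → ℝ) {e : ℕ → ℝ}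
    (he : e =o[atTop] fun k : ℕ => (k : ℝ)) {ε : ℝ} (hε : 0 < ε) :
    ∀ᶠ n : ℕ in atTop, ∃ J : ℕ, (J : ℝ) ≤ ε * Nat.clog 2 n ∧ IsBudget c q f e n J := by
  set P := params c q with hP
  have hlam : 0 < P.lam := by
    change 0 < 2 ^ 15 * c ^ 2 * q ^ 3
    positivity
  have hlamR : (0 : ℝ) < P.lam := by exact_mod_cast hlam
  have hcR : (0 : ℝ) < c := by exact_mod_cast hc
  have hqR : (0 : ℝ) < q := by exact_mod_cast (by omega : 0 < q)
  -- With k = 8ch and hM ≤ 2λb this makes 4qM·|e k| at most 64qcλη·b = εb/4.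
  set η : ℝ := ε / (256 * q * P.lam * c) with hη
  have hη0 : 0 < η := by positivity
  obtain ⟨k₀, hk₀⟩ := eventually_atTop.1 (he.bound hη0)
  obtain ⟨h₁, hh₁⟩ := exists_nat_ge (8 * P.lam / ε)
  -- The term `k₀` puts k in the range where e(k) ≤ ηk, and `h₁` makes the width M at most εb/4.
  set h := k₀ + h₁ + 1 with hh
  have hhR : (0 : ℝ) < h := by positivity
  set k := 8 * c * h with hk
  have hkk : k₀ ≤ k := by
    rw [hk]
    calc k₀ ≤ h := by omega
      _ ≤ 8 * c * h := Nat.le_mul_of_pos_left _ (by positivity)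
  have hek : |e k| ≤ η * k := by simpa using hk₀ k hkk
  have hlh : 8 * P.lam ≤ ε * h := by
    have : 8 * P.lam / ε ≤ h := hh₁.trans (by rw [hh]; push_cast; linarith)
    rw [div_le_iff₀ hε] at this
    linarith
  obtain ⟨b₁, hb₁⟩ := exists_nat_ge (8 / ε)
  obtain ⟨n₁, hn₁⟩ := exists_nat_ge |f k|
  filter_upwards [tendsto_clog.eventually_ge_atTop (h * h + h * P.mu0 + b₁),
    eventually_ge_atTop n₁, eventually_ge_atTop 2] with n hb hn hn2
  set b := Nat.clog 2 n with hbdef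
  set x := P.lam * b with hx
  have hbx : b ≤ x := Nat.le_mul_of_pos_left _ hlam
  set M := x ⌈/⌉ h with hM
  have hsub : P.sub n M = k := by
    change 8 * c * (x ⌈/⌉ (x ⌈/⌉ h)) = k
    rw [ceilDiv_ceilDiv (by omega) (by omega)]
  have h1 : x ≤ h * M := le_smul_ceilDiv (show 0 < h by omega)
  have h2 : h * M < x + h := by
    rw [hM, Nat.ceilDiv_eq_add_pred_div]
    exact (Nat.mul_div_le _ _).trans_lt (by omega)
  have hM0 : P.mu0 ≤ M := by
    have : h * P.mu0 ≤ h * M := by omega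
    exact Nat.le_of_mul_le_mul_left this (by omega)
  have hbR : (8 : ℝ) ≤ ε * b := by
    have : 8 / ε ≤ b := hb₁.trans (by exact_mod_cast (by omega : b₁ ≤ b))
    rwa [div_le_iff₀ hε, mul_comm] at this
  have hMR : (h : ℝ) * M ≤ 2 * P.lam * b := by
    have : h * M ≤ 2 * P.lam * b := by nlinarith
    exact_mod_cast this
  have hMb : (M : ℝ) ≤ ε / 4 * b := by
    have h3 : (h : ℝ) * M ≤ h * (ε / 4 * b) := by
      have : 8 * P.lam * (b : ℝ) ≤ ε * h * b := by gcongr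
      linarith
    exact le_of_mul_le_mul_left h3 hhR
  -- The ceiling bounds the exponent in N^(e(k)), and the additional 1 pays for f(k) ≤ n.
  set j := ⌈4 * q * M * |e k|⌉₊ + 1 with hj
  have hjb : (j : ℝ) ≤ ε / 2 * b := by
    have g1 : 4 * q * M * |e k| ≤ ε / 4 * b := by
      calc 4 * q * M * |e k| ≤ 4 * q * M * (η * k) := by gcongr
        _ = 32 * q * c * η * (h * M) := by rw [hk]; push_cast; ring
        _ ≤ 32 * q * c * η * (2 * P.lam * b) := by gcongr
        _ = ε / 4 * b := by rw [hη]; field_simp; ring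
    have g2 := Nat.ceil_lt_add_one (show 0 ≤ 4 * q * M * |e k| by positivity)
    rw [hj]
    push_cast
    linarith
  refine ⟨M + j, ?_, M, hM0, by omega, ?_⟩
  · push_cast
    nlinarith
  · rw [hsub]
    have hn1 : (1 : ℝ) ≤ n := by exact_mod_cast (by omega : 1 ≤ n)
    have hsz : (P.size n M : ℝ) ^ e k ≤ (n : ℝ) ^ (⌈4 * q * M * |e k|⌉₊ : ℕ) := by
      have g0 : (P.size n M : ℝ) = (n : ℝ) ^ ((4 * (q - 1) * M : ℕ) : ℝ) := by
        rw [Real.rpow_natCast]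
        change ((n ^ (4 * (q - 1) * M) : ℕ) : ℝ) = _
        push_cast
        rfl
      rw [g0, ← Real.rpow_mul (by positivity), ← Real.rpow_natCast]
      refine Real.rpow_le_rpow_of_exponent_le hn1 ?_
      refine le_trans ?_ (Nat.le_ceil _)
      have g1 : ((4 * (q - 1) * M : ℕ) : ℝ) ≤ 4 * q * M := by
        exact_mod_cast Nat.mul_le_mul_right M (by omega : 4 * (q - 1) ≤ 4 * q)
      calc ((4 * (q - 1) * M : ℕ) : ℝ) * e k ≤ ((4 * (q - 1) * M : ℕ) : ℝ) * |e k| := by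
            gcongr; exact le_abs_self _
        _ ≤ _ := by gcongr
    have hf : f k ≤ n := (le_abs_self _).trans (hn₁.trans (by exact_mod_cast hn))
    calc f k * (P.size n M : ℝ) ^ e k ≤ n * (n : ℝ) ^ (⌈4 * q * M * |e k|⌉₊ : ℕ) := by gcongr
      _ = (n : ℝ) ^ j := by rw [hj, pow_succ']
      _ ≤ (n : ℝ) ^ (M + j) := pow_le_pow_right₀ hn1 (by omega)

/-- The first stage at which the distinguisher is certain to stop. -/
def budget (c q : ℕ) (f e : ℕ → ℝ) (n : ℕ) : ℕ := sInf {J | IsBudget c q f e n J}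

theorem eventually_isBudget_budget {c q : ℕ} (hc : 0 < c) (hq : 2 ≤ q) (f : ℕ → ℝ) {e : ℕ → ℝ}
    (he : e =o[atTop] fun k : ℕ => (k : ℝ)) {ε : ℝ} (hε : 0 < ε) :
    ∀ᶠ n : ℕ in atTop, (budget c q f e n : ℝ) ≤ ε * Nat.clog 2 n ∧
      IsBudget c q f e n (budget c q f e n) := by
  filter_upwards [eventually_exists_isBudget hc hq f he hε] with n ⟨J, hJ, hB⟩
  refine ⟨le_trans ?_ hJ, Nat.sInf_mem (s := {J | IsBudget c q f e n J}) ⟨J, hB⟩⟩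
  exact_mod_cast Nat.sInf_le (s := {J | IsBudget c q f e n J}) hB

theorem clog_le_log {n : ℕ} (hn : 2 ≤ n) : (Nat.clog 2 n : ℝ) ≤ 4 * Real.log n := by
  have h1 := two_pow_clog_le hn
  have hn' : (2 : ℝ) ≤ n := by exact_mod_cast hn
  have h2 : (2 : ℝ) ^ Nat.clog 2 n ≤ 2 * n := by exact_mod_cast h1
  have h3 := Real.log_le_log (by positivity) h2
  rw [Real.log_pow, Real.log_mul (by norm_num) (by positivity)] at h3
  have h4 := Real.log_le_log (by norm_num) hn'
  have h5 := Real.log_two_gt_d9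
  nlinarith [(Nat.cast_nonneg (Nat.clog 2 n) : (0 : ℝ) ≤ Nat.clog 2 n)]

/-- The size `k` used to bound the stage depends on ε, but `budget`, as the least possible stage,
does not; so the bounds for all ε apply to the same function. -/
theorem budget_isLittleO {c q : ℕ} (hc : 0 < c) (hq : 2 ≤ q) (f : ℕ → ℝ) {e : ℕ → ℝ}
    (he : e =o[atTop] fun k : ℕ => (k : ℝ)) :
    (fun n => (budget c q f e n : ℝ)) =o[atTop] fun n : ℕ => Real.log n := by
  refine isLittleO_iff.2 fun ε hε => ?_
  filter_upwards [eventually_isBudget_budget hc hq f he (show 0 < ε / 4 by positivity),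
    eventually_ge_atTop 2] with n hn hn2
  have h1 := clog_le_log hn2
  have h2 : (0 : ℝ) ≤ Real.log n := Real.log_natCast_nonneg n
  rw [Real.norm_of_nonneg (by positivity), Real.norm_of_nonneg h2]
  nlinarith [hn.1]

theorem runsInTimeLittleOLog_mainProg {A : Prog} {f e : ℕ → ℝ} {C : ℝ} {c q : ℕ}
    (hA : RunsInTimeDkS A f e) (hA' : ApproximatesDkSPerfectCompleteness A C) (hC : C ≤ c)
    (hc : 0 < c) (hq : 2 ≤ q) (he : e =o[atTop] fun k : ℕ => (k : ℝ)) :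
    RunsInTimeLittleOLog (mainProg (params c q) A) := by
  refine ⟨fun n => (9 * (4 * q * budget c q f e n + 1) : ℕ), ?_, ?_⟩
  · have h1 : (fun _ : ℕ => (9 : ℝ)) =o[atTop] fun n : ℕ => Real.log n :=
      isLittleO_const_left.2 (Or.inr (tendsto_norm_atTop_atTop.comp
        (Real.tendsto_log_atTop.comp tendsto_natCast_atTop_atTop)))
    have h2 := ((budget_isLittleO hc hq f he).const_mul_left (36 * q : ℝ)).add h1
    refine h2.congr_left fun n => ?_
    push_cast
    ring
  · filter_upwards [eventually_isLarge c q A.clockCost,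
      eventually_isBudget_budget hc hq f he one_pos] with n hn hB G
    have hJ : budget c q f e n ≤ Nat.clog 2 n := by
      have := hB.1
      rw [one_mul] at this
      exact_mod_cast this
    have := haltsWithin_mainProg hA hA' hC hc hq hn hJ hB.2 G
    rw [Real.rpow_natCast]
    exact_mod_cast this

end RAM

/-! ### Refuting the planted clique hypothesis. -/

theorem isClique_addClique {n : ℕ} (G : SimpleGraph (Fin n)) (S : Finset (Fin n)) :
    (addClique G S).IsClique S := by
  intro u hu v hv hne
  exact Or.inr ((SimpleGraph.fromRel_adj _ u v).2 ⟨hne, Or.inl ⟨hu, hv⟩⟩)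

/-- Every graph in the support contains a `κ`-clique, so a worst-case bound over such graphs passes
to the average. -/
theorem le_acceptProb_plantedClique {n κ : ℕ} {A : RAM.Prog} {x : ℝ≥0∞} (hκ : κ ≤ n)
    (h : ∀ (G : SimpleGraph (Fin n)) (S : Finset (Fin n)), S.card = κ → G.IsClique S →
      x ≤ RAM.outputProb A (RAM.input G 0) RAM.accepting) :
    x ≤ acceptProb A (plantedClique n κ) := by
  rw [acceptProb, plantedClique, lintegral_finsetSum_measure]
  have hc : (n.choose κ : ℝ≥0∞) ≠ 0 := by exact_mod_cast (Nat.choose_pos hκ).ne'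
  calc x = (n.choose κ : ℝ≥0∞) * ((n.choose κ : ℝ≥0∞)⁻¹ * x) := by
        rw [← mul_assoc, ENNReal.mul_inv_cancel hc (by simp), one_mul]
    _ = ∑ S ∈ (Finset.univ : Finset (Fin n)).powersetCard κ, (n.choose κ : ℝ≥0∞)⁻¹ * x := by
        rw [Finset.sum_const, nsmul_eq_mul, Finset.card_powersetCard, Finset.card_univ,
          Fintype.card_fin]
    _ ≤ _ := by
        refine Finset.sum_le_sum fun S hS => ?_
        rw [lintegral_smul_measure, lintegral_map .of_discrete .of_discrete, smul_eq_mul]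
        gcongr
        calc x = ∫⁻ _, x ∂erdosRenyiHalf n := by simp
          _ ≤ _ := lintegral_mono fun G =>
            h _ S (Finset.mem_powersetCard.1 hS).2 (isClique_addClique G S)

theorem not_approximatesDkSPerfectCompleteness (hSPCH : StrongishPlantedCliqueHypothesis) {C : ℝ}
    {f e : ℕ → ℝ} (he : e =o[atTop] (fun k : ℕ => (k : ℝ))) {A : RAM.Prog}
    (hA : RunsInTimeDkS A f e) : ¬ ApproximatesDkSPerfectCompleteness A C := by
  intro hA'
  obtain ⟨δ, hδ0, hδ, hno⟩ := hSPCH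
  obtain ⟨c, hcC⟩ := exists_nat_ge C
  -- From δq ≥ 2 a clique with at least n^δ vertices satisfies |S|^q ≥ n².
  obtain ⟨q, hq⟩ := exists_nat_ge (2 / δ)
  have hC : C ≤ (c + 1 : ℕ) := hcC.trans (by push_cast; linarith)
  have hqδ : 2 ≤ δ * q := by rwa [div_le_iff₀ hδ0, mul_comm] at hq
  have hq2 : 2 ≤ q := by
    have : (2 : ℝ) ≤ q := by nlinarith [(Nat.cast_nonneg q : (0 : ℝ) ≤ q)]
    exact_mod_cast this
  refine hno ⟨RAM.mainProg (RAM.params (c + 1) q) A,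
    RAM.runsInTimeLittleOLog_mainProg hA hA' hC c.succ_pos hq2 he, ?_⟩
  filter_upwards [RAM.eventually_isLarge (c + 1) q A.clockCost,
    RAM.eventually_isBudget_budget c.succ_pos hq2 f he one_pos] with n hn hB
  have hJ : RAM.budget (c + 1) q f e n ≤ Nat.clog 2 n := by
    have := hB.1
    rw [one_mul] at this
    exact_mod_cast this
  have hn1 : (1 : ℝ) ≤ n := by exact_mod_cast (by have := hn.large; omega : 1 ≤ n)
  refine ⟨le_acceptProb_plantedClique ?_ fun G S hS hcl => ?_, ?_⟩
  · refine Nat.ceil_le.2 ?_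
    calc (n : ℝ) ^ δ ≤ (n : ℝ) ^ (1 : ℝ) := Real.rpow_le_rpow_of_exponent_le hn1 (by linarith)
      _ = n := Real.rpow_one _
  · refine RAM.two_thirds_le_outputProb hA hA' hC c.succ_pos hq2 hn hJ hB.2 hcl ?_
    have h1 : (n : ℝ) ^ 2 ≤ (S.card : ℝ) ^ q := by
      calc (n : ℝ) ^ 2 = (n : ℝ) ^ (2 : ℝ) := by norm_cast
        _ ≤ (n : ℝ) ^ (δ * q) := Real.rpow_le_rpow_of_exponent_le hn1 hqδ
        _ = ((n : ℝ) ^ δ) ^ q := by rw [Real.rpow_mul (by positivity), Real.rpow_natCast]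
        _ ≤ (S.card : ℝ) ^ q := by
            gcongr
            rw [hS]
            exact Nat.le_ceil _
    exact_mod_cast h1
  · exact RAM.lintegral_outputProb_le hA hA' hC c.succ_pos hq2 hn hJ hB.2

theorem mainTheorem2 (hSPCH : StrongishPlantedCliqueHypothesis) (C : ℝ) (hC : 0 < C)
    (f e : ℕ → ℝ) (he : e =o[atTop] (fun k : ℕ => (k : ℝ))) :
    (¬ ∃ A : RAM.Prog, RunsInTimeDkS A f e ∧ ApproximatesDkS A C) ∧
    (¬ ∃ A : RAM.Prog, RunsInTimeDkS A f e ∧ ApproximatesDkSPerfectCompleteness A C) := by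
  refine ⟨?_, ?_⟩
  -- An algorithm for all instances is in particular one for the instances with a `k`-clique.
  · rintro ⟨A, hA, hA'⟩
    exact not_approximatesDkSPerfectCompleteness hSPCH he hA
      fun n k h1 h2 G _ => hA' n k h1 h2 G
  · rintro ⟨A, hA, hA'⟩
    exact not_approximatesDkSPerfectCompleteness hSPCH he hA hA'

end
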